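/- Let $M$ be a smooth Hausdorff $4$-manifold and $E\to M$ a smooth real vector bundle with structure group $G\subset GL(V)$, whose Lie algebra $\mathfrak g\subset\mathrm{End}\,V$ carries an $\mathrm{Ad}(G)$-invariant symmetric pairing $\langle\ ,\ \rangle$. Consider smooth fields $s=(\phi,\kappa,g,\Gamma)$: a matter field $\phi$ (a section of $E$), a gauge field $\kappa$ (a linear connection of $E$ with $\mathfrak g$-valued components in the $G$-trivializations, $\nabla_a\phi=\partial_a\phi-\kappa_a\phi$), a pseudo-Riemannian metric $g$ and a torsion-free linear connection $\Gamma$ of $TM$ ($\nabla_av^b=\partial_av^b-\Gamma_a{}^b{}_cv^c$), the last two being independent. Let $\mathcal L=\mathcal L_{\rm grav}+\mathcal L_{\rm matter}+\mathcal L_{\rm gauge}=\ell\,d^4x$ with $$\ell_{\rm grav}=R\sqrt{|g|},\quad \ell_{\rm gauge}=-\tfrac14 g^{ac}g^{bd}\langle\rho_{ab},\rho_{cd}\rangle\sqrt{|g|},\quad \ell_{\rm matter}=\lambda(x,g,\phi,\nabla\phi)\sqrt{|g|},$$ where $\rho_{ab}=\kappa_{a,b}-\kappa_{b,a}+[\kappa_a,\kappa_b]$,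 $R_{ab}{}^c{}_d$ is given by the same expression in $\Gamma_a{}^c{}_d$, $R_{ac}=R_{ab}{}^b{}_c$, $R=g^{ac}R_{ac}$, $G_{ab}=R_{ab}-\tfrac12Rg_{ab}$, and $\lambda$ is smooth. Denote by $y^i$ the fibre coordinates of the total bundle $Z\to M$ of the fields (in the $\Gamma$ sector, the bundle of all linear connections of $TM$), and let $$\mathcal C=\ell\,d^4x+\frac{\partial\ell}{\partial y^i_a}\,(dy^i-y^i_b\,dx^b)\wedge dx_a,\qquad dx_a=i_{\partial_a}d^4x,$$ be the total Poincaré–Cartan form on the first jet bundle of $Z$. For a smooth vector field $X$ on $M$ let $Y[X]=X^a(\partial_a+K_a)$ be its horizontal lift to $Z$ for the connection $K$ determined by $(\kappa,\Gamma)$: on the matter sector $\kappa_a\phi$; on the gauge sector $$\kappa_{a,b}+[\kappa_a,y_b]+\Gamma_a{}^c{}_b(\kappa_c-y_c);$$ on the metric sector $-\Gamma_a{}^d{}_b\,y_{dc}-\Gamma_a{}^d{}_c\,y_{bd}$; on the $\Gamma$ sector $$\Gamma_a{}^c{}_{d,b}-\Gamma_a{}^e{}_d\,y_b{}^c{}_e+\Gamma_a{}^c{}_e\,y_b{}^e{}_d+\Gamma_a{}^e{}_b(\Gamma_e{}^c{}_d-y_e{}^c{}_d).$$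 Suppose that $\Gamma$ satisfies its own field equation (the Euler–Lagrange equation of $\mathcal L$ for variations of $\Gamma$ among symmetric connections), and that $i_{Y[X]}\mathcal C$ is conserved along $s$ for every smooth vector field $X$ on $M$, that is, $(\mathrm js)^*\,d(i_{Y[X]}\mathcal C)=0$. Then the Einstein field equations hold: $$G^a{}_b\sqrt{|g|}=-\bigl(T_{\rm matter}+T_{\rm gauge}\bigr)^a{}_b,\qquad T=-\tfrac12U,\qquad U^a{}_b=\ell\,\delta^a_b-\frac{\partial\ell}{\partial y^i_a}\,\nabla_bs^i,$$ where $U$ is the canonical energy-tensor of the matter, respectively gauge, Lagrangian and $\nabla_bs^i=\partial_bs^i-K_b^i\circ s$. If moreover $\mathcal L_{\rm matter}$ is natural, i.e. $\lambda$ is invariant under linear automorphisms of the tangent spaces (acting on $g$ and $\nabla\phi$), then they also hold with the stress-energy tensors $T_{ab}=\partial\ell/\partial g^{ab}$: $$G_{ab}\sqrt{|g|}=-\Bigl(\frac{\partial\ell_{\rm matter}}{\partial g^{ab}}+\frac{\partial\ell_{\rm gauge}}{\partial g^{ab}}\Bigr).$$ -/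

import Mathlib

open Bundle Set Filter Topology
open scoped Manifold ContDiff

noncomputable section

namespace MetricAffine

/-! ## Coordinate spaces -/

/-- The coordinate space of a four-dimensional spacetime. -/
abbrev Base : Type := EuclideanSpace ℝ (Fin 4)

/-- The coordinate vector `∂_a`. -/
def stdVec (a : Fin 4) : Base := EuclideanSpace.single a (1 : ℝ)

/-- The coordinate one-form `dx^a`. -/
def stdCovec (a : Fin 4) : Base →L[ℝ] ℝ := EuclideanSpace.proj a

/-- The coordinate volume form `d⁴x`. -/
def vol : Base [⋀^Fin 4]→L[ℝ] ℝ where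
  __ := (Matrix.detRowAlternating (n := Fin 4) (R := ℝ)).compLinearMap
    (WithLp.linearEquiv 2 ℝ (Fin 4 → ℝ)).toLinearMap
  cont := by
    change Continuous fun v : Fin 4 → Base => Matrix.det (Matrix.of fun i j => v i j)
    fun_prop

/-- The three-form `dx_a = i(∂_a) d⁴x`. -/
def vol3 (a : Fin 4) : Base [⋀^Fin 3]→L[ℝ] ℝ := vol.curryLeft (stdVec a)

/-- The exterior product `α ∧ β` of a one-form and a `k`-form. -/
def wedge {T : Type*} [NormedAddCommGroup T] [NormedSpace ℝ T] {k : ℕ}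
    (α : T →L[ℝ] ℝ) (β : T [⋀^Fin k]→L[ℝ] ℝ) : T [⋀^Fin (k + 1)]→L[ℝ] ℝ :=
  ContinuousAlternatingMap.alternatizeUncurryFin (α.smulRight β)

/-! ## First-order Lagrangian field theory in a fibred chart

`F` is the space of fibre coordinates `y`. The jet coordinates `(x, y, z)` of a section `s` are
`x`, `s x` and the derivative of `s` at `x`, so that `z (∂_a)` is the family of the `y^i_a`. -/

section FieldTheory

variable {F : Type*} [NormedAddCommGroup F] [NormedSpace ℝ F]

/-- The space of the jet coordinates `(x, y, z)`. -/
abbrev Jet (F : Type*) [NormedAddCommGroup F] [NormedSpace ℝ F] : Type _ :=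
  Base × F × (Base →L[ℝ] F)

/-- The first jet prolongation of a section. -/
def jet (s : Base → F) (x : Base) : Jet F := (x, s x, fderiv ℝ s x)

/-- The momentum components `P^a_i = ∂ℓ/∂y^i_a`, as linear forms in the index `i`. -/
def momentum (ℓ : Jet F → ℝ) (j : Jet F) (a : Fin 4) : F →L[ℝ] ℝ :=
  (fderiv ℝ (fun z => ℓ (j.1, j.2.1, z)) j.2.2).comp
    (ContinuousLinearMap.smulRightL ℝ Base F (stdCovec a))

/-- The contact one-form `ϑ^i = dy^i - y^i_a dx^a`. -/
def contact (j : Jet F) : Jet F →L[ℝ] F :=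
  (ContinuousLinearMap.fst ℝ F (Base →L[ℝ] F)).comp
      (ContinuousLinearMap.snd ℝ Base (F × (Base →L[ℝ] F)))
    - j.2.2.comp (ContinuousLinearMap.fst ℝ Base (F × (Base →L[ℝ] F)))

/-- The Poincaré–Cartan form `ℓ d⁴x + P^a_i ϑ^i ∧ dx_a` on the jet space. -/
def poincareCartan (ℓ : Jet F → ℝ) (j : Jet F) : Jet F [⋀^Fin 4]→L[ℝ] ℝ :=
  ℓ j • vol.compContinuousLinearMap (ContinuousLinearMap.fst ℝ Base (F × (Base →L[ℝ] F)))
    + ∑ a, wedge ((momentum ℓ j a).comp (contact j))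
        ((vol3 a).compContinuousLinearMap
          (ContinuousLinearMap.fst ℝ Base (F × (Base →L[ℝ] F))))

/-- The current `i_Y C`. Here `Y` is a vector field on the total space, in coordinates a vector
field `(x, y) ↦ (Y^a, Y^i)`; it is inserted in `C` through its extension to the jet space with
vanishing jet components. (The form `C` is annihilated by the vertical vectors of the projection
`(x, y, z) ↦ (x, y)`, so that every extension gives the same form `i_Y C`.) -/
def current (ℓ : Jet F → ℝ) (Y : Base × F → Base × F) (j : Jet F) : Jet F [⋀^Fin 3]→L[ℝ] ℝ :=
  (poincareCartan ℓ j).curryLeft ((Y (j.1, j.2.1)).1, (Y (j.1, j.2.1)).2, 0)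

/-- The form `(js)^* dJ`, for a three-form `J` on the jet space. -/
def pullbackDeriv (J : Jet F → Jet F [⋀^Fin 3]→L[ℝ] ℝ) (s : Base → F) (x : Base) :
    Base [⋀^Fin 4]→L[ℝ] ℝ :=
  (extDeriv J (jet s x)).compContinuousLinearMap (fderiv ℝ (jet s) x)

/-- The component of the Euler–Lagrange expression `∂_i ℓ - d_a ∂^a_i ℓ`, evaluated along `s`,
in the direction `δ = (δ^i)`. -/
def eulerLagrange (ℓ : Jet F → ℝ) (s : Base → F) (x : Base) (δ : F) : ℝ :=
  fderiv ℝ (fun y => ℓ (x, y, fderiv ℝ s x)) (s x) δ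
    - ∑ a, fderiv ℝ (fun x' => momentum ℓ (jet s x') a δ) x (stdVec a)

/-- The components `U^a_b = ℓ δ^a_b - P^a_i (∂_b s^i - K_b^i)` of the canonical energy-tensor of
`ℓ` along `s`, where `K_b` are the components of a connection of the total space. -/
def energyTensor (ℓ : Jet F → ℝ) (K : Base → F → Fin 4 → F) (s : Base → F) (x : Base)
    (a b : Fin 4) : ℝ :=
  (if a = b then ℓ (jet s x) else 0)
    - momentum ℓ (jet s x) a (fderiv ℝ s x (stdVec b) - K x (s x) b)

end FieldTheory

/-! ## Fibre coordinates of the total bundle -/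

/-- The symmetric `4 × 4` arrays `g_{ab}`. -/
def SymForm : Submodule ℝ (Fin 4 → Fin 4 → ℝ) where
  carrier := {g | ∀ a b, g a b = g b a}
  add_mem' hg hh a b := by simp [hg a b, hh a b]
  zero_mem' _ _ := rfl
  smul_mem' r g hg a b := by simp [hg a b]

/-- The inverse array `g^{ab}`. -/
def symInv (g : SymForm) : SymForm :=
  ⟨fun a b => (Matrix.of (g : Fin 4 → Fin 4 → ℝ))⁻¹ a b, fun a b => by
    have h : (Matrix.of (g : Fin 4 → Fin 4 → ℝ)).transpose = Matrix.of g := by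
      ext i j; exact g.2 j i
    have h' := Matrix.transpose_nonsing_inv (Matrix.of (g : Fin 4 → Fin 4 → ℝ))
    rw [h] at h'
    exact (congrFun (congrFun h' b) a)⟩

/-- The density `√|det g|`. -/
def sqrtDet (g : SymForm) : ℝ := Real.sqrt |(Matrix.of (g : Fin 4 → Fin 4 → ℝ)).det|

/-- The symmetrized elementary array. -/
def symUnit (a b : Fin 4) : SymForm :=
  ⟨fun c d => ((if c = a ∧ d = b then 1 else 0) + (if c = b ∧ d = a then 1 else 0)) / 2,
    fun c d => by simp only [add_comm, and_comm]⟩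

/-- A structure group `G` of linear automorphisms of the typical fibre `V`, with its Lie algebra
and an `Ad(G)`-invariant symmetric pairing on the Lie algebra. (For instance the unitary group of a
Hermitian space, the anti-Hermitian endomorphisms and `Re Tr (A† ∘ B)`.) -/
structure GaugeGroup (V : Type*) [NormedAddCommGroup V] [NormedSpace ℝ V] where
  G : Subgroup (V →L[ℝ] V)ˣ
  lie : Submodule ℝ (V →L[ℝ] V)
  mem_lie_iff : ∀ A : V →L[ℝ] V,
    A ∈ lie ↔ ∀ t : ℝ, ∃ u ∈ G, (u : V →L[ℝ] V) = NormedSpace.exp (t • A)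
  bracket_mem : ∀ A ∈ lie, ∀ B ∈ lie, A * B - B * A ∈ lie
  pairing : lie →ₗ[ℝ] lie →ₗ[ℝ] ℝ
  pairing_symm : ∀ A B, pairing A B = pairing B A
  pairing_ad : ∀ u ∈ G, ∀ A B A' B' : lie,
    (A' : V →L[ℝ] V) = (u : V →L[ℝ] V) * A * (u⁻¹ : (V →L[ℝ] V)ˣ) →
    (B' : V →L[ℝ] V) = (u : V →L[ℝ] V) * B * (u⁻¹ : (V →L[ℝ] V)ˣ) →
    pairing A' B' = pairing A B

section Model

variable {V : Type*} [NormedAddCommGroup V] [NormedSpace ℝ V] (𝔊 : GaugeGroup V)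

instance GaugeGroup.instNormedAddCommGroupLie : NormedAddCommGroup 𝔊.lie :=
  Submodule.normedAddCommGroup _

instance GaugeGroup.instNormedSpaceLie : NormedSpace ℝ 𝔊.lie := Submodule.normedSpace _

/-- The commutator of the Lie algebra. -/
def GaugeGroup.bracket (A B : 𝔊.lie) : 𝔊.lie :=
  ⟨(A : V →L[ℝ] V) * B - B * A, 𝔊.bracket_mem A A.2 B B.2⟩

/-- The fibre coordinates `(φ^i, κ_a, g_{ab}, Γ_a^b_c)` of the total bundle: matter sector, gauge
sector (with `κ_a` valued in the Lie algebra), metric sector, and sector of the linear connections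
of the tangent bundle. The coefficient `Γ_a^b_c` is `y.conn a b c`. -/
abbrev Fibre : Type _ :=
  V × (Fin 4 → 𝔊.lie) × SymForm × (Fin 4 → Fin 4 → Fin 4 → ℝ)

variable {𝔊}

abbrev Fibre.matter (y : Fibre 𝔊) : V := y.1
abbrev Fibre.gauge (y : Fibre 𝔊) : Fin 4 → 𝔊.lie := y.2.1
abbrev Fibre.metric (y : Fibre 𝔊) : SymForm := y.2.2.1
abbrev Fibre.conn (y : Fibre 𝔊) : Fin 4 → Fin 4 → Fin 4 → ℝ := y.2.2.2

/-- The derivative coordinates `y_{,a}`. -/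
def dcoord (j : Jet (Fibre 𝔊)) (a : Fin 4) : Fibre 𝔊 := j.2.2 (stdVec a)

/-- The covariant derivative `∇_a φ = φ_{,a} - κ_a φ`. -/
def covMatter (j : Jet (Fibre 𝔊)) (a : Fin 4) : V :=
  (dcoord j a).matter - (j.2.1.gauge a : V →L[ℝ] V) j.2.1.matter

/-- The gauge curvature `ρ_{ab} = κ_{a,b} - κ_{b,a} + [κ_a, κ_b]`. -/
def gaugeCurv (j : Jet (Fibre 𝔊)) (a b : Fin 4) : 𝔊.lie :=
  (dcoord j b).gauge a - (dcoord j a).gauge b + 𝔊.bracket (j.2.1.gauge a) (j.2.1.gauge b)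

/-- The spacetime curvature `R_{ab}^c_d` (it is the same expression in the coefficients
`Γ_a^c_d`). -/
def riemann (j : Jet (Fibre 𝔊)) (a b c d : Fin 4) : ℝ :=
  (dcoord j b).conn a c d - (dcoord j a).conn b c d
    + ∑ e, (j.2.1.conn a c e * j.2.1.conn b e d - j.2.1.conn b c e * j.2.1.conn a e d)

/-- The Ricci tensor `R_{ac} = R_{ab}^b_c`. -/
def ricci (j : Jet (Fibre 𝔊)) (a c : Fin 4) : ℝ := ∑ b, riemann j a b b c

/-- The scalar curvature `R = g^{ac} R_{ac}`. -/
def scalarCurv (j : Jet (Fibre 𝔊)) : ℝ :=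
  ∑ a, ∑ c, (symInv j.2.1.metric : Fin 4 → Fin 4 → ℝ) a c * ricci j a c

/-- The Einstein tensor `G_{ab} = R_{ab} - ½ R g_{ab}`. -/
def einstein (j : Jet (Fibre 𝔊)) (a b : Fin 4) : ℝ :=
  ricci j a b - 1 / 2 * scalarCurv j * (j.2.1.metric : Fin 4 → Fin 4 → ℝ) a b

/-- The Einstein tensor with mixed indices, `G^a_b = g^{ac} G_{cb}`. -/
def einsteinMixed (j : Jet (Fibre 𝔊)) (a b : Fin 4) : ℝ :=
  ∑ c, (symInv j.2.1.metric : Fin 4 → Fin 4 → ℝ) a c * einstein j c b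

/-- The gravitational Lagrangian `R √|g|`. -/
def lagGrav (j : Jet (Fibre 𝔊)) : ℝ := scalarCurv j * sqrtDet j.2.1.metric

/-- The gauge Lagrangian `-¼ g^{ac} g^{bd} ⟨ρ_{ab}, ρ_{cd}⟩ √|g|`. -/
def lagGauge (j : Jet (Fibre 𝔊)) : ℝ :=
  -(1 / 4) * (∑ a, ∑ b, ∑ c, ∑ d,
    (symInv j.2.1.metric : Fin 4 → Fin 4 → ℝ) a c * (symInv j.2.1.metric : Fin 4 → Fin 4 → ℝ) b d *
      𝔊.pairing (gaugeCurv j a b) (gaugeCurv j c d)) * sqrtDet j.2.1.metric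

/-- The stress-energy tensor `T_{ab} = ∂ℓ/∂g^{ab}`, the symmetric array such that the derivative
of `ℓ` with respect to the inverse metric, in the direction `δg^{ab}`, is `T_{ab} δg^{ab}`. -/
def stressTensor (ℓ : Jet (Fibre 𝔊) → ℝ) (j : Jet (Fibre 𝔊)) (a b : Fin 4) : ℝ :=
  fderiv ℝ (fun h : SymForm =>
      ℓ (j.1, (j.2.1.matter, j.2.1.gauge, symInv h, j.2.1.conn), j.2.2))
    (symInv j.2.1.metric) (symUnit a b)

/-- The connection of the total bundle determined by the gauge field and the spacetime connection
of a section `s`. On the matter sector it is `κ`; on the gauge sector it is the overconnection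
`(κ↑_a)_b = κ_{a,b} + [κ_a, y_b] + Γ_a^c_b (κ_c - y_c)`; on the metric sector it is the one induced
by `Γ` on covariant tensors; on the sector of the spacetime connections it is the overconnection
`(Γ↑_a)_b^c_d = Γ_a^c_{d,b} - Γ_a^e_d y_b^c_e + y_b^e_d Γ_a^c_e + Γ_a^e_b (Γ_e^c_d - y_e^c_d)`. -/
def prolongConn (s : Base → Fibre 𝔊) (x : Base) (y : Fibre 𝔊) (a : Fin 4) : Fibre 𝔊 :=
  ((((s x).gauge a : V →L[ℝ] V) y.matter),
   (fun b => (fderiv ℝ s x (stdVec b)).gauge a + 𝔊.bracket ((s x).gauge a) (y.gauge b)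
      + ∑ c, (s x).conn a c b • ((s x).gauge c - y.gauge c)),
   ⟨fun b c => -∑ d, ((s x).conn a d b * (y.metric : Fin 4 → Fin 4 → ℝ) d c
      + (s x).conn a d c * (y.metric : Fin 4 → Fin 4 → ℝ) d b), fun b c => by
        simp only [add_comm]⟩,
   (fun b c d => (fderiv ℝ s x (stdVec b)).conn a c d
      + ∑ e, (-(s x).conn a e d * y.conn b c e + y.conn b e d * (s x).conn a c e
        + (s x).conn a e b * ((s x).conn e c d - y.conn e c d))))

/-- The prolongation `Y[X] = X^a (∂_a + K_a)` of a vector field `X` on the base, where `K` is the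
connection determined by the gauge field and the spacetime connection of `s`. -/
def prolong (s : Base → Fibre 𝔊) (X : Base → Base) (q : Base × Fibre 𝔊) : Base × Fibre 𝔊 :=
  (X q.1, ∑ a, X q.1 a • prolongConn s q.1 q.2 a)

/-- The variations of the spacetime connection within the symmetric connections. -/
def IsConnVariation (δ : Fibre 𝔊) : Prop :=
  δ.matter = 0 ∧ δ.gauge = 0 ∧ δ.metric = 0 ∧ ∀ a b c, δ.conn a b c = δ.conn c b a

end Model

/-! ## Fields on a spacetime manifold -/

section Manifold

variable {V : Type*} [NormedAddCommGroup V] [NormedSpace ℝ V] [FiniteDimensional ℝ V]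
  {M : Type*} [TopologicalSpace M] [ChartedSpace Base M]

/-- The coordinate vector field `∂_a` of a chart. -/
def coordVec (c : OpenPartialHomeomorph M Base) (p : M) (a : Fin 4) :
    TangentSpace 𝓘(ℝ, Base) p :=
  (mfderiv 𝓘(ℝ, Base) 𝓘(ℝ, Base) c p).inverse (stdVec a)

/-- The coordinate one-form `dx^a` of a chart. -/
def coordCovec (c : OpenPartialHomeomorph M Base) (p : M) (a : Fin 4) :
    TangentSpace 𝓘(ℝ, Base) p →L[ℝ] ℝ :=
  (stdCovec a).comp (mfderiv 𝓘(ℝ, Base) 𝓘(ℝ, Base) c p)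

/-- The coordinate expression `X^a` of a vector field. -/
def coordField (c : OpenPartialHomeomorph M Base) (X : Π p : M, TangentSpace 𝓘(ℝ, Base) p)
    (x : Base) : Base :=
  mfderiv 𝓘(ℝ, Base) 𝓘(ℝ, Base) c (c.symm x) (X (c.symm x))

variable {E : M → Type*} [TopologicalSpace (TotalSpace V E)]
  [∀ p, AddCommGroup (E p)] [∀ p, Module ℝ (E p)] [∀ p, TopologicalSpace (E p)]
  [∀ p, IsTopologicalAddGroup (E p)] [∀ p, ContinuousSMul ℝ (E p)]
  [FiberBundle V E] [VectorBundle ℝ V E]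

/-- The coordinate domain of a chart `c` of `M` together with a local trivialization `τ`. -/
def coordDomain (c : OpenPartialHomeomorph M Base)
    (τ : Trivialization V (TotalSpace.proj : TotalSpace V E → M)) : Set Base :=
  c.target ∩ c.symm ⁻¹' τ.baseSet

/-- The transition functions of the bundle take values in the structure group. -/
def HasStructureGroup (𝔊 : GaugeGroup V) (E : M → Type*) [TopologicalSpace (TotalSpace V E)]
    [∀ p, AddCommGroup (E p)] [∀ p, TopologicalSpace (E p)] [FiberBundle V E] : Prop :=
  ∀ τ ∈ trivializationAtlas V E, ∀ τ' ∈ trivializationAtlas V E, ∀ p ∈ τ.baseSet ∩ τ'.baseSet,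
    ∃ u ∈ 𝔊.G, ∀ v : V, (τ' ⟨p, τ.symm p v⟩).2 = (u : V →L[ℝ] V) v

/-- `A` is the component `κ_a` at the point of coordinates `x`, with the sign convention
`∇_a φ = ∂_a φ - κ_a φ`: one has `∇_a e = -A e` for every constant section `e` of the
trivialization. -/
def IsGaugeCoeff (κ : CovariantDerivative 𝓘(ℝ, Base) V E) (c : OpenPartialHomeomorph M Base)
    (τ : Trivialization V (TotalSpace.proj : TotalSpace V E → M)) (x : Base) (a : Fin 4)
    (A : V →L[ℝ] V) : Prop :=
  ∀ v : V, (τ ⟨c.symm x, κ (fun p => τ.symm p v) (c.symm x) (coordVec c (c.symm x) a)⟩).2 = -A v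

/-- Interacting fields on a spacetime `M`: a matter field (a section of `E`), a gauge field (a
linear connection of `E` preserving the fibre structure), a pseudo-Riemannian metric and a
symmetric linear connection of the tangent bundle. -/
structure Fields [IsManifold 𝓘(ℝ, Base) ∞ M] (𝔊 : GaugeGroup V) (E : M → Type*)
    [TopologicalSpace (TotalSpace V E)] [∀ p, AddCommGroup (E p)] [∀ p, Module ℝ (E p)]
    [∀ p, TopologicalSpace (E p)] [∀ p, IsTopologicalAddGroup (E p)]
    [∀ p, ContinuousSMul ℝ (E p)] [FiberBundle V E] [VectorBundle ℝ V E]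
    [ContMDiffVectorBundle ∞ V E 𝓘(ℝ, Base)] where
  φ : Π p : M, E p
  φ_smooth : ContMDiff 𝓘(ℝ, Base) (𝓘(ℝ, Base).prod 𝓘(ℝ, V)) ∞
    (fun p => TotalSpace.mk' V p (φ p))
  κ : CovariantDerivative 𝓘(ℝ, Base) V E
  κ_smooth : CovariantDerivative.ContMDiffCovariantDerivative κ ∞
  κ_mem : ∀ c ∈ IsManifold.maximalAtlas 𝓘(ℝ, Base) ∞ M, ∀ τ ∈ trivializationAtlas V E,
    ∀ x ∈ coordDomain c τ, ∀ a, ∃ A : 𝔊.lie, IsGaugeCoeff κ c τ x a A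
  g : Π p : M, TangentSpace 𝓘(ℝ, Base) p →L[ℝ] TangentSpace 𝓘(ℝ, Base) p →L[ℝ] ℝ
  g_symm : ∀ p v w, g p v w = g p w v
  g_nondeg : ∀ p v, (∀ w, g p v w = 0) → v = 0
  g_smooth : ContMDiff 𝓘(ℝ, Base) (𝓘(ℝ, Base).prod 𝓘(ℝ, Base →L[ℝ] Base →L[ℝ] ℝ)) ∞
    (fun p => TotalSpace.mk' (Base →L[ℝ] Base →L[ℝ] ℝ) p (g p))
  Γ : CovariantDerivative 𝓘(ℝ, Base) Base (TangentSpace 𝓘(ℝ, Base) : M → Type _)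
  Γ_smooth : CovariantDerivative.ContMDiffCovariantDerivative Γ ∞
  Γ_symm : Γ.torsion = 0

variable [IsManifold 𝓘(ℝ, Base) ∞ M] [ContMDiffVectorBundle ∞ V E 𝓘(ℝ, Base)]
  {𝔊 : GaugeGroup V}

namespace Fields

variable (f : Fields (M := M) 𝔊 E) (c : OpenPartialHomeomorph M Base)
  (τ : Trivialization V (TotalSpace.proj : TotalSpace V E → M))

/-- The components `φ^i` of the matter field. -/
def matterCoord (x : Base) : V := (τ ⟨c.symm x, f.φ (c.symm x)⟩).2

open Classical in
/-- The components `κ_a` of the gauge field (they are determined by `IsGaugeCoeff`). -/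
def gaugeCoord (x : Base) (a : Fin 4) : 𝔊.lie :=
  if h : ∃ A : 𝔊.lie, IsGaugeCoeff f.κ c τ x a A then h.choose else 0

/-- The components `g_{ab}` of the metric. -/
def metricCoord (x : Base) : SymForm :=
  ⟨fun a b => f.g (c.symm x) (coordVec c (c.symm x) a) (coordVec c (c.symm x) b),
    fun _ _ => f.g_symm _ _ _⟩

/-- The components `Γ_a^b_c` of the spacetime connection, with the sign convention
`∇_a v^b = ∂_a v^b - Γ_a^b_c v^c`. -/
def connCoord (x : Base) (a b d : Fin 4) : ℝ :=
  -coordCovec c (c.symm x) b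
    (f.Γ (fun p => coordVec c p d) (c.symm x) (coordVec c (c.symm x) a))

/-- The coordinate expression of the fields, as a section of the total bundle. -/
def coords (x : Base) : Fibre 𝔊 :=
  (f.matterCoord c τ x, f.gaugeCoord c τ x, f.metricCoord c x, f.connCoord c x)

end Fields

/-- The bilinear form `g_{ab} dx^a ⊗ dx^b` at a point. -/
def formOf (c : OpenPartialHomeomorph M Base) (p : M) (g : SymForm) :
    TangentSpace 𝓘(ℝ, Base) p →L[ℝ] TangentSpace 𝓘(ℝ, Base) p →L[ℝ] ℝ :=
  ∑ a, ∑ b, (g : Fin 4 → Fin 4 → ℝ) a b • (coordCovec c p a).smulRight (coordCovec c p b)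

/-- The `E`-valued covector `dx^a ⊗ w_a` at a point. -/
def covecOf (c : OpenPartialHomeomorph M Base)
    (τ : Trivialization V (TotalSpace.proj : TotalSpace V E → M)) (p : M) (w : Fin 4 → V) :
    TangentSpace 𝓘(ℝ, Base) p →L[ℝ] E p :=
  ∑ a, (coordCovec c p a).smulRight (τ.symm p (w a))

variable (M E) in
/-- A matter Lagrangian density `λ(g, φ, ∇φ) √|g| d⁴x`: a first-order Lagrangian depending on the
derivatives of the matter field through the covariant derivative, and on the metric (but not on its
derivatives). The scalar factor `λ` may also depend on the point of spacetime, through fixed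
structures of the bundles. Only its values at symmetric nondegenerate forms matter. -/
structure MatterLagrangian where
  toFun : Π p : M, (TangentSpace 𝓘(ℝ, Base) p →L[ℝ] TangentSpace 𝓘(ℝ, Base) p →L[ℝ] ℝ) →
    E p → (TangentSpace 𝓘(ℝ, Base) p →L[ℝ] E p) → ℝ
  smooth : ∀ c ∈ IsManifold.maximalAtlas 𝓘(ℝ, Base) ∞ M, ∀ τ ∈ trivializationAtlas V E,
    ContDiffOn ℝ ∞
      (fun q : Base × SymForm × V × (Fin 4 → V) =>
        toFun (c.symm q.1) (formOf c (c.symm q.1) q.2.1) (τ.symm (c.symm q.1) q.2.2.1)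
          (covecOf c τ (c.symm q.1) q.2.2.2))
      {q | q.1 ∈ coordDomain c τ ∧ (Matrix.of (q.2.1 : Fin 4 → Fin 4 → ℝ)).det ≠ 0}

/-- The matter Lagrangian is natural: it depends on the tangent spaces only through the metric and
the covariant derivative of the field, hence it is invariant under their linear automorphisms. -/
def MatterLagrangian.IsNatural (L : MatterLagrangian (V := V) M E) : Prop :=
  ∀ (p : M) (B : TangentSpace 𝓘(ℝ, Base) p ≃L[ℝ] TangentSpace 𝓘(ℝ, Base) p)
    (g : TangentSpace 𝓘(ℝ, Base) p →L[ℝ] TangentSpace 𝓘(ℝ, Base) p →L[ℝ] ℝ)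
    (φ : E p) (w : TangentSpace 𝓘(ℝ, Base) p →L[ℝ] E p),
    (∀ u v, g u v = g v u) → (∀ u, (∀ v, g u v = 0) → u = 0) →
    ∀ g' : TangentSpace 𝓘(ℝ, Base) p →L[ℝ] TangentSpace 𝓘(ℝ, Base) p →L[ℝ] ℝ,
      (∀ u v, g' u v = g (B u) (B v)) →
      L.toFun p g' φ (w.comp (B : TangentSpace 𝓘(ℝ, Base) p →L[ℝ] TangentSpace 𝓘(ℝ, Base) p))
        = L.toFun p g φ w

/-- The coordinate expression of a matter Lagrangian. -/
def lagMatter (L : MatterLagrangian (V := V) M E) (c : OpenPartialHomeomorph M Base)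
    (τ : Trivialization V (TotalSpace.proj : TotalSpace V E → M)) (j : Jet (Fibre 𝔊)) : ℝ :=
  L.toFun (c.symm j.1) (formOf c (c.symm j.1) j.2.1.metric) (τ.symm (c.symm j.1) j.2.1.matter)
    (covecOf c τ (c.symm j.1) (covMatter j)) * sqrtDet j.2.1.metric

/-- The coordinate expression of the total Lagrangian. -/
def lagTotal (L : MatterLagrangian (V := V) M E) (c : OpenPartialHomeomorph M Base)
    (τ : Trivialization V (TotalSpace.proj : TotalSpace V E → M)) (j : Jet (Fibre 𝔊)) : ℝ :=
  lagGrav j + lagMatter L c τ j + lagGauge j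

/-- The spacetime connection satisfies its own field equation, the Euler–Lagrange equation of the
total Lagrangian with respect to the variations of the spacetime connection. -/
def ConnFieldEquation (L : MatterLagrangian (V := V) M E) (f : Fields (M := M) 𝔊 E) : Prop :=
  ∀ c ∈ IsManifold.maximalAtlas 𝓘(ℝ, Base) ∞ M, ∀ τ ∈ trivializationAtlas V E,
    ∀ x ∈ coordDomain c τ, ∀ δ : Fibre 𝔊, IsConnVariation δ →
      eulerLagrange (lagTotal L c τ) (f.coords c τ) x δ = 0

/-- The current `i_{Y[X]} C` is conserved along the section `s` given by the fields:
`(js)^* d(i_{Y[X]} C) = 0`, where `C` is the total Poincaré–Cartan form and `Y[X]` is the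
prolongation of `X` determined by the gauge field and the spacetime connection. -/
def CurrentConserved (L : MatterLagrangian (V := V) M E) (f : Fields (M := M) 𝔊 E)
    (X : Π p : M, TangentSpace 𝓘(ℝ, Base) p) : Prop :=
  ∀ c ∈ IsManifold.maximalAtlas 𝓘(ℝ, Base) ∞ M, ∀ τ ∈ trivializationAtlas V E,
    ∀ x ∈ coordDomain c τ,
      pullbackDeriv
        (current (lagTotal L c τ) (prolong (f.coords c τ) (coordField c X)))
        (f.coords c τ) x = 0

/-- The Einstein equations `G^a_b √|g| = -(T_matter + T_gauge)^a_b`, where `T = -½ U` for the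
canonical energy-tensors `U` of the matter and gauge sectors. -/
def EinsteinCanonical (L : MatterLagrangian (V := V) M E) (f : Fields (M := M) 𝔊 E) : Prop :=
  ∀ c ∈ IsManifold.maximalAtlas 𝓘(ℝ, Base) ∞ M, ∀ τ ∈ trivializationAtlas V E,
    ∀ x ∈ coordDomain c τ, ∀ a b : Fin 4,
      einsteinMixed (jet (f.coords c τ) x) a b * sqrtDet (f.metricCoord c x) =
        -(-(1 / 2) * energyTensor (lagMatter L c τ) (prolongConn (f.coords c τ))
              (f.coords c τ) x a b
          + -(1 / 2) * energyTensor lagGauge (prolongConn (f.coords c τ))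
              (f.coords c τ) x a b)

/-- The Einstein equations `G_{ab} √|g| = -(T_matter + T_gauge)_{ab}`, where `T_{ab} = ∂ℓ/∂g^{ab}`
for the matter and gauge Lagrangians. -/
def EinsteinMetric (L : MatterLagrangian (V := V) M E) (f : Fields (M := M) 𝔊 E) : Prop :=
  ∀ c ∈ IsManifold.maximalAtlas 𝓘(ℝ, Base) ∞ M, ∀ τ ∈ trivializationAtlas V E,
    ∀ x ∈ coordDomain c τ, ∀ a b : Fin 4,
      einstein (jet (f.coords c τ) x) a b * sqrtDet (f.metricCoord c x) =
        -(stressTensor (lagMatter L c τ) (jet (f.coords c τ) x) a b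
          + stressTensor lagGauge (jet (f.coords c τ) x) a b)

end Manifold

end MetricAffine

end

set_option linter.unusedSectionVars false

namespace MetricAffine

/-! ### Coordinate frames and coframes of a chart. -/

section Charts

variable {M : Type*} [TopologicalSpace M] [ChartedSpace Base M] [IsManifold 𝓘(ℝ, Base) ∞ M]
  {c : OpenPartialHomeomorph M Base} {p : M}

/-! The currents are conserved for every vector field, so `X` may be localized at a point: near `x`
take `X = (y^a - x^a) ∂_b`. Its lift `Y[X]` vanishes at `(x, s x)`, with derivative `dx^a ⊗ (∂_b +
K_b)` there. At a zero of `Y` the form `d(i_Y C)` contains no derivative of `C`: it is `C` with the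
derivative of `Y` inserted in one slot. Pulled back by `js`, on which contact forms vanish, it
becomes exactly the component `U^a_b` of the total canonical energy-tensor
(`pullbackDeriv_current_apply`). Conservation of all the currents therefore gives `U_grav + U_matter
+ U_gauge = 0` at every point, without any field equation (`energyTensor_eq_zero_of_conserved`).

The equation of the connection serves to identify `U_grav`. The matter and gauge Lagrangians do not
involve `Γ`, so the equation is Palatini's, without source, and it says that `Γ` annihilates the
inverse metric (`palatini_algebra`, `inverse_of_density`). The overconnection is built so that the
covariant derivative of `Γ` is its own curvature (`conn_covDeriv`). For a torsion-free metric
connection the curvature is antisymmetric and the Ricci tensor symmetric, hence the two contractions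
of the curvature in `P^a_i ∇_b s^i` both equal `R^a_b`, and `U_grav = -2 G √|g|`
(`IsRegular.energyTensor_lagGrav`). This is the canonical form of the Einstein equations.

For the metric form one needs `U^c_a = -2 g^{cp} T_{pa}` for matter and gauge. Contracting `T` with
`g` amounts to differentiating the Lagrangian along the infinitesimal action of an elementary
endomorphism on the metric (`stressTensor_contraction`). For natural matter, invariance trades this
variation of `g` for the opposite one of `∇φ`, whose derivative is the momentum term
(`IsInvariant.fderiv_eq_zero`); the factor `√|g|` supplies the trace term `ℓ δ^c_a`. For the gauge
field the same identity is an explicit contraction of the squared curvature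
(`curvature_square_contraction`). -/

theorem mdifferentiable_of_mem_maximalAtlas
    (hc : c ∈ IsManifold.maximalAtlas 𝓘(ℝ, Base) ∞ M) :
    c.MDifferentiable 𝓘(ℝ, Base) 𝓘(ℝ, Base) :=
  ⟨fun _ hx => ((contMDiffAt_of_mem_maximalAtlas hc hx).mdifferentiableAt
      (by simp)).mdifferentiableWithinAt,
    fun _ hx => ((contMDiffAt_symm_of_mem_maximalAtlas hc hx).mdifferentiableAt
      (by simp)).mdifferentiableWithinAt⟩

theorem isInvertible_mfderiv_chart (hc : c ∈ IsManifold.maximalAtlas 𝓘(ℝ, Base) ∞ M)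
    (hp : p ∈ c.source) : (mfderiv 𝓘(ℝ, Base) 𝓘(ℝ, Base) c p).IsInvertible :=
  ⟨(mdifferentiable_of_mem_maximalAtlas hc).mfderiv hp, rfl⟩

theorem mfderiv_coordVec (hc : c ∈ IsManifold.maximalAtlas 𝓘(ℝ, Base) ∞ M)
    (hp : p ∈ c.source) (a : Fin 4) :
    mfderiv 𝓘(ℝ, Base) 𝓘(ℝ, Base) c p (coordVec c p a) = stdVec a := by
  obtain ⟨e, he⟩ := isInvertible_mfderiv_chart hc hp
  rw [coordVec, ← he, ContinuousLinearMap.inverse_equiv]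
  exact e.apply_symm_apply _

theorem mfderiv_chart_injective (hc : c ∈ IsManifold.maximalAtlas 𝓘(ℝ, Base) ∞ M)
    (hp : p ∈ c.source) :
    Function.Injective (mfderiv 𝓘(ℝ, Base) 𝓘(ℝ, Base) c p) :=
  (mdifferentiable_of_mem_maximalAtlas hc).mfderiv_injective hp

theorem base_eq_sum (v : Base) : v = ∑ a, v a • stdVec a := by
  ext i
  simp [stdVec, Pi.single_apply]

theorem stdCovec_stdVec (a b : Fin 4) : stdCovec a (stdVec b) = if a = b then 1 else 0 := by
  simp [stdCovec, stdVec]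

theorem coordCovec_coordVec (hc : c ∈ IsManifold.maximalAtlas 𝓘(ℝ, Base) ∞ M)
    (hp : p ∈ c.source) (a b : Fin 4) :
    coordCovec c p a (coordVec c p b) = if a = b then 1 else 0 := by
  have h := mfderiv_coordVec hc hp b
  change stdCovec a (mfderiv 𝓘(ℝ, Base) 𝓘(ℝ, Base) c p (coordVec c p b)) = _
  rw [h]
  exact stdCovec_stdVec a b

theorem tangent_eq_sum (hc : c ∈ IsManifold.maximalAtlas 𝓘(ℝ, Base) ∞ M)
    (hp : p ∈ c.source) (v : TangentSpace 𝓘(ℝ, Base) p) :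
    v = ∑ a, coordCovec c p a v • coordVec c p a := by
  apply mfderiv_chart_injective hc hp
  rw [map_sum]
  simp only [map_smul, mfderiv_coordVec hc hp]
  exact base_eq_sum _

theorem mfderiv_sum_coordVec (hc : c ∈ IsManifold.maximalAtlas 𝓘(ℝ, Base) ∞ M)
    (hp : p ∈ c.source) (w : Base) :
    mfderiv 𝓘(ℝ, Base) 𝓘(ℝ, Base) c p (∑ a, w a • coordVec c p a) = w := by
  rw [map_sum]
  simp only [map_smul, mfderiv_coordVec hc hp]
  exact (base_eq_sum w).symm

/-- The field `∂_a` is the pullback under the chart of a constant field of the model space, and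
pullback by a local diffeomorphism preserves smoothness. -/
theorem contMDiffAt_coordVec (hc : c ∈ IsManifold.maximalAtlas 𝓘(ℝ, Base) ∞ M)
    (hp : p ∈ c.source) (a : Fin 4) :
    ContMDiffAt 𝓘(ℝ, Base) (𝓘(ℝ, Base).prod 𝓘(ℝ, Base)) ∞
      (fun q => TotalSpace.mk' Base q (coordVec c q a)) p := by
  have hV : ContMDiffAt 𝓘(ℝ, Base) (𝓘(ℝ, Base).prod 𝓘(ℝ, Base)) ∞
      (fun x : Base => TotalSpace.mk' Base (E := TangentSpace 𝓘(ℝ, Base)) x (stdVec a)) (c p) :=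
    contMDiffAt_vectorSpace_iff_contDiffAt.2 contDiffAt_const
  rw [← contMDiffWithinAt_univ] at hV ⊢
  have := ContMDiffWithinAt.mpullback_vectorField_preimage (n := ∞) hV
    (contMDiffAt_of_mem_maximalAtlas hc hp) (isInvertible_mfderiv_chart hc hp) (by simp)
  exact this

theorem contMDiffAt_mfderiv_chart_apply (hc : c ∈ IsManifold.maximalAtlas 𝓘(ℝ, Base) ∞ M)
    (hp : p ∈ c.source) {X : Π p : M, TangentSpace 𝓘(ℝ, Base) p}
    (hX : ContMDiffAt 𝓘(ℝ, Base) (𝓘(ℝ, Base).prod 𝓘(ℝ, Base)) ∞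
      (fun q => TotalSpace.mk' Base q (X q)) p) :
    ContMDiffAt 𝓘(ℝ, Base) 𝓘(ℝ, Base) ∞
      (fun q => (mfderiv 𝓘(ℝ, Base) 𝓘(ℝ, Base) c q (X q) : Base)) p := by
  have h1 : ContMDiffOn 𝓘(ℝ, Base) 𝓘(ℝ, Base) ∞ c c.source := fun q hq =>
    (contMDiffAt_of_mem_maximalAtlas hc hq).contMDiffWithinAt
  have h2 := h1.contMDiffOn_tangentMapWithin (m := ∞) (by simp) c.open_source.uniqueMDiffOn
  have h3 := (h2 ⟨p, X p⟩ hp).contMDiffAt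
    ((c.open_source.preimage (FiberBundle.continuous_proj Base _)).mem_nhds hp)
  have h4 := (contMDiff_snd_tangentBundle_modelSpace Base 𝓘(ℝ, Base)).contMDiffAt.comp p
    (ContMDiffAt.comp p h3 hX)
  refine h4.congr_of_eventuallyEq ?_
  filter_upwards [c.open_source.mem_nhds hp] with q hq
  simp only [Function.comp, tangentMapWithin, TotalSpace.mk']
  rw [mfderivWithin_of_isOpen c.open_source hq]

theorem contMDiffAt_coordCovec_apply (hc : c ∈ IsManifold.maximalAtlas 𝓘(ℝ, Base) ∞ M)
    (hp : p ∈ c.source) {X : Π p : M, TangentSpace 𝓘(ℝ, Base) p}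
    (hX : ContMDiffAt 𝓘(ℝ, Base) (𝓘(ℝ, Base).prod 𝓘(ℝ, Base)) ∞
      (fun q => TotalSpace.mk' Base q (X q)) p) (a : Fin 4) :
    ContMDiffAt 𝓘(ℝ, Base) 𝓘(ℝ, ℝ) ∞ (fun q => coordCovec c q a (X q)) p :=
  (stdCovec a).contDiff.contMDiff.contMDiffAt.comp p (contMDiffAt_mfderiv_chart_apply hc hp hX)

/-- Pullback commutes with Lie brackets, and constant fields of the model space commute. -/
theorem mlieBracket_coordVec (hc : c ∈ IsManifold.maximalAtlas 𝓘(ℝ, Base) ∞ M)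
    (hp : p ∈ c.source) (a b : Fin 4) :
    VectorField.mlieBracket 𝓘(ℝ, Base) (fun q => coordVec c q a) (fun q => coordVec c q b) p
      = 0 := by
  have hV : ∀ a, MDifferentiableAt 𝓘(ℝ, Base) (𝓘(ℝ, Base).prod 𝓘(ℝ, Base))
      (fun x : Base => TotalSpace.mk' Base (E := TangentSpace 𝓘(ℝ, Base)) x (stdVec a)) (c p) :=
    fun a => (contMDiffAt_vectorSpace_iff_contDiffAt (n := 1).2 contDiffAt_const).mdifferentiableAt
      one_ne_zero
  have : IsManifold 𝓘(ℝ, Base) (minSmoothness ℝ 2) M := by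
    rw [minSmoothness_of_isRCLikeNormedField]
    infer_instance
  have h := VectorField.mpullback_mlieBracket (n := ∞) (hV a) (hV b)
    (contMDiffAt_of_mem_maximalAtlas hc hp)
    (by rw [minSmoothness_of_isRCLikeNormedField]; exact ENat.LEInfty.out)
  have h0 : VectorField.mlieBracket 𝓘(ℝ, Base)
      (fun x : Base => (stdVec a : TangentSpace 𝓘(ℝ, Base) x)) (fun x => stdVec b) (c p) = 0 := by
    have key : ∀ (V W : Π x : Base, TangentSpace 𝓘(ℝ, Base) x),
        VectorField.mlieBracket 𝓘(ℝ, Base) V W = VectorField.lieBracket ℝ V W := fun V W => by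
      rw [← VectorField.mlieBracketWithin_univ, VectorField.mlieBracketWithin_eq_lieBracketWithin]
      exact VectorField.lieBracketWithin_univ
    exact (congrFun (key _ _) _).trans
      (show fderiv ℝ (fun _ : Base => stdVec b) (c p) (stdVec a)
        - fderiv ℝ (fun _ : Base => stdVec a) (c p) (stdVec b) = 0 by simp)
  rw [VectorField.mpullback_apply, h0, map_zero] at h
  exact h.symm

end Charts

/-! ### Smoothness of maps into subspaces and spaces of operators. -/

/-- In finite dimension the inclusion of a subspace has a continuous linear left inverse. -/
theorem contDiffAt_submodule_iff {X W : Type*} [NormedAddCommGroup X] [NormedSpace ℝ X]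
    [NormedAddCommGroup W] [NormedSpace ℝ W] [FiniteDimensional ℝ W] {S : Submodule ℝ W}
    {n : WithTop ℕ∞} {h : X → S} {x : X} :
    ContDiffAt ℝ n h x ↔ ContDiffAt ℝ n (fun x => (h x : W)) x := by
  refine ⟨fun hh => S.subtypeL.contDiff.contDiffAt.comp x hh, fun hh => ?_⟩
  obtain ⟨P, hP⟩ := S.subtype.exists_leftInverse_of_injective (Submodule.ker_subtype S)
  have := (LinearMap.toContinuousLinearMap P).contDiff.contDiffAt.comp x hh
  refine this.congr_of_eventuallyEq (Eventually.of_forall fun y => ?_)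
  exact (LinearMap.congr_fun hP (h y)).symm

theorem contDiffAt_clm_of_apply {X W W' : Type*} [NormedAddCommGroup X] [NormedSpace ℝ X]
    [NormedAddCommGroup W] [NormedSpace ℝ W] [FiniteDimensional ℝ W]
    [NormedAddCommGroup W'] [NormedSpace ℝ W'] {n : WithTop ℕ∞} {h : X → W →L[ℝ] W'} {x : X}
    (hh : ∀ w, ContDiffAt ℝ n (fun x => h x w) x) : ContDiffAt ℝ n h x := by
  let d := Module.finrank ℝ W
  have hd : d = Module.finrank ℝ (Fin d → ℝ) := (Module.finrank_fin_fun ℝ).symm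
  let e₁ := ContinuousLinearEquiv.ofFinrankEq hd
  let e₂ := (e₁.arrowCongr (1 : W' ≃L[ℝ] W')).trans (ContinuousLinearEquiv.piRing (Fin d))
  rw [← Function.id_comp h, ← e₂.symm_comp_self]
  exact e₂.symm.contDiff.contDiffAt.comp x (contDiffAt_pi.2 fun i => hh _)

/-! ### Globalizing local sections; covariant derivatives of local sections. -/

section Sections

variable {M : Type*} [TopologicalSpace M] [T2Space M] [ChartedSpace Base M]
  [IsManifold 𝓘(ℝ, Base) ∞ M]
  {W : Type*} [NormedAddCommGroup W] [NormedSpace ℝ W]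
  {E : M → Type*} [TopologicalSpace (TotalSpace W E)]
  [∀ p, AddCommGroup (E p)] [∀ p, Module ℝ (E p)] [∀ p, TopologicalSpace (E p)]
  [∀ p, IsTopologicalAddGroup (E p)] [∀ p, ContinuousSMul ℝ (E p)]
  [FiberBundle W E] [VectorBundle ℝ W E] [ContMDiffVectorBundle ∞ W E 𝓘(ℝ, Base)]

/-- A smooth section over an open set agrees near any of its points with a global smooth section. -/
theorem exists_contMDiff_section_eventuallyEq {σ : Π p : M, E p} {u : Set M} (hu : IsOpen u)
    (hσ : ContMDiffOn 𝓘(ℝ, Base) (𝓘(ℝ, Base).prod 𝓘(ℝ, W)) ∞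
      (fun q => TotalSpace.mk' W q (σ q)) u) {p : M} (hp : p ∈ u) :
    ∃ σ' : Π p : M, E p, ContMDiff 𝓘(ℝ, Base) (𝓘(ℝ, Base).prod 𝓘(ℝ, W)) ∞
      (fun q => TotalSpace.mk' W q (σ' q)) ∧ ∀ᶠ q in 𝓝 p, σ' q = σ q := by
  obtain ⟨ρ, -, hρ⟩ := (SmoothBumpFunction.nhds_basis_tsupport (I := 𝓘(ℝ, Base)) p).mem_iff.1
    (hu.mem_nhds hp)
  refine ⟨(ρ : M → ℝ) • σ,
    ContMDiffOn.smul_section_of_tsupport ρ.contMDiff.contMDiffOn hu hρ hσ, ?_⟩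
  filter_upwards [ρ.eventuallyEq_one] with q hq
  simp [hq]

/-- Smoothness of `κ` is used on global sections, whereas frames are only local. A bump function
replaces `σ` by a global section with the same germ at `p`, and a covariant derivative depends only
on germs. -/
theorem contMDiffAt_covariantDerivative
    {κ : CovariantDerivative 𝓘(ℝ, Base) W E}
    (hκ : CovariantDerivative.ContMDiffCovariantDerivative κ ∞)
    {σ : Π p : M, E p} {u : Set M} (hu : IsOpen u)
    (hσ : ContMDiffOn 𝓘(ℝ, Base) (𝓘(ℝ, Base).prod 𝓘(ℝ, W)) ∞
      (fun q => TotalSpace.mk' W q (σ q)) u) {p : M} (hp : p ∈ u)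
    {X : Π p : M, TangentSpace 𝓘(ℝ, Base) p}
    (hX : ContMDiffAt 𝓘(ℝ, Base) (𝓘(ℝ, Base).prod 𝓘(ℝ, Base)) ∞
      (fun q => TotalSpace.mk' Base q (X q)) p) :
    ContMDiffAt 𝓘(ℝ, Base) (𝓘(ℝ, Base).prod 𝓘(ℝ, W)) ∞
      (fun q => TotalSpace.mk' W q (κ σ q (X q))) p := by
  obtain ⟨σ', hσ', he⟩ := exists_contMDiff_section_eventuallyEq hu hσ hp
  have h1 := hκ.contMDiff.contMDiff (σ := σ') (by simpa using hσ'.contMDiffOn)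
  have h2 := ContMDiffAt.clm_bundle_apply ((contMDiffOn_univ.1 h1) p) hX
  refine h2.congr_of_eventuallyEq ?_
  filter_upwards [he.eventually_nhds, hu.mem_nhds hp] with q hq hqu
  have := κ.isCovariantDerivativeOnUniv.congr_of_eventuallyEq (x := q) (σ := σ') (σ' := σ)
    ((hσ' q).mdifferentiableAt (by simp))
    (((hσ q hqu).contMDiffAt (hu.mem_nhds hqu)).mdifferentiableAt (by simp))
    univ_mem hq
  rw [this]

end Sections

/-! ### Coordinate expressions of the fields: smoothness, symmetry, nondegeneracy. -/

section Coordinates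

variable {V : Type*} [NormedAddCommGroup V] [NormedSpace ℝ V] [FiniteDimensional ℝ V]
  {M : Type*} [TopologicalSpace M] [ChartedSpace Base M]
  {E : M → Type*} [TopologicalSpace (TotalSpace V E)]
  [∀ p, AddCommGroup (E p)] [∀ p, Module ℝ (E p)] [∀ p, TopologicalSpace (E p)]
  [∀ p, IsTopologicalAddGroup (E p)] [∀ p, ContinuousSMul ℝ (E p)]
  [FiberBundle V E] [VectorBundle ℝ V E]
  [IsManifold 𝓘(ℝ, Base) ∞ M] [ContMDiffVectorBundle ∞ V E 𝓘(ℝ, Base)]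
  {𝔊 : GaugeGroup V} (f : Fields (M := M) 𝔊 E)
  {c : OpenPartialHomeomorph M Base}
  {τ : Trivialization V (TotalSpace.proj : TotalSpace V E → M)} {x : Base}

theorem isOpen_coordDomain : IsOpen (coordDomain c τ) :=
  c.isOpen_inter_preimage_symm τ.open_baseSet

theorem contDiffAt_comp_chart_symm {W : Type*} [NormedAddCommGroup W] [NormedSpace ℝ W]
    (hc : c ∈ IsManifold.maximalAtlas 𝓘(ℝ, Base) ∞ M) (hx : x ∈ c.target) {h : M → W}
    (hh : ContMDiffAt 𝓘(ℝ, Base) 𝓘(ℝ, W) ∞ h (c.symm x)) :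
    ContDiffAt ℝ ∞ (fun y => h (c.symm y)) x :=
  contMDiffAt_iff_contDiffAt.1 (hh.comp x (contMDiffAt_symm_of_mem_maximalAtlas hc hx))

theorem contMDiffOn_trivialization_symm (hτ : τ ∈ trivializationAtlas V E) (v : V) :
    ContMDiffOn 𝓘(ℝ, Base) (𝓘(ℝ, Base).prod 𝓘(ℝ, V)) ∞
      (fun q => TotalSpace.mk' V q (τ.symm q v)) τ.baseSet := by
  have : MemTrivializationAtlas τ := ⟨hτ⟩
  rw [τ.contMDiffOn_section_iff τ.open_baseSet subset_rfl]
  refine (contMDiffOn_const (c := v)).congr fun q hq => ?_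
  rw [τ.mk_symm hq, τ.apply_symm_apply (τ.mem_target.2 hq)]

theorem isGaugeCoeff_gaugeCoord (hc : c ∈ IsManifold.maximalAtlas 𝓘(ℝ, Base) ∞ M)
    (hτ : τ ∈ trivializationAtlas V E) (hx : x ∈ coordDomain c τ) (a : Fin 4) :
    IsGaugeCoeff f.κ c τ x a (f.gaugeCoord c τ x a) := by
  have h := f.κ_mem c hc τ hτ x hx a
  rw [Fields.gaugeCoord, dif_pos h]
  exact h.choose_spec

theorem contDiffAt_matterCoord (hc : c ∈ IsManifold.maximalAtlas 𝓘(ℝ, Base) ∞ M)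
    (hτ : τ ∈ trivializationAtlas V E) (hx : x ∈ coordDomain c τ) :
    ContDiffAt ℝ ∞ (f.matterCoord c τ) x := by
  have : MemTrivializationAtlas τ := ⟨hτ⟩
  exact contDiffAt_comp_chart_symm hc hx.1
    ((τ.contMDiffAt_section_iff hx.2).1 f.φ_smooth.contMDiffAt)

/-- The components are obtained by choice, but `IsGaugeCoeff` fixes their value on each constant
vector `v` as minus the covariant derivative of a smooth local section. -/
theorem contDiffAt_gaugeCoord [T2Space M] (hc : c ∈ IsManifold.maximalAtlas 𝓘(ℝ, Base) ∞ M)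
    (hτ : τ ∈ trivializationAtlas V E) (hx : x ∈ coordDomain c τ) :
    ContDiffAt ℝ ∞ (f.gaugeCoord c τ) x := by
  have : MemTrivializationAtlas τ := ⟨hτ⟩
  rw [contDiffAt_pi]
  intro a
  rw [contDiffAt_submodule_iff]
  have hU : coordDomain c τ ∈ 𝓝 x := isOpen_coordDomain.mem_nhds hx
  refine contDiffAt_clm_of_apply fun v => ?_
  have h1 := contMDiffAt_covariantDerivative f.κ_smooth τ.open_baseSet
      (contMDiffOn_trivialization_symm hτ v) hx.2 (contMDiffAt_coordVec hc (c.map_target hx.1) a)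
  have h2 := contDiffAt_comp_chart_symm hc hx.1 ((τ.contMDiffAt_section_iff hx.2).1 h1)
  refine h2.neg.congr_of_eventuallyEq ?_
  filter_upwards [hU] with y hy
  rw [isGaugeCoeff_gaugeCoord f hc hτ hy a v, neg_neg]

theorem contDiffAt_metricCoord (hc : c ∈ IsManifold.maximalAtlas 𝓘(ℝ, Base) ∞ M)
    (hx : x ∈ c.target) : ContDiffAt ℝ ∞ (f.metricCoord c) x := by
  rw [contDiffAt_submodule_iff, contDiffAt_pi]
  intro a
  rw [contDiffAt_pi]
  intro b
  have hp := c.map_target hx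
  have h1 := ContMDiffAt.clm_bundle_apply₂ (E₃ := Bundle.Trivial M ℝ) (F₃ := ℝ) f.g_smooth.contMDiffAt
    (contMDiffAt_coordVec hc hp a) (contMDiffAt_coordVec hc hp b)
  refine contDiffAt_comp_chart_symm hc hx (h := fun q => f.g q (coordVec c q a) (coordVec c q b)) ?_
  exact ((contMDiffAt_section _).1 h1)

theorem contDiffAt_connCoord [T2Space M] (hc : c ∈ IsManifold.maximalAtlas 𝓘(ℝ, Base) ∞ M)
    (hx : x ∈ c.target) : ContDiffAt ℝ ∞ (f.connCoord c) x := by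
  have hp := c.map_target hx
  simp only [contDiffAt_pi]
  intro a b d
  refine (contDiffAt_comp_chart_symm hc hx (h := fun q => coordCovec c q b
    (f.Γ (fun p => coordVec c p d) q (coordVec c q a))) ?_).neg
  refine contMDiffAt_coordCovec_apply hc hp ?_ b
  exact contMDiffAt_covariantDerivative f.Γ_smooth c.open_source
    (fun q hq => (contMDiffAt_coordVec hc hq d).contMDiffWithinAt) hp
    (contMDiffAt_coordVec hc hp a)

theorem contDiffAt_coords [T2Space M] (hc : c ∈ IsManifold.maximalAtlas 𝓘(ℝ, Base) ∞ M)
    (hτ : τ ∈ trivializationAtlas V E) (hx : x ∈ coordDomain c τ) :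
    ContDiffAt ℝ ∞ (f.coords c τ) x :=
  (contDiffAt_matterCoord f hc hτ hx).prodMk ((contDiffAt_gaugeCoord f hc hτ hx).prodMk
    ((contDiffAt_metricCoord f hc hx.1).prodMk (contDiffAt_connCoord f hc hx.1)))

/-- Torsion on a pair of commuting coordinate fields is the antisymmetric part of the coefficients.
-/
theorem connCoord_symm (hc : c ∈ IsManifold.maximalAtlas 𝓘(ℝ, Base) ∞ M)
    (hx : x ∈ c.target) (a b d : Fin 4) : f.connCoord c x a b d = f.connCoord c x d b a := by
  have hp := c.map_target hx
  have h := (f.Γ.torsion_eq_zero_iff.1 f.Γ_symm)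
    ((contMDiffAt_coordVec hc hp a).mdifferentiableAt (by simp))
    ((contMDiffAt_coordVec hc hp d).mdifferentiableAt (by simp))
  rw [mlieBracket_coordVec hc hp, sub_eq_zero] at h
  simp only [Fields.connCoord, h]

/-- A null vector of the matrix gives a tangent vector orthogonal to the whole coordinate frame. -/
theorem det_metricCoord_ne_zero (hc : c ∈ IsManifold.maximalAtlas 𝓘(ℝ, Base) ∞ M)
    (hx : x ∈ c.target) :
    (Matrix.of (f.metricCoord c x : Fin 4 → Fin 4 → ℝ)).det ≠ 0 := by
  have hp := c.map_target hx
  intro h0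
  obtain ⟨v, hv, hv0⟩ := Matrix.exists_vecMul_eq_zero_iff.2 h0
  have key : ∑ a, v a • coordVec c (c.symm x) a = 0 := by
    refine f.g_nondeg _ _ fun w => ?_
    rw [tangent_eq_sum hc hp w, map_sum]
    refine Finset.sum_eq_zero fun b _ => ?_
    have := congrFun hv0 b
    simp only [Matrix.vecMul, dotProduct, Matrix.of_apply, Fields.metricCoord, Pi.zero_apply] at this
    rw [map_smul, map_sum, sum_apply]
    simp only [map_smul, smul_apply, smul_eq_mul, this, mul_zero]
  apply hv
  funext a
  have := congrArg (coordCovec c (c.symm x) a) key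
  simpa [map_sum, coordCovec_coordVec hc hp] using this

/-- Conservation is assumed for global vector fields; this realizes any smooth germ in a chart by
one of them. -/
theorem coordField_eventuallyEq_of_chart [T2Space M]
    (hc : c ∈ IsManifold.maximalAtlas 𝓘(ℝ, Base) ∞ M) (hx : x ∈ c.target)
    {w : Base → Base} (hw : ContDiff ℝ ∞ w) :
    ∃ X : Π p : M, TangentSpace 𝓘(ℝ, Base) p,
      ContMDiff 𝓘(ℝ, Base) (𝓘(ℝ, Base).prod 𝓘(ℝ, Base)) ∞
        (fun p => TotalSpace.mk' Base p (X p)) ∧ coordField c X =ᶠ[𝓝 x] w := by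
  have hσ : ContMDiffOn 𝓘(ℝ, Base) (𝓘(ℝ, Base).prod 𝓘(ℝ, Base)) ∞
      (fun q => TotalSpace.mk' Base q (∑ a, w (c q) a • coordVec c q a)) c.source := by
    refine ContMDiffOn.sum_section fun a _ => ContMDiffOn.smul_section ?_
      fun q hq => (contMDiffAt_coordVec hc hq a).contMDiffWithinAt
    exact ((stdCovec a).contDiff.comp hw).contMDiff.comp_contMDiffOn
      fun q hq => (contMDiffAt_of_mem_maximalAtlas hc hq).contMDiffWithinAt
  obtain ⟨X, hX, he⟩ := exists_contMDiff_section_eventuallyEq c.open_source hσ (c.map_target hx)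
  refine ⟨X, hX, ?_⟩
  filter_upwards [(c.continuousAt_symm hx).eventually he, c.open_target.mem_nhds hx] with y hy hyc
  rw [coordField, hy]
  exact (mfderiv_sum_coordVec hc (c.map_target hyc) _).trans (by rw [c.right_inv hyc])

end Coordinates

/-! ### Differentiation at a zero of a vector field. -/

/-- Product rule at a zero of `y`: the error `(A t - A x) (y t)` is `o(1) · O(t - x)`, so continuity
of `A` suffices. This applies to `A` equal to contraction with the Poincaré–Cartan form or to the
horizontal lift. -/
theorem hasFDerivAt_clm_apply_of_eq_zero {X Y Z : Type*} [NormedAddCommGroup X] [NormedSpace ℝ X]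
    [NormedAddCommGroup Y] [NormedSpace ℝ Y] [NormedAddCommGroup Z] [NormedSpace ℝ Z]
    {A : X → Y →L[ℝ] Z} {y : X → Y} {y' : X →L[ℝ] Y} {x : X} (hA : ContinuousAt A x)
    (hy : HasFDerivAt y y' x) (h0 : y x = 0) :
    HasFDerivAt (fun t => A t (y t)) ((A x).comp y') x := by
  have h1 : HasFDerivAt (fun t => A x (y t)) ((A x).comp y') x := (A x).hasFDerivAt.comp x hy
  have h2 : HasFDerivAt (fun t => (A t - A x) (y t)) (0 : X →L[ℝ] Z) x := by
    rw [hasFDerivAt_iff_isLittleO]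
    have ho : (fun t => A t - A x) =o[𝓝 x] (fun _ => (1 : ℝ)) :=
      (Asymptotics.isLittleO_one_iff ℝ).2 (by simpa using hA.sub_const (A x))
    have hO : y =O[𝓝 x] fun t => t - x := by simpa [h0] using hy.isBigO_sub
    have := ho.norm_left.mul_isBigO hO.norm_norm
    simp only [one_mul] at this
    refine (Asymptotics.IsBigO.trans_isLittleO (Asymptotics.IsBigO.of_norm_le fun t => ?_)
      this).of_norm_right
    simpa [h0] using (A t - A x).le_opNorm (y t)
  simpa [Pi.add_def] using h1.add h2

/-- The exterior derivative of `i_y C` at a zero of the vector field `y`. -/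
theorem extDeriv_curryLeft_apply_of_eq_zero {T : Type*} [NormedAddCommGroup T] [NormedSpace ℝ T]
    {n : ℕ} {C : T → T [⋀^Fin (n + 1)]→L[ℝ] ℝ} {y : T → T} {y' : T →L[ℝ] T} {t : T}
    (hC : ContinuousAt C t) (hy : HasFDerivAt y y' t) (h0 : y t = 0) {v : Fin (n + 1) → T}
    {a : Fin (n + 1)} {u : T} (hv : ∀ i, y' (v i) = (if i = a then (1 : ℝ) else 0) • u) :
    extDeriv (fun t => (C t).curryLeft (y t)) t v =
      (-1) ^ (a : ℕ) * C t (Matrix.vecCons u (a.removeNth v)) := by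
  have hC' : ContinuousAt (fun t => (C t).curryLeft) t :=
    (ContinuousAlternatingMap.curryLeftLI (𝕜 := ℝ) (E := T) (F := ℝ)
      (n := n)).continuous.continuousAt.comp hC
  rw [extDeriv, ContinuousAlternatingMap.alternatizeUncurryFin_apply,
    (hasFDerivAt_clm_apply_of_eq_zero hC' hy h0).fderiv]
  simp only [ContinuousLinearMap.comp_apply, hv, map_smul]
  -- The derivative of `y` kills every `v i` with `i ≠ a`, so one term of the alternating sum
  -- survives.
  rw [Finset.sum_eq_single a (fun i _ hi => by simp [hi]) (by simp)]
  simp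

/-! ### The Poincaré–Cartan form and its currents. -/

section FieldTheory

variable {F : Type*} [NormedAddCommGroup F] [NormedSpace ℝ F]

theorem wedge_apply {T : Type*} [NormedAddCommGroup T] [NormedSpace ℝ T] {k : ℕ}
    (α : T →L[ℝ] ℝ) (β : T [⋀^Fin k]→L[ℝ] ℝ) (v : Fin (k + 1) → T) :
    wedge α β v = ∑ i : Fin (k + 1), (-1) ^ (i : ℕ) • (α (v i) * β (i.removeNth v)) := by
  simp [wedge, ContinuousAlternatingMap.alternatizeUncurryFin_apply]

theorem fderiv_jet_snd {ℓ : Jet F → ℝ} {j : Jet F} (h : DifferentiableAt ℝ ℓ j)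
    (ζ : Base →L[ℝ] F) :
    fderiv ℝ (fun z => ℓ (j.1, j.2.1, z)) j.2.2 ζ = fderiv ℝ ℓ j (0, 0, ζ) := by
  have h1 : HasFDerivAt (fun z : Base →L[ℝ] F => ((j.1, j.2.1, z) : Jet F))
      ((0 : (Base →L[ℝ] F) →L[ℝ] Base).prod ((0 : (Base →L[ℝ] F) →L[ℝ] F).prod
        (ContinuousLinearMap.id ℝ _))) j.2.2 :=
    (hasFDerivAt_const _ _).prodMk ((hasFDerivAt_const _ _).prodMk (hasFDerivAt_id _))
  have h2 : HasFDerivAt ℓ (fderiv ℝ ℓ j) ((j.1, j.2.1, j.2.2) : Jet F) := h.hasFDerivAt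
  have h3 : HasFDerivAt (fun z => ℓ (j.1, j.2.1, z)) _ j.2.2 := h2.comp j.2.2 h1
  rw [h3.fderiv]
  rfl

theorem momentum_apply {ℓ : Jet F → ℝ} {j : Jet F} (h : DifferentiableAt ℝ ℓ j) (a : Fin 4)
    (δ : F) : momentum ℓ j a δ = fderiv ℝ ℓ j (0, 0, (stdCovec a).smulRight δ) :=
  fderiv_jet_snd h _

theorem contDiffAt_momentum {ℓ : Jet F → ℝ} {j : Jet F} (h : ContDiffAt ℝ ∞ ℓ j) (a : Fin 4) :
    ContDiffAt ℝ ∞ (fun j => momentum ℓ j a) j := by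
  have h1 : ContDiffAt ℝ ∞ (fderiv ℝ ℓ) j := h.fderiv_right (by simp)
  refine (h1.clm_comp (contDiffAt_const (c := ((ContinuousLinearMap.inr ℝ Base _).comp
    ((ContinuousLinearMap.inr ℝ F (Base →L[ℝ] F)).comp
      (ContinuousLinearMap.smulRightL ℝ Base F (stdCovec a))))))).congr_of_eventuallyEq ?_
  have h2 : ∀ᶠ j in 𝓝 j, ContDiffAt ℝ 1 ℓ j := (h.of_le (by simp)).eventually (by simp)
  filter_upwards [h2] with j hj
  ext δ
  rw [momentum_apply (hj.differentiableAt (by simp))]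
  rfl

theorem contDiff_contact : ContDiff ℝ ∞ (contact : Jet F → Jet F →L[ℝ] F) := by
  unfold contact
  exact contDiff_const.sub ((contDiff_snd.comp contDiff_snd).clm_comp contDiff_const)

theorem continuousAt_wedge {X T : Type*} [TopologicalSpace X] [NormedAddCommGroup T]
    [NormedSpace ℝ T] {k : ℕ} {α : X → T →L[ℝ] ℝ} {x : X} (hα : ContinuousAt α x)
    (β : T [⋀^Fin k]→L[ℝ] ℝ) : ContinuousAt (fun t => wedge (α t) β) x := by
  have h : ContinuousAt (fun t => ContinuousLinearMap.smulRightL ℝ T _ (α t) β) x :=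
    (((ContinuousLinearMap.smulRightL ℝ T (T [⋀^Fin k]→L[ℝ] ℝ)).flip β).continuous.continuousAt).comp
      hα
  exact (ContinuousAlternatingMap.alternatizeUncurryFinCLM ℝ T ℝ).continuous.continuousAt.comp h

set_option synthInstance.maxHeartbeats 200000 in
theorem continuousAt_poincareCartan {ℓ : Jet F → ℝ} {j : Jet F} (h : ContDiffAt ℝ ∞ ℓ j) :
    ContinuousAt (poincareCartan ℓ) j := by
  unfold poincareCartan
  refine (h.continuousAt.smul continuousAt_const).add (tendsto_finsetSum _ fun a _ => ?_)
  exact continuousAt_wedge ((contDiffAt_momentum h a).clm_comp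
    contDiff_contact.contDiffAt).continuousAt _

theorem vol_stdVec : vol stdVec = 1 := by
  have h : (Matrix.of fun i j : Fin 4 => stdVec i j) = 1 := by
    ext i j
    simp [stdVec, Matrix.one_apply, eq_comm]
  exact (congrArg Matrix.det h).trans Matrix.det_one

/-- Moving `∂_c` from the first slot to slot `a` costs the sign and yields the standard frame with
its `a`-th vector replaced by `∂_c`; a vector is then repeated unless `c = a`. -/
theorem vol3_stdVec (a c : Fin 4) :
    vol3 c (fun i => stdVec (a.succAbove i)) = (-1) ^ (a : ℕ) * (if a = c then 1 else 0) := by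
  have h := vol.neg_one_pow_smul_map_insertNth a (stdVec c) (fun i => stdVec (a.succAbove i))
  have h2 : a.insertNth (stdVec c) (fun i => stdVec (a.succAbove i))
      = Function.update stdVec a (stdVec c) := by
    funext i
    refine Fin.succAboveCases a ?_ (fun k => ?_) i <;> simp [Fin.succAbove_ne]
  rw [h2] at h
  have h3 : vol3 c (fun i => stdVec (a.succAbove i)) =
    vol (Matrix.vecCons (stdVec c) fun i => stdVec (a.succAbove i)) := rfl
  have h4 : vol (Function.update stdVec a (stdVec c)) = if a = c then 1 else 0 := by
    split_ifs with hac
    · subst hac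
      rw [Function.update_eq_self, vol_stdVec]
    · refine vol.map_eq_zero_of_eq _ (i := a) (j := c) ?_ hac
      rw [Function.update_self, Function.update_of_ne (Ne.symm hac)]
  rw [h3, ← h, h4]
  simp

theorem hasFDerivAt_jet {s : Base → F} {x : Base} (hs : ContDiffAt ℝ 2 s x) :
    HasFDerivAt (jet s) ((ContinuousLinearMap.id ℝ Base).prod ((fderiv ℝ s x).prod
      (fderiv ℝ (fderiv ℝ s) x))) x := by
  refine (hasFDerivAt_id x).prodMk ((hs.differentiableAt (by simp)).hasFDerivAt.prodMk ?_)
  exact ((hs.fderiv_right (m := 1) (by norm_num)).differentiableAt (by simp)).hasFDerivAt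

/-- The hypotheses on `T` are those satisfied by the differential of a jet prolongation. Since the
contact form kills its image, each wedge product retains only the term where the contact form is
evaluated on the first vector. With `k = K_b` the result is `U^a_b` up to sign. -/
theorem poincareCartan_vecCons (ℓ : Jet F → ℝ) (j : Jet F) (a b : Fin 4) (k : F)
    {T : Base →L[ℝ] Jet F} (hT : ∀ v, (T v).1 = v) (hcon : ∀ v, contact j (T v) = 0) :
    poincareCartan ℓ j (Matrix.vecCons (stdVec b, k, 0) fun i => T (stdVec (a.succAbove i))) =
      (-1) ^ (a : ℕ) * ((if a = b then ℓ j else 0)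
        - momentum ℓ j a (j.2.2 (stdVec b) - k)) := by
  have h : ∀ c : Fin 4, wedge ((momentum ℓ j c).comp (contact j))
      ((vol3 c).compContinuousLinearMap (ContinuousLinearMap.fst ℝ Base (F × (Base →L[ℝ] F))))
      (Matrix.vecCons (stdVec b, k, 0) fun i => T (stdVec (a.succAbove i))) =
      momentum ℓ j c (k - j.2.2 (stdVec b)) * ((-1) ^ (a : ℕ) * (if a = c then 1 else 0)) := by
    intro c
    rw [wedge_apply, Fin.sum_univ_succ, Finset.sum_eq_zero, add_zero, ← vol3_stdVec]
    · simp only [Fin.val_zero, pow_zero, one_smul, Matrix.cons_val_zero]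
      refine congrArg₂ (· * ·) rfl (congrArg (vol3 c) (funext fun i => hT _))
    · intro i _
      rw [Matrix.cons_val_succ, ContinuousLinearMap.comp_apply, hcon, map_zero, zero_mul,
        smul_zero]
  have h' : vol.compContinuousLinearMap (ContinuousLinearMap.fst ℝ Base (F × (Base →L[ℝ] F)))
      (Matrix.vecCons (stdVec b, k, 0) fun i => T (stdVec (a.succAbove i))) =
      (-1) ^ (a : ℕ) * (if a = b then 1 else 0) := by
    rw [← vol3_stdVec]
    change vol _ = vol (Matrix.vecCons _ _)
    refine congrArg vol (funext fun i => ?_)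
    exact Fin.cases rfl (fun i => hT _) i
  have hneg : momentum ℓ j a (j.2.2 (stdVec b) - k) =
      -momentum ℓ j a (k - j.2.2 (stdVec b)) := by
    rw [← map_neg, neg_sub]
  rw [poincareCartan, ContinuousAlternatingMap.add_apply, ContinuousAlternatingMap.sum_apply,
    Finset.sum_congr rfl fun c _ => h c, ContinuousAlternatingMap.smul_apply, h', hneg]
  simp only [mul_ite, mul_one, mul_zero, Finset.sum_ite_eq, Finset.mem_univ, if_true, smul_eq_mul]
  split_ifs <;> ring

-- The energy-tensor read off from a current: if `Y` vanishes at `(x, s x)` and its derivative there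
-- is `dx^a ⊗ (∂_b + k)`, then `d(i_Y C)` on the standard frame is `C` evaluated on `∂_b + k` and on
-- the lifts of the `∂_i` with `i ≠ a`.
set_option synthInstance.maxHeartbeats 200000 in
set_option maxHeartbeats 1000000 in
theorem pullbackDeriv_current_apply {ℓ : Jet F → ℝ} {s : Base → F} {x : Base}
    (hℓ : ContDiffAt ℝ ∞ ℓ (jet s x)) (hs : ContDiffAt ℝ 2 s x) {Y : Base × F → Base × F}
    {a b : Fin 4} {k : F} {Y' : Base × F →L[ℝ] Base × F} (hY0 : Y (x, s x) = 0)
    (hY : HasFDerivAt Y Y' (x, s x)) (hY' : ∀ q, Y' q = q.1 a • (stdVec b, k)) :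
    pullbackDeriv (current ℓ Y) s x stdVec =
      (if a = b then ℓ (jet s x) else 0)
        - momentum ℓ (jet s x) a (fderiv ℝ s x (stdVec b) - k) := by
  let ι : Base × F →L[ℝ] Jet F := (ContinuousLinearMap.fst ℝ Base F).prod
    ((ContinuousLinearMap.snd ℝ Base F).prod 0)
  let pr : Jet F →L[ℝ] Base × F := (ContinuousLinearMap.fst ℝ Base _).prod
    ((ContinuousLinearMap.fst ℝ F _).comp (ContinuousLinearMap.snd ℝ Base _))
  have h1 : HasFDerivAt (fun j : Jet F => ι (Y (pr j))) (ι.comp (Y'.comp pr)) (jet s x) :=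
    ι.hasFDerivAt.comp _ (HasFDerivAt.comp (jet s x) (f := pr) (g := Y) hY pr.hasFDerivAt)
  have h2 : ι (Y (pr (jet s x))) = 0 := (congrArg ι hY0).trans (map_zero ι)
  have hT := (hasFDerivAt_jet hs).fderiv
  set T := (ContinuousLinearMap.id ℝ Base).prod ((fderiv ℝ s x).prod (fderiv ℝ (fderiv ℝ s) x))
  -- The base component of the lift of `∂_i` is `∂_i` itself, so `Y'` sees it only when `i = a`.
  have hv : ∀ i : Fin 4, (ι.comp (Y'.comp pr)) (T (stdVec i)) = (if i = a then (1 : ℝ) else 0) •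
      ((stdVec b, k, 0) : Jet F) := fun i => by
    have : Y' (stdVec i, fderiv ℝ s x (stdVec i)) = (if i = a then (1 : ℝ) else 0) •
        (stdVec b, k) := by
      rw [hY']
      simp [stdVec, eq_comm]
    refine (congrArg ι this).trans ?_
    rw [map_smul]
    rfl
  have h3 := extDeriv_curryLeft_apply_of_eq_zero (continuousAt_poincareCartan hℓ) h1 h2
    (v := fun i => T (stdVec i)) hv
  have h4 := poincareCartan_vecCons ℓ (jet s x) a b k (T := T) (fun v => rfl)
    (fun v => by simp [contact, T, jet])
  rw [pullbackDeriv, hT]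
  refine h3.trans ?_
  refine (congrArg (fun r => (-1) ^ (a : ℕ) * r) h4).trans ?_
  -- Two signs `(-1)^a` cancel: one from the slot in the exterior derivative, one from reordering
  -- the volume form.
  simp only [← mul_assoc]
  rw [← pow_add, ← two_mul, pow_mul, neg_one_sq, one_pow, one_mul]
  rfl

end FieldTheory

/-! ### Calculus of the inverse metric and of the density `√|det g|`. -/

section Metric

theorem contDiffAt_det {X : Type*} [NormedAddCommGroup X] [NormedSpace ℝ X]
    {n : WithTop ℕ∞} {m : X → Matrix (Fin 4) (Fin 4) ℝ} {x : X}
    (hm : ∀ i j, ContDiffAt ℝ n (fun x => m x i j) x) : ContDiffAt ℝ n (fun x => (m x).det) x := by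
  simp only [Matrix.det_apply]
  exact ContDiffAt.sum fun σ _ => (contDiffAt_prod fun i _ => hm _ _).const_smul _

theorem contDiffAt_coe_symForm {X : Type*} [NormedAddCommGroup X] [NormedSpace ℝ X]
    {n : WithTop ℕ∞} {m : X → SymForm} {x : X} (hm : ContDiffAt ℝ n m x) (a b : Fin 4) :
    ContDiffAt ℝ n (fun x => (m x : Fin 4 → Fin 4 → ℝ) a b) x :=
  contDiffAt_pi.1 (contDiffAt_pi.1 (contDiffAt_submodule_iff.1 hm) a) b

/-- The matrix of a symmetric array. -/
abbrev toMatrix (g : SymForm) : Matrix (Fin 4) (Fin 4) ℝ := Matrix.of (g : Fin 4 → Fin 4 → ℝ)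

theorem toMatrix_symInv (g : SymForm) : toMatrix (symInv g) = (toMatrix g)⁻¹ := rfl

theorem contDiffAt_symInv {g : SymForm} (hg : (toMatrix g).det ≠ 0) :
    ContDiffAt ℝ ∞ symInv g := by
  have hc : ∀ i j, ContDiffAt ℝ ∞ (fun g : SymForm => toMatrix g i j) g :=
    fun i j => contDiffAt_coe_symForm contDiffAt_id i j
  rw [contDiffAt_submodule_iff, contDiffAt_pi]
  intro a
  rw [contDiffAt_pi]
  intro b
  -- Cramer's rule expresses the entries through determinants, so that smoothness away from `det =
  -- 0` is visible.
  have : ∀ g : SymForm, (symInv g : Fin 4 → Fin 4 → ℝ) a b =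
      (toMatrix g).det⁻¹ * ((toMatrix g).updateRow b (Pi.single a 1)).det := fun g => by
    change (toMatrix g)⁻¹ a b = _
    rw [Matrix.inv_def, Ring.inverse_eq_inv', Matrix.smul_apply, Matrix.adjugate_apply, smul_eq_mul]
  simp only [this]
  refine ((contDiffAt_det hc).inv hg).mul (contDiffAt_det fun i j => ?_)
  by_cases hi : i = b
  · subst hi
    simpa using contDiffAt_const
  · simpa [Matrix.updateRow_ne hi] using hc i j

theorem contDiffAt_sqrtDet {g : SymForm} (hg : (toMatrix g).det ≠ 0) :
    ContDiffAt ℝ ∞ sqrtDet g := by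
  have hd : ContDiffAt ℝ ∞ (fun g : SymForm => (toMatrix g).det) g :=
    contDiffAt_det fun i j => contDiffAt_coe_symForm contDiffAt_id i j
  exact (hd.abs hg).sqrt (abs_ne_zero.2 hg)

theorem sqrtDet_ne_zero {g : SymForm} (hg : (toMatrix g).det ≠ 0) : sqrtDet g ≠ 0 :=
  (Real.sqrt_pos.2 (abs_pos.2 hg)).ne'

theorem symInv_mul {g : SymForm} (hg : (toMatrix g).det ≠ 0) :
    toMatrix (symInv g) * toMatrix g = 1 :=
  Matrix.nonsing_inv_mul _ (isUnit_iff_ne_zero.2 hg)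

theorem mul_symInv {g : SymForm} (hg : (toMatrix g).det ≠ 0) :
    toMatrix g * toMatrix (symInv g) = 1 :=
  Matrix.mul_nonsing_inv _ (isUnit_iff_ne_zero.2 hg)

theorem det_symInv_ne_zero {g : SymForm} (hg : (toMatrix g).det ≠ 0) :
    (toMatrix (symInv g)).det ≠ 0 := by
  rw [toMatrix_symInv, Matrix.det_nonsing_inv, Ring.inverse_eq_inv']
  exact inv_ne_zero hg

theorem symInv_symInv {g : SymForm} (hg : (toMatrix g).det ≠ 0) : symInv (symInv g) = g := by
  apply Subtype.ext
  funext a b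
  change ((toMatrix g)⁻¹)⁻¹ a b = toMatrix g a b
  rw [Matrix.nonsing_inv_nonsing_inv _ (isUnit_iff_ne_zero.2 hg)]

theorem eventually_det_ne_zero {g : SymForm} (hg : (toMatrix g).det ≠ 0) :
    ∀ᶠ g' : SymForm in 𝓝 g, (toMatrix g').det ≠ 0 :=
  (contDiffAt_det (n := 0) fun i j => contDiffAt_coe_symForm contDiffAt_id i j).continuousAt.eventually_ne hg

/-- Reduces a derivative to algebra wherever the Lagrangian is a polynomial of degree at most two
along the test direction; the linear coefficient is the derivative. -/
theorem fderiv_apply_of_quadratic {X : Type*} [NormedAddCommGroup X] [NormedSpace ℝ X]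
    {ψ : X → ℝ} {x δ : X} (h : DifferentiableAt ℝ ψ x) {m q : ℝ}
    (hq : ∀ t : ℝ, ψ (x + t • δ) = ψ x + t * m + t ^ 2 * q) : fderiv ℝ ψ x δ = m := by
  have h1 : HasDerivAt (fun t : ℝ => ψ (x + t • δ)) (fderiv ℝ ψ x δ) 0 :=
    h.hasFDerivAt.hasLineDerivAt δ
  have h2 : HasDerivAt (fun t : ℝ => ψ x + t * m + t ^ 2 * q) m 0 := by
    have := (((hasDerivAt_id (0 : ℝ)).mul_const m).const_add (ψ x)).fun_add
      (((hasDerivAt_id (0 : ℝ)).pow 2).mul_const q)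
    simpa using! this
  rw [funext hq] at h1
  exact h1.unique h2

/-- Jacobi's formula: factor `det (g + t w) = det g · det (1 + t N)` with `N = g⁻¹ w`, and the
linear coefficient of the second factor is the trace of `N`. -/
theorem fderiv_det {g : SymForm} (hg : (toMatrix g).det ≠ 0) (w : SymForm) :
    fderiv ℝ (fun g : SymForm => (toMatrix g).det) g w =
      (toMatrix g).det * (toMatrix (symInv g) * toMatrix w).trace := by
  have hd : DifferentiableAt ℝ (fun g : SymForm => (toMatrix g).det) g :=
    (contDiffAt_det (n := 1) fun i j => contDiffAt_coe_symForm contDiffAt_id i j).differentiableAt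
      (by simp)
  have h1 : HasDerivAt (fun t : ℝ => (toMatrix (g + t • w)).det)
    (fderiv ℝ (fun g : SymForm => (toMatrix g).det) g w) 0 := hd.hasFDerivAt.hasLineDerivAt w
  set N := toMatrix (symInv g) * toMatrix w
  have h2 : ∀ t : ℝ, (toMatrix (g + t • w)).det = (toMatrix g).det *
      (1 + N.trace * t + Polynomial.eval t (Matrix.det
        (1 + (Polynomial.X : Polynomial ℝ) • N.map Polynomial.C)).divX.divX * t ^ 2) := fun t => by
    rw [← Matrix.det_one_add_smul, ← Matrix.det_mul, mul_add, mul_one, Matrix.mul_smul, ← Matrix.mul_assoc, mul_symInv hg,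
      Matrix.one_mul]
    rfl
  rw [funext h2] at h1
  refine h1.unique ?_
  have h3 : HasDerivAt (fun t : ℝ => 1 + N.trace * t + Polynomial.eval t
      (Matrix.det (1 + (Polynomial.X : Polynomial ℝ) • N.map Polynomial.C)).divX.divX * t ^ 2)
      (N.trace) 0 := by
    have := (((hasDerivAt_id (0 : ℝ)).const_mul N.trace).const_add 1).fun_add
      ((Polynomial.hasDerivAt
        (Matrix.det (1 + (Polynomial.X : Polynomial ℝ) • N.map Polynomial.C)).divX.divX 0).fun_mul
        ((hasDerivAt_id (0 : ℝ)).pow 2))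
    simpa using! this
  exact h3.const_mul _

theorem fderiv_sqrtDet {g : SymForm} (hg : (toMatrix g).det ≠ 0) (w : SymForm) :
    fderiv ℝ sqrtDet g w =
      1 / 2 * (toMatrix (symInv g) * toMatrix w).trace * sqrtDet g := by
  have hd : DifferentiableAt ℝ (fun g : SymForm => (toMatrix g).det) g :=
    (contDiffAt_det (n := 1) fun i j => contDiffAt_coe_symForm contDiffAt_id i j).differentiableAt
      (by simp)
  have h1 : HasDerivAt (fun t : ℝ => (toMatrix (g + t • w)).det)
    (fderiv ℝ (fun g : SymForm => (toMatrix g).det) g w) 0 := hd.hasFDerivAt.hasLineDerivAt w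
  rw [fderiv_det hg] at h1
  have hs : HasDerivAt (fun t : ℝ => sqrtDet (g + t • w)) (fderiv ℝ sqrtDet g w) 0 :=
    ((contDiffAt_sqrtDet hg).differentiableAt (by simp)).hasFDerivAt.hasLineDerivAt w
  have h0 : (toMatrix (g + (0 : ℝ) • w)).det = (toMatrix g).det := by simp
  have h2 := ((hasDerivAt_abs (x := (toMatrix (g + (0 : ℝ) • w)).det)
    (by rwa [h0])).comp (0 : ℝ) h1).sqrt (by simpa using hg)
  rw [hs.unique h2, h0]
  simp only [Function.comp_apply, h0]
  change _ = 1 / 2 * (toMatrix (symInv g) * toMatrix w).trace * Real.sqrt |(toMatrix g).det|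
  have hp : (0 : ℝ) < |(toMatrix g).det| := abs_pos.2 hg
  -- The sign from differentiating the absolute value is absorbed here, which makes the formula
  -- independent of the signature.
  have hsg : (SignType.sign (toMatrix g).det : ℝ) * (toMatrix g).det = |(toMatrix g).det| :=
    sign_mul_self _
  have hsq : Real.sqrt |(toMatrix g).det| ≠ 0 := (Real.sqrt_pos.2 hp).ne'
  rw [← mul_assoc, hsg, div_eq_iff (by positivity)]
  have := Real.mul_self_sqrt hp.le
  linear_combination -(toMatrix (symInv g) * toMatrix w).trace * this

/-- The derivative of the inverse of a curve of metrics. -/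
theorem hasFDerivAt_symInv_apply {g : SymForm} (hg : (toMatrix g).det ≠ 0) (w : SymForm) :
    toMatrix (fderiv ℝ symInv g w) =
      -(toMatrix (symInv g) * toMatrix w * toMatrix (symInv g)) := by
  have hd := ((contDiffAt_symInv hg).differentiableAt (by simp)).hasFDerivAt.hasLineDerivAt w
  have hD : HasDerivAt (fun t : ℝ => symInv (g + t • w)) (fderiv ℝ symInv g w) 0 := hd
  have hc : ∀ a b, HasDerivAt (fun t : ℝ => toMatrix (symInv (g + t • w)) a b)
      (toMatrix (fderiv ℝ symInv g w) a b) 0 := fun a b =>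
    hasDerivAt_pi.1 (hasDerivAt_pi.1 ((SymForm.subtypeL.hasFDerivAt.comp_hasDerivAt 0 hD)) a) b
  have hw : ∀ a b, HasDerivAt (fun t : ℝ => toMatrix (g + t • w) a b) (toMatrix w a b) 0 :=
    fun a b => by
      have := ((hasDerivAt_id (0 : ℝ)).mul_const (toMatrix w a b)).const_add (toMatrix g a b)
      simpa using this
  have hev : ∀ᶠ t : ℝ in 𝓝 0, (toMatrix (g + t • w)).det ≠ 0 := by
    have hcont : ContinuousAt (fun t : ℝ => g + t • w) 0 := by fun_prop
    refine hcont.eventually (p := fun g' => (toMatrix g').det ≠ 0) ?_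
    simpa using eventually_det_ne_zero hg
  -- Differentiate `g⁻¹ g = 1`, which holds along the curve only near `t = 0`.
  have key : toMatrix (fderiv ℝ symInv g w) * toMatrix g + toMatrix (symInv g) * toMatrix w = 0 := by
    ext a b
    have h1 : HasDerivAt (fun t : ℝ => (toMatrix (symInv (g + t • w)) * toMatrix (g + t • w)) a b)
        ((toMatrix (fderiv ℝ symInv g w) * toMatrix g + toMatrix (symInv g) * toMatrix w) a b) 0 := by
      simp only [Matrix.mul_apply, Matrix.add_apply, ← Finset.sum_add_distrib]
      have := HasDerivAt.fun_sum (u := Finset.univ) fun c _ => (hc a c).mul (hw c b)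
      simpa using this
    refine h1.unique ((hasDerivAt_const (0 : ℝ) ((1 : Matrix (Fin 4) (Fin 4) ℝ) a b)).congr_of_eventuallyEq ?_)
    filter_upwards [hev] with t ht
    rw [symInv_mul ht]
  have := congrArg (· * toMatrix (symInv g)) key
  simp only [add_mul, Matrix.mul_assoc, mul_symInv hg, Matrix.mul_one, Matrix.zero_mul] at this
  rw [eq_neg_iff_add_eq_zero, Matrix.mul_assoc]
  exact this

end Metric

section

variable {V : Type*} [NormedAddCommGroup V] [NormedSpace ℝ V] (𝔊 : GaugeGroup V)

/-- A shortcut for instance search. -/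
noncomputable abbrev GaugeGroup.lieSeminormed : SeminormedAddCommGroup 𝔊.lie :=
  NormedAddCommGroup.toSeminormedAddCommGroup

end

attribute [local instance] GaugeGroup.lieSeminormed

/-! ### Smoothness of the Lagrangians on nondegenerate jets. -/

section Lagrangians

variable {V : Type*} [NormedAddCommGroup V] [NormedSpace ℝ V] [FiniteDimensional ℝ V]
  {𝔊 : GaugeGroup V}

/-- The Lagrangian `Λ(x, g, φ, ∇φ) √|g|` of a matter field in coordinates. -/
noncomputable def matterDensity (Λ : Base × SymForm × V × (Fin 4 → V) → ℝ) (j : Jet (Fibre 𝔊)) : ℝ :=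
  Λ (j.1, j.2.1.metric, j.2.1.matter, covMatter j) * sqrtDet j.2.1.metric

theorem contDiff_dcoord (a : Fin 4) :
    ContDiff ℝ ∞ (fun j : Jet (Fibre 𝔊) => dcoord j a) :=
  (contDiff_snd.comp contDiff_snd).clm_apply contDiff_const

theorem contDiff_covMatter : ContDiff ℝ ∞ (covMatter : Jet (Fibre 𝔊) → Fin 4 → V) := by
  refine contDiff_pi.2 fun a => ?_
  refine (contDiff_fst.comp (contDiff_dcoord a)).sub (ContDiff.clm_apply ?_ ?_)
  · exact (𝔊.lie.subtypeL.contDiff.comp (contDiff_apply ℝ 𝔊.lie a)).comp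
      (contDiff_fst.comp (contDiff_snd.comp (contDiff_fst.comp contDiff_snd)))
  · exact contDiff_fst.comp (contDiff_fst.comp contDiff_snd)

theorem contDiff_gauge (a : Fin 4) :
    ContDiff ℝ ∞ (fun y : Fibre 𝔊 => y.gauge a) :=
  (contDiff_apply ℝ 𝔊.lie a).comp (contDiff_fst.comp contDiff_snd)

theorem contDiff_conn (a b c : Fin 4) :
    ContDiff ℝ ∞ (fun y : Fibre 𝔊 => y.conn a b c) :=
  contDiff_pi.1 (contDiff_pi.1 (contDiff_pi.1
    (contDiff_snd.comp (contDiff_snd.comp contDiff_snd)) a) b) c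

theorem contDiffAt_bracket {X : Type*} [NormedAddCommGroup X] [NormedSpace ℝ X] {x : X}
    {A B : X → 𝔊.lie} (hA : ContDiffAt ℝ ∞ A x) (hB : ContDiffAt ℝ ∞ B x) :
    ContDiffAt ℝ ∞ (fun x => 𝔊.bracket (A x) (B x)) x := by
  rw [contDiffAt_submodule_iff] at hA hB ⊢
  exact (hA.clm_comp hB).sub (hB.clm_comp hA)

theorem contDiff_gaugeCurv (a b : Fin 4) :
    ContDiff ℝ ∞ (fun j : Jet (Fibre 𝔊) => gaugeCurv j a b) := by
  have h : ∀ a, ContDiff ℝ ∞ (fun j : Jet (Fibre 𝔊) => j.2.1.gauge a) := fun a =>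
    (contDiff_gauge a).comp (contDiff_fst.comp contDiff_snd)
  exact (((contDiff_gauge a).comp (contDiff_dcoord b)).sub
    ((contDiff_gauge b).comp (contDiff_dcoord a))).add
      (contDiff_iff_contDiffAt.2 fun j =>
        contDiffAt_bracket (h a).contDiffAt (h b).contDiffAt)

theorem contDiff_riemann (a b c d : Fin 4) :
    ContDiff ℝ ∞ (fun j : Jet (Fibre 𝔊) => riemann j a b c d) := by
  have h : ∀ a b c, ContDiff ℝ ∞ (fun j : Jet (Fibre 𝔊) => j.2.1.conn a b c) := fun a b c =>
    (contDiff_conn a b c).comp (contDiff_fst.comp contDiff_snd)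
  exact (((contDiff_conn a c d).comp (contDiff_dcoord b)).sub
    ((contDiff_conn b c d).comp (contDiff_dcoord a))).add
      (ContDiff.sum fun e _ => ((h _ _ _).mul (h _ _ _)).sub ((h _ _ _).mul (h _ _ _)))

theorem contDiffAt_bilin {X W : Type*} [NormedAddCommGroup X] [NormedSpace ℝ X]
    [NormedAddCommGroup W] [NormedSpace ℝ W] [FiniteDimensional ℝ W] (B : W →ₗ[ℝ] W →ₗ[ℝ] ℝ)
    {x : X} {f g : X → W} (hf : ContDiffAt ℝ ∞ f x) (hg : ContDiffAt ℝ ∞ g x) :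
    ContDiffAt ℝ ∞ (fun x => B (f x) (g x)) x :=
  (((LinearMap.toContinuousLinearMap ((LinearMap.toContinuousLinearMap :
    (W →ₗ[ℝ] ℝ) ≃ₗ[ℝ] (W →L[ℝ] ℝ)).toLinearMap ∘ₗ B)).contDiff.contDiffAt.comp x hf).clm_apply hg)

variable {j : Jet (Fibre 𝔊)}

theorem contDiff_jet_metric : ContDiff ℝ ∞ (fun j : Jet (Fibre 𝔊) => j.2.1.metric) :=
  contDiff_fst.comp (contDiff_snd.comp (contDiff_snd.comp (contDiff_fst.comp contDiff_snd)))

theorem contDiffAt_jet_symInv (hj : (toMatrix j.2.1.metric).det ≠ 0) (a b : Fin 4) :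
    ContDiffAt ℝ ∞ (fun j : Jet (Fibre 𝔊) =>
      (symInv j.2.1.metric : Fin 4 → Fin 4 → ℝ) a b) j :=
  have h : ContDiffAt ℝ ∞ (fun j : Jet (Fibre 𝔊) => symInv j.2.1.metric) j :=
    ContDiffAt.comp (g := symInv) (f := fun j : Jet (Fibre 𝔊) => j.2.1.metric) j
      (contDiffAt_symInv hj) contDiff_jet_metric.contDiffAt
  contDiffAt_coe_symForm h a b

theorem contDiffAt_jet_sqrtDet (hj : (toMatrix j.2.1.metric).det ≠ 0) :
    ContDiffAt ℝ ∞ (fun j : Jet (Fibre 𝔊) => sqrtDet j.2.1.metric) j :=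
  ContDiffAt.comp (g := sqrtDet) (f := fun j : Jet (Fibre 𝔊) => j.2.1.metric) j
    (contDiffAt_sqrtDet hj) contDiff_jet_metric.contDiffAt

theorem contDiffAt_lagGrav (hj : (toMatrix j.2.1.metric).det ≠ 0) :
    ContDiffAt ℝ ∞ (lagGrav : Jet (Fibre 𝔊) → ℝ) j := by
  refine ContDiffAt.mul ?_ (contDiffAt_jet_sqrtDet hj)
  refine ContDiffAt.sum fun a _ => ContDiffAt.sum fun c _ => ?_
  exact (contDiffAt_jet_symInv hj a c).mul
    (ContDiffAt.sum fun b _ => (contDiff_riemann a b b c).contDiffAt)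

theorem contDiffAt_lagGauge (hj : (toMatrix j.2.1.metric).det ≠ 0) :
    ContDiffAt ℝ ∞ (lagGauge : Jet (Fibre 𝔊) → ℝ) j := by
  refine ContDiffAt.mul (contDiffAt_const.mul ?_) (contDiffAt_jet_sqrtDet hj)
  refine ContDiffAt.sum fun a _ => ContDiffAt.sum fun b _ => ContDiffAt.sum fun c _ =>
    ContDiffAt.sum fun d _ => ?_
  exact ((contDiffAt_jet_symInv hj a c).mul (contDiffAt_jet_symInv hj b d)).mul
    (contDiffAt_bilin _ (contDiff_gaugeCurv a b).contDiffAt (contDiff_gaugeCurv c d).contDiffAt)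

theorem contDiffAt_matterDensity {Λ : Base × SymForm × V × (Fin 4 → V) → ℝ}
    (hj : (toMatrix j.2.1.metric).det ≠ 0)
    (hΛ : ContDiffAt ℝ ∞ Λ (j.1, j.2.1.metric, j.2.1.matter, covMatter j)) :
    ContDiffAt ℝ ∞ (matterDensity Λ : Jet (Fibre 𝔊) → ℝ) j := by
  refine ContDiffAt.mul ?_ (contDiffAt_jet_sqrtDet hj)
  exact ContDiffAt.comp (g := Λ) (f := fun j : Jet (Fibre 𝔊) =>
    (j.1, j.2.1.metric, j.2.1.matter, covMatter j)) j hΛ (contDiff_fst.prodMk (contDiff_jet_metric.prodMk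
    ((contDiff_fst.comp (contDiff_fst.comp contDiff_snd)).prodMk contDiff_covMatter))).contDiffAt

theorem differentiableAt_jet_snd {F : Type*} [NormedAddCommGroup F] [NormedSpace ℝ F]
    {ℓ : Jet F → ℝ} {j : Jet F} (h : ContDiffAt ℝ ∞ ℓ j) :
    DifferentiableAt ℝ (fun z => ℓ (j.1, j.2.1, z)) j.2.2 := by
  have h1 : DifferentiableAt ℝ ℓ ((j.1, j.2.1, j.2.2) : Jet F) := h.differentiableAt (by simp)
  exact DifferentiableAt.comp (g := ℓ) j.2.2 h1 (by fun_prop)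

theorem differentiableAt_jet_fst {F : Type*} [NormedAddCommGroup F] [NormedSpace ℝ F]
    {ℓ : Jet F → ℝ} {j : Jet F} (h : ContDiffAt ℝ ∞ ℓ j) :
    DifferentiableAt ℝ (fun y => ℓ (j.1, y, j.2.2)) j.2.1 := by
  have h1 : DifferentiableAt ℝ ℓ ((j.1, j.2.1, j.2.2) : Jet F) := h.differentiableAt (by simp)
  exact DifferentiableAt.comp (g := ℓ) j.2.1 h1 (by fun_prop)

theorem momentum_of_quadratic {F : Type*} [NormedAddCommGroup F] [NormedSpace ℝ F]
    {ℓ : Jet F → ℝ} {j : Jet F} (h : ContDiffAt ℝ ∞ ℓ j) {a : Fin 4} {δ : F} {m q : ℝ}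
    (hq : ∀ t : ℝ, ℓ (j.1, j.2.1, j.2.2 + t • (stdCovec a).smulRight δ) = ℓ j + t * m + t ^ 2 * q) :
    momentum ℓ j a δ = m :=
  fderiv_apply_of_quadratic (differentiableAt_jet_snd h) hq

theorem dcoord_add_smul (x : Base) (y : Fibre 𝔊) (z : Base →L[ℝ] Fibre 𝔊) (t : ℝ) (a : Fin 4)
    (δ : Fibre 𝔊) (b : Fin 4) :
    dcoord (x, y, z + t • (stdCovec a).smulRight δ) b =
      dcoord (x, y, z) b + (if a = b then t else 0) • δ := by
  have : stdCovec a (stdVec b) = if a = b then 1 else 0 := stdCovec_stdVec a b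
  simp only [dcoord, add_apply, smul_apply, ContinuousLinearMap.smulRight_apply, this]
  split_ifs <;> simp

end Lagrangians

/-! ### Momenta of the three Lagrangians. -/

section Momenta

variable {V : Type*} [NormedAddCommGroup V] [NormedSpace ℝ V] [FiniteDimensional ℝ V]
  {𝔊 : GaugeGroup V} {j : Jet (Fibre 𝔊)}

theorem conn_dcoord_add_smul (j : Jet (Fibre 𝔊)) (t : ℝ) (e : Fin 4) (δ : Fibre 𝔊)
    (b p q r : Fin 4) :
    (dcoord (j.1, j.2.1, j.2.2 + t • (stdCovec e).smulRight δ) b).conn p q r =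
      (dcoord j b).conn p q r + (if e = b then t else 0) * δ.conn p q r := by
  rw [dcoord_add_smul]
  rfl

theorem gauge_dcoord_add_smul (j : Jet (Fibre 𝔊)) (t : ℝ) (e : Fin 4) (δ : Fibre 𝔊)
    (b p : Fin 4) :
    (dcoord (j.1, j.2.1, j.2.2 + t • (stdCovec e).smulRight δ) b).gauge p =
      (dcoord j b).gauge p + (if e = b then t else 0) • δ.gauge p := by
  rw [dcoord_add_smul]
  rfl

theorem matter_dcoord_add_smul (j : Jet (Fibre 𝔊)) (t : ℝ) (e : Fin 4) (δ : Fibre 𝔊)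
    (b : Fin 4) :
    (dcoord (j.1, j.2.1, j.2.2 + t • (stdCovec e).smulRight δ) b).matter =
      (dcoord j b).matter + (if e = b then t else 0) • δ.matter := by
  rw [dcoord_add_smul]
  rfl

theorem riemann_add_smul (j : Jet (Fibre 𝔊)) (t : ℝ) (e : Fin 4) (δ : Fibre 𝔊)
    (a b c d : Fin 4) :
    riemann (j.1, j.2.1, j.2.2 + t • (stdCovec e).smulRight δ) a b c d = riemann j a b c d +
      t * ((if e = b then δ.conn a c d else 0) - (if e = a then δ.conn b c d else 0)) := by
  simp only [riemann, conn_dcoord_add_smul]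
  split_ifs <;> ring

theorem momentum_lagGrav (hj : (toMatrix j.2.1.metric).det ≠ 0) (e : Fin 4) (δ : Fibre 𝔊) :
    momentum lagGrav j e δ =
      (∑ a, ∑ c, (symInv j.2.1.metric : Fin 4 → Fin 4 → ℝ) a c * δ.conn a e c
        - ∑ c, (symInv j.2.1.metric : Fin 4 → Fin 4 → ℝ) e c * ∑ b, δ.conn b b c) *
        sqrtDet j.2.1.metric := by
  -- The quadratic coefficient is `0`: the curvature is affine in the derivative coordinates.
  refine momentum_of_quadratic (contDiffAt_lagGrav hj) (q := 0) fun t => ?_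
  have h : ∀ a c, ricci (j.1, j.2.1, j.2.2 + t • (stdCovec e).smulRight δ) a c = ricci j a c +
      t * (δ.conn a e c - if e = a then ∑ b, δ.conn b b c else 0) := fun a c => by
    simp only [ricci, riemann_add_smul, Finset.sum_add_distrib, ← Finset.mul_sum,
      Finset.sum_sub_distrib, Finset.sum_ite_eq, Finset.mem_univ, if_true]
    split_ifs <;> simp
  have h' : ∑ a, ∑ c, (symInv j.2.1.metric : Fin 4 → Fin 4 → ℝ) a c *
      (if e = a then ∑ b, δ.conn b b c else 0) =
      ∑ c, (symInv j.2.1.metric : Fin 4 → Fin 4 → ℝ) e c * ∑ b, δ.conn b b c := by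
    rw [Finset.sum_comm]
    simp only [mul_ite, mul_zero, Finset.sum_ite_eq, Finset.mem_univ, if_true]
  simp only [lagGrav, scalarCurv, h, mul_add, Finset.sum_add_distrib, mul_left_comm _ t,
    ← Finset.mul_sum, mul_sub, Finset.sum_sub_distrib]
  simp only [← mul_sub, h']
  ring

theorem gaugeCurv_add_smul (j : Jet (Fibre 𝔊)) (t : ℝ) (e : Fin 4) (δ : Fibre 𝔊)
    (a b : Fin 4) :
    gaugeCurv (j.1, j.2.1, j.2.2 + t • (stdCovec e).smulRight δ) a b = gaugeCurv j a b +
      t • ((if e = b then δ.gauge a else 0) - (if e = a then δ.gauge b else 0)) := by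
  simp only [gaugeCurv, gauge_dcoord_add_smul]
  split_ifs <;> simp only [zero_smul, smul_sub, smul_zero] <;> abel

theorem pairing_gaugeCurv_add_smul (t : ℝ) (A A' B B' : 𝔊.lie) :
    𝔊.pairing (A + t • A') (B + t • B') = 𝔊.pairing A B +
      t * (𝔊.pairing A' B + 𝔊.pairing B' A) + t ^ 2 * 𝔊.pairing A' B' := by
  simp only [map_add, map_smul, LinearMap.add_apply, LinearMap.smul_apply, smul_eq_mul]
  rw [𝔊.pairing_symm A B']
  ring

theorem sum_quadratic {ι : Type*} (s : Finset ι) (t : ℝ) (A B C : ι → ℝ) :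
    ∑ i ∈ s, (A i + t * B i + t ^ 2 * C i) =
      ∑ i ∈ s, A i + t * ∑ i ∈ s, B i + t ^ 2 * ∑ i ∈ s, C i := by
  simp only [Finset.sum_add_distrib, Finset.mul_sum]

theorem mul_quadratic (r t A B C : ℝ) :
    r * (A + t * B + t ^ 2 * C) = r * A + t * (r * B) + t ^ 2 * (r * C) := by ring

theorem momentum_lagGauge (hj : (toMatrix j.2.1.metric).det ≠ 0) (e : Fin 4) (δ : Fibre 𝔊) :
    momentum lagGauge j e δ =
      -(1 / 4) * (∑ a, ∑ b, ∑ c, ∑ d,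
        (symInv j.2.1.metric : Fin 4 → Fin 4 → ℝ) a c *
        (symInv j.2.1.metric : Fin 4 → Fin 4 → ℝ) b d *
        (𝔊.pairing ((if e = b then δ.gauge a else 0) - (if e = a then δ.gauge b else 0))
            (gaugeCurv j c d)
          + 𝔊.pairing ((if e = d then δ.gauge c else 0) - (if e = c then δ.gauge d else 0))
            (gaugeCurv j a b))) * sqrtDet j.2.1.metric := by
  -- The curvature is affine in the derivatives and the Lagrangian is quadratic in it; `q` is the
  -- Lagrangian form on the increment of the curvature.
  refine momentum_of_quadratic (contDiffAt_lagGauge hj) (q :=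
    -(1 / 4) * (∑ a, ∑ b, ∑ c, ∑ d,
        (symInv j.2.1.metric : Fin 4 → Fin 4 → ℝ) a c *
        (symInv j.2.1.metric : Fin 4 → Fin 4 → ℝ) b d *
        𝔊.pairing ((if e = b then δ.gauge a else 0) - (if e = a then δ.gauge b else 0))
            ((if e = d then δ.gauge c else 0) - (if e = c then δ.gauge d else 0))) *
            sqrtDet j.2.1.metric) fun t => ?_
  simp only [lagGauge, gaugeCurv_add_smul, pairing_gaugeCurv_add_smul, mul_quadratic,
    sum_quadratic]
  ring

theorem covMatter_add_smul (j : Jet (Fibre 𝔊)) (t : ℝ) (e : Fin 4) (δ : Fibre 𝔊) :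
    covMatter (j.1, j.2.1, j.2.2 + t • (stdCovec e).smulRight δ) =
      covMatter j + t • Pi.single (M := fun _ => V) e δ.matter := by
  funext a
  simp only [covMatter, matter_dcoord_add_smul, Pi.add_apply, Pi.smul_apply, Pi.single_apply,
    eq_comm (a := a)]
  split_ifs
  · abel
  · rw [zero_smul, smul_zero, add_zero, add_zero]

theorem momentum_matterDensity {Λ : Base × SymForm × V × (Fin 4 → V) → ℝ}
    (hj : (toMatrix j.2.1.metric).det ≠ 0)
    (hΛ : ContDiffAt ℝ ∞ Λ (j.1, j.2.1.metric, j.2.1.matter, covMatter j)) (e : Fin 4)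
    (δ : Fibre 𝔊) :
    momentum (matterDensity Λ) j e δ =
      fderiv ℝ Λ (j.1, j.2.1.metric, j.2.1.matter, covMatter j) (0, 0, 0, Pi.single e δ.matter) *
        sqrtDet j.2.1.metric := by
  have h1 := (differentiableAt_jet_snd (contDiffAt_matterDensity hj
    hΛ)).hasFDerivAt.hasLineDerivAt ((stdCovec e).smulRight δ)
  have h2 := ((hΛ.differentiableAt (by simp)).hasFDerivAt.hasLineDerivAt
    ((0, 0, 0, Pi.single e δ.matter) : Base × SymForm × V × (Fin 4 → V)))
  have h3 : HasDerivAt (fun t : ℝ => matterDensity Λ (j.1, j.2.1, j.2.2 + t •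
    (stdCovec e).smulRight δ)) (momentum (matterDensity Λ) j e δ) 0 := h1
  have h4 : HasDerivAt (fun t : ℝ => Λ ((j.1, j.2.1.metric, j.2.1.matter, covMatter j)
    + t • ((0, 0, 0, Pi.single e δ.matter) : Base × SymForm × V × (Fin 4 → V))) *
      sqrtDet j.2.1.metric) _ 0 := HasDerivAt.mul_const h2 (sqrtDet j.2.1.metric)
  refine h3.unique ?_
  convert! h4 using 2 with t
  simp [matterDensity, covMatter_add_smul]

end Momenta

/-! ### Pointwise algebra: the Palatini equation and the symmetries of the curvature. -/

section Palatini

/-- The Palatini argument at a point: `k` is the tensor density `g^{ab} √|g|`, and `dk` are its partial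
derivatives. -/
theorem palatini_algebra {k : Fin 4 → Fin 4 → ℝ} {dk Γ : Fin 4 → Fin 4 → Fin 4 → ℝ}
    (hk : ∀ a b, k a b = k b a) (hdk : ∀ r a b, dk r a b = dk r b a)
    (hΓ : ∀ a b c, Γ a b c = Γ c b a)
    (h : ∀ δ : Fin 4 → Fin 4 → Fin 4 → ℝ, (∀ a b c, δ a b c = δ c b a) →
      (∑ a, ∑ c, k a c * ∑ b, ∑ e, (δ a b e * Γ b e c + Γ a b e * δ b e c
        - (δ b b e * Γ a e c + Γ b b e * δ a e c)))
      - ∑ r, (∑ a, ∑ c, dk r a c * δ a r c - ∑ c, dk r r c * ∑ b, δ b b c) = 0) (r p q : Fin 4) :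
    dk r p q = ∑ c, Γ r p c * k c q + ∑ c, k p c * Γ r q c - (∑ b, Γ r b b) * k p q := by
  -- `D` is the covariant derivative of the tensor density `k`, and `W` turns out to be its
  -- contraction.
  let W : Fin 4 → ℝ := fun q => ∑ e, dk e e q - ∑ a, ∑ c, k a c * Γ a q c
  let D : Fin 4 → Fin 4 → Fin 4 → ℝ := fun r p q =>
    dk r p q - ∑ c, Γ r p c * k c q - ∑ c, k p c * Γ r q c + (∑ b, Γ r b b) * k p q
  have key : ∀ r p q, 2 * D r p q = (if p = r then W q else 0) + (if q = r then W p else 0) := by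
    intro r p q
    -- Test with the elementary array in the slots `(p, r, q)`, symmetrized in `p` and `q` as the
    -- admissible variations require.
    have h1 := h (fun a b c => (if a = p then 1 else 0) * (if b = r then 1 else 0) *
      (if c = q then 1 else 0) + (if a = q then 1 else 0) * (if b = r then 1 else 0) *
      (if c = p then 1 else 0)) (fun a b c => by ring)
    simp only [mul_add, add_mul, mul_sub, Finset.sum_add_distrib, Finset.sum_sub_distrib, ite_mul,
      mul_ite, one_mul, zero_mul, mul_zero, mul_one, Finset.sum_ite_eq', Finset.sum_const_zero,
      Finset.sum_ite_irrel, Finset.mem_univ, if_true] at h1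
    have e1 : ∑ x, k q x * Γ r p x = ∑ c, Γ r p c * k c q :=
      Finset.sum_congr rfl fun x _ => by rw [hk q x, mul_comm]
    have e2 : ∑ x, k x q * Γ x p r = ∑ c, Γ r p c * k c q :=
      Finset.sum_congr rfl fun x _ => by rw [hΓ x p r, mul_comm]
    have e3 : ∑ x, k x p * Γ x q r = ∑ c, k p c * Γ r q c :=
      Finset.sum_congr rfl fun x _ => by rw [hΓ x q r, hk x p]
    have e4 : ∑ x, Γ x x r = ∑ b, Γ r b b := Finset.sum_congr rfl fun x _ => hΓ x x r
    rw [e1, e2, e3, e4, hk q p, hdk r q p] at h1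
    simp only [D, W, eq_comm (a := p) (b := r), eq_comm (a := q) (b := r)]
    split_ifs at h1 ⊢ <;> linarith
  have hW : ∀ q, W q = 0 := by
    intro q
    have h1 : ∑ r, D r r q = W q := by
      have h2 : ∑ r, ∑ c, Γ r r c * k c q = ∑ r, (∑ b, Γ r b b) * k r q := by
        rw [Finset.sum_comm]
        simp only [Finset.sum_mul, hΓ _ _ _]
      simp only [D, W, Finset.sum_add_distrib, Finset.sum_sub_distrib, h2]
      ring
    -- Contracting `key` gives `2 W = (4 + 1) W`, so `W = 0` and then `D = 0`.
    have h2 : ∑ r, 2 * D r r q = 4 * W q + W q := by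
      simp [key, Finset.sum_add_distrib]
    rw [← Finset.mul_sum, h1] at h2
    linarith
  have := key r p q
  simp only [hW, ite_self, add_zero] at this
  simp only [D] at this
  linarith

/-- A covariantly constant tensor density `g^{ab} √|g|` in dimension four has a covariantly constant
inverse metric. -/
theorem inverse_of_density {G H H' w N : Matrix (Fin 4) (Fin 4) ℝ} {r σ : ℝ} (hr : r ≠ 0)
    (hHG : H * G = 1) (hH' : H' = -(H * w * H)) (hσ : σ = 1 / 2 * (H * w).trace)
    (h : r • H' + (σ * r) • H = r • (N * H + H * N.transpose) - (N.trace * r) • H) :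
    H' = N * H + H * N.transpose := by
  have hGH : G * H = 1 := mul_eq_one_comm.1 hHG
  have h1 : H' = N * H + H * N.transpose - (N.trace + σ) • H := by
    have : r • H' = r • (N * H + H * N.transpose - (N.trace + σ) • H) := by
      rw [smul_sub, smul_smul, mul_add, add_smul, mul_comm r N.trace, mul_comm r σ]
      rw [eq_sub_of_add_eq h]
      abel
    exact smul_right_injective _ hr this
  -- Contraction with the metric gives `-2σ = 2 tr N - 4 (tr N + σ)`, that is `tr N + σ = 0`; in
  -- dimension `n` the factor would be `n - 2`.
  have h2 := congrArg (fun A => (A * G).trace) h1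
  have e1 : (H' * G).trace = -(2 * σ) := by
    rw [hH', neg_mul, Matrix.mul_assoc, hHG, Matrix.mul_one, Matrix.trace_neg, hσ]
    ring
  have e2 : (N * H * G).trace = N.trace := by rw [Matrix.mul_assoc, hHG, Matrix.mul_one]
  have e3 : (H * N.transpose * G).trace = N.trace := by
    rw [Matrix.trace_mul_comm, ← Matrix.mul_assoc, hGH, Matrix.one_mul, Matrix.trace_transpose]
  simp only [sub_mul, add_mul, Matrix.trace_sub, Matrix.trace_add, Matrix.smul_mul,
    Matrix.trace_smul, e1, e2, e3, hHG, Matrix.trace_one] at h2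
  simp only [Fintype.card_fin, smul_eq_mul] at h2
  have h3 : N.trace + σ = 0 := by push_cast at h2; linarith
  rw [h1, h3, zero_smul, sub_zero]

/-- The curvature of a connection whose covariant derivative annihilates the inverse metric is
antisymmetric. -/
theorem curvature_antisymm {H Nr Nq dqNr drNq : Matrix (Fin 4) (Fin 4) ℝ}
    (h : dqNr * H + Nr * (Nq * H + H * Nq.transpose)
        + ((Nq * H + H * Nq.transpose) * Nr.transpose + H * dqNr.transpose) =
      drNq * H + Nq * (Nr * H + H * Nr.transpose)
        + ((Nr * H + H * Nr.transpose) * Nq.transpose + H * drNq.transpose)) :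
    (dqNr - drNq + (Nr * Nq - Nq * Nr)) * H
      + H * (dqNr - drNq + (Nr * Nq - Nq * Nr)).transpose = 0 := by
  -- `h` is the equality of the mixed second derivatives of `H`, with first derivatives replaced by
  -- `N H + H Nᵀ`; the terms `Nr H Nqᵀ` and `Nq H Nrᵀ` cancel in the difference.
  rw [← sub_eq_zero] at h
  rw [← h]
  simp only [Matrix.transpose_add, Matrix.transpose_sub, Matrix.transpose_mul]
  noncomm_ring

/-- The Ricci tensor of a torsion-free metric connection is symmetric. -/
theorem ricci_symm_of_antisymm {R : Fin 4 → Fin 4 → Fin 4 → Fin 4 → ℝ}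
    {H G : Matrix (Fin 4) (Fin 4) ℝ} (hHG : H * G = 1)
    (hR : ∀ a b c d, R a b c d = -R b a c d)
    (hB : ∀ a b c d, R a b c d + R b d c a + R d a c b = 0)
    (hA : ∀ a b, Matrix.of (R a b) * H + H * (Matrix.of (R a b)).transpose = 0) (a c : Fin 4) :
    ∑ b, R a b b c = ∑ b, R c b b a := by
  have hGH : G * H = 1 := mul_eq_one_comm.1 hHG
  -- Contracting the antisymmetry relation with the metric gives `2 tr R_{ab} = 0`.
  have htr : ∀ a b, ∑ c, R a b c c = 0 := fun a b => by
    have h := congrArg (fun A => (A * G).trace) (hA a b)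
    simp only [add_mul, Matrix.mul_assoc, hHG, Matrix.trace_add, Matrix.mul_one, Matrix.zero_mul,
      Matrix.trace_zero] at h
    rw [Matrix.trace_mul_comm H, Matrix.mul_assoc, hGH, Matrix.mul_one,
      Matrix.trace_transpose] at h
    have h' : (Matrix.of (R a b)).trace = 0 := by linarith
    exact h'
  -- Contract the first Bianchi identity; the term `R_{ca}^b_b` drops out by `htr`.
  have h := Finset.sum_congr rfl fun b (_ : b ∈ Finset.univ) => hB a b b c
  simp only [Finset.sum_add_distrib, htr, Finset.sum_const_zero, add_zero] at h
  have h2 : ∑ b, R b c b a = -∑ b, R c b b a := by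
    rw [← Finset.sum_neg_distrib]
    exact Finset.sum_congr rfl fun b _ => hR _ _ _ _
  linarith

/-- The contraction `g^{ac} R_{ab}^e_c` is the Ricci tensor. -/
theorem contraction_of_antisymm {R : Fin 4 → Fin 4 → Fin 4 → Fin 4 → ℝ}
    {h : Fin 4 → Fin 4 → ℝ} (hh : ∀ a b, h a b = h b a) (hR : ∀ a b c d, R a b c d = -R b a c d)
    (hA : ∀ a b, Matrix.of (R a b) * Matrix.of h
      + Matrix.of h * (Matrix.of (R a b)).transpose = 0) (e b : Fin 4) :
    ∑ a, ∑ c, h a c * R a b e c = ∑ c, h e c * ∑ d, R b d d c := by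
  have h1 : ∀ a, ∑ c, h a c * R a b e c = ∑ c, h e c * R b a a c := fun a => by
    have := congrFun (congrFun (hA a b) a) e
    simp only [Matrix.add_apply, Matrix.mul_apply, Matrix.transpose_apply, Matrix.of_apply,
      Matrix.zero_apply] at this
    rw [eq_neg_of_add_eq_zero_right this, ← Finset.sum_neg_distrib]
    exact Finset.sum_congr rfl fun c _ => by rw [hR a b a c, hh e c]; ring
  rw [Finset.sum_congr rfl fun a _ => h1 a, Finset.sum_comm]
  simp only [Finset.mul_sum]

end Palatini

/-! ### The total Lagrangian under variations of the connection. -/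

section Total

theorem momentum_add {F : Type*} [NormedAddCommGroup F] [NormedSpace ℝ F] {ℓ ℓ' : Jet F → ℝ}
    {j : Jet F} (h : ContDiffAt ℝ ∞ ℓ j) (h' : ContDiffAt ℝ ∞ ℓ' j) (a : Fin 4) (δ : F) :
    momentum (fun j => ℓ j + ℓ' j) j a δ = momentum ℓ j a δ + momentum ℓ' j a δ := by
  have := ((differentiableAt_jet_snd h).hasFDerivAt.add
    (differentiableAt_jet_snd h').hasFDerivAt).fderiv
  exact congrArg (fun T => T ((stdCovec a).smulRight δ)) this

theorem energyTensor_add {F : Type*} [NormedAddCommGroup F] [NormedSpace ℝ F] {ℓ ℓ' : Jet F → ℝ}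
    {s : Base → F} {x : Base} (h : ContDiffAt ℝ ∞ ℓ (jet s x)) (h' : ContDiffAt ℝ ∞ ℓ' (jet s x))
    (K : Base → F → Fin 4 → F) (a b : Fin 4) :
    energyTensor (fun j => ℓ j + ℓ' j) K s x a b =
      energyTensor ℓ K s x a b + energyTensor ℓ' K s x a b := by
  simp only [energyTensor, momentum_add h h']
  split_ifs <;> ring

variable {V : Type*} [NormedAddCommGroup V] [NormedSpace ℝ V] [FiniteDimensional ℝ V]
  {𝔊 : GaugeGroup V} {Λ : Base × SymForm × V × (Fin 4 → V) → ℝ} {j : Jet (Fibre 𝔊)}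

/-- The total Lagrangian in coordinates. -/
noncomputable def totalDensity (Λ : Base × SymForm × V × (Fin 4 → V) → ℝ) (j : Jet (Fibre 𝔊)) : ℝ :=
  lagGrav j + matterDensity Λ j + lagGauge j

theorem contDiffAt_totalDensity (hj : (toMatrix j.2.1.metric).det ≠ 0)
    (hΛ : ContDiffAt ℝ ∞ Λ (j.1, j.2.1.metric, j.2.1.matter, covMatter j)) :
    ContDiffAt ℝ ∞ (totalDensity Λ : Jet (Fibre 𝔊) → ℝ) j :=
  ((contDiffAt_lagGrav hj).add (contDiffAt_matterDensity hj hΛ)).add (contDiffAt_lagGauge hj)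

/-- Only derivatives of `φ` and `κ` enter the matter and gauge Lagrangians, so gravity alone
contributes. -/
theorem momentum_totalDensity_of_isConnVariation (hj : (toMatrix j.2.1.metric).det ≠ 0)
    (hΛ : ContDiffAt ℝ ∞ Λ (j.1, j.2.1.metric, j.2.1.matter, covMatter j)) (e : Fin 4)
    {δ : Fibre 𝔊} (hδ : IsConnVariation δ) :
    momentum (totalDensity Λ) j e δ =
      (∑ a, ∑ c, (symInv j.2.1.metric : Fin 4 → Fin 4 → ℝ) a c * δ.conn a e c
        - ∑ c, (symInv j.2.1.metric : Fin 4 → Fin 4 → ℝ) e c * ∑ b, δ.conn b b c) *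
        sqrtDet j.2.1.metric := by
  obtain ⟨h1, h2, -, -⟩ := hδ
  have h3 : momentum (matterDensity Λ) j e δ = 0 := by
    rw [momentum_matterDensity hj hΛ, h1, Pi.single_zero]
    exact (congrArg (· * _) (map_zero _)).trans (zero_mul _)
  have h4 : momentum lagGauge j e δ = 0 := by
    rw [momentum_lagGauge hj, h2]
    simp
  have h5 := momentum_add ((contDiffAt_lagGrav hj).add (contDiffAt_matterDensity hj hΛ))
    (contDiffAt_lagGauge hj) e δ
  rw [momentum_add (contDiffAt_lagGrav hj) (contDiffAt_matterDensity hj hΛ), h3, h4,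
    momentum_lagGrav hj, add_zero, add_zero] at h5
  exact h5

theorem riemann_vertical_add_smul (j : Jet (Fibre 𝔊)) (t : ℝ) (δ : Fibre 𝔊) (a b c d : Fin 4) :
    riemann (j.1, j.2.1 + t • δ, j.2.2) a b c d = riemann j a b c d
      + t * ∑ e, (δ.conn a c e * j.2.1.conn b e d + j.2.1.conn a c e * δ.conn b e d
        - (δ.conn b c e * j.2.1.conn a e d + j.2.1.conn b c e * δ.conn a e d))
      + t ^ 2 * ∑ e, (δ.conn a c e * δ.conn b e d - δ.conn b c e * δ.conn a e d) := by
  have h : ∀ p q r, (j.2.1 + t • δ).conn p q r = j.2.1.conn p q r + t * δ.conn p q r :=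
    fun _ _ _ => rfl
  simp only [riemann, h]
  rw [Finset.mul_sum, Finset.mul_sum, add_assoc, add_assoc, ← Finset.sum_add_distrib,
    ← Finset.sum_add_distrib]
  refine congrArg₂ (· + ·) rfl (Finset.sum_congr rfl fun e _ => ?_)
  ring

/-- The values of `Γ` enter only through the quadratic part of the curvature. Matter and gauge
fields give no term, which is why the connection equation has no source. -/
theorem fderiv_totalDensity_of_isConnVariation (hj : (toMatrix j.2.1.metric).det ≠ 0)
    (hΛ : ContDiffAt ℝ ∞ Λ (j.1, j.2.1.metric, j.2.1.matter, covMatter j))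
    {δ : Fibre 𝔊} (hδ : IsConnVariation δ) :
    fderiv ℝ (fun y => totalDensity Λ (j.1, y, j.2.2)) j.2.1 δ =
      (∑ a, ∑ c, (symInv j.2.1.metric : Fin 4 → Fin 4 → ℝ) a c *
        ∑ b, ∑ e, (δ.conn a b e * j.2.1.conn b e c + j.2.1.conn a b e * δ.conn b e c
        - (δ.conn b b e * j.2.1.conn a e c + j.2.1.conn b b e * δ.conn a e c))) *
        sqrtDet j.2.1.metric := by
  obtain ⟨h1, h2, h3, -⟩ := hδ
  refine fderiv_apply_of_quadratic (differentiableAt_jet_fst (contDiffAt_totalDensity hj hΛ))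
    (q := (∑ a, ∑ c, (symInv j.2.1.metric : Fin 4 → Fin 4 → ℝ) a c *
        ∑ b, ∑ e, (δ.conn a b e * δ.conn b e c - δ.conn b b e * δ.conn a e c)) *
        sqrtDet j.2.1.metric) fun t => ?_
  have e1 : (j.2.1 + t • δ).matter = j.2.1.matter := by
    change j.2.1.matter + t • δ.matter = _
    rw [h1, smul_zero, add_zero]
  have e2 : (j.2.1 + t • δ).gauge = j.2.1.gauge := by
    change j.2.1.gauge + t • δ.gauge = _
    rw [h2, smul_zero, add_zero]
  have e3 : (j.2.1 + t • δ).metric = j.2.1.metric := by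
    change j.2.1.metric + t • δ.metric = _
    rw [h3, smul_zero, add_zero]
  have e4 : matterDensity Λ (j.1, j.2.1 + t • δ, j.2.2) = matterDensity Λ j := by
    have e0 : covMatter (j.1, j.2.1 + t • δ, j.2.2) = covMatter j := by
      funext a
      simp only [covMatter, dcoord, e1, e2]
    simp only [matterDensity, e0, e1, e3]
  have e5 : lagGauge (j.1, j.2.1 + t • δ, j.2.2) = lagGauge j := by
    simp only [lagGauge, gaugeCurv, dcoord, e2, e3]
  have e6 : lagGrav (j.1, j.2.1 + t • δ, j.2.2) = lagGrav j
      + t * ((∑ a, ∑ c, (symInv j.2.1.metric : Fin 4 → Fin 4 → ℝ) a c *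
        ∑ b, ∑ e, (δ.conn a b e * j.2.1.conn b e c + j.2.1.conn a b e * δ.conn b e c
        - (δ.conn b b e * j.2.1.conn a e c + j.2.1.conn b b e * δ.conn a e c))) *
        sqrtDet j.2.1.metric)
      + t ^ 2 * ((∑ a, ∑ c, (symInv j.2.1.metric : Fin 4 → Fin 4 → ℝ) a c *
        ∑ b, ∑ e, (δ.conn a b e * δ.conn b e c - δ.conn b b e * δ.conn a e c)) *
        sqrtDet j.2.1.metric) := by
    simp only [lagGrav, scalarCurv, ricci, riemann_vertical_add_smul, e3, mul_quadratic,
      sum_quadratic]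
    ring
  simp only [totalDensity, e4, e5, e6]
  ring

end Total

/-! ### The connection field equation along a section. -/

section Section

variable {V : Type*} [NormedAddCommGroup V] [NormedSpace ℝ V] [FiniteDimensional ℝ V]
  {𝔊 : GaugeGroup V}

/-- A smooth section of the total bundle over an open set of coordinates, with nondegenerate metric
and torsion-free connection, along which the matter Lagrangian `Λ` is smooth. -/
structure IsRegular (Λ : Base × SymForm × V × (Fin 4 → V) → ℝ) (s : Base → Fibre 𝔊)
    (D : Set Base) : Prop where
  isOpen : IsOpen D
  contDiffAt : ∀ x ∈ D, ContDiffAt ℝ ∞ s x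
  det_ne_zero : ∀ x ∈ D, (toMatrix (s x).metric).det ≠ 0
  conn_symm : ∀ x ∈ D, ∀ a b c, (s x).conn a b c = (s x).conn c b a
  contDiffAt_matter : ∀ x ∈ D,
    ContDiffAt ℝ ∞ Λ (x, (s x).metric, (s x).matter, covMatter (jet s x))

variable {Λ : Base × SymForm × V × (Fin 4 → V) → ℝ} {s : Base → Fibre 𝔊} {D : Set Base}
  {x : Base}

namespace IsRegular

theorem contDiffAt_metric (h : IsRegular Λ s D) (hx : x ∈ D) :
    ContDiffAt ℝ ∞ (fun y => (s y).metric) x :=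
  ContDiffAt.comp (g := fun y : Fibre 𝔊 => y.metric) x
    (contDiff_fst.comp (contDiff_snd.comp contDiff_snd)).contDiffAt (h.contDiffAt x hx)

theorem contDiffAt_connComp (h : IsRegular Λ s D) (hx : x ∈ D) (a b c : Fin 4) :
    ContDiffAt ℝ ∞ (fun y => (s y).conn a b c) x :=
  ContDiffAt.comp (g := fun y : Fibre 𝔊 => y.conn a b c) x
    (contDiff_conn a b c).contDiffAt (h.contDiffAt x hx)

theorem fderiv_conn (h : IsRegular Λ s D) (hx : x ∈ D) (a b c r : Fin 4) :
    fderiv ℝ (fun y => (s y).conn a b c) x (stdVec r) = (dcoord (jet s x) r).conn a b c := by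
  have h1 := ((h.contDiffAt x hx).differentiableAt (by simp)).hasFDerivAt
  have h2 := hasFDerivAt_pi'.1 (hasFDerivAt_pi'.1 (hasFDerivAt_pi'.1 h1.snd.snd.snd a) b) c
  rw [h2.fderiv]
  rfl

theorem contDiffAt_inverse (h : IsRegular Λ s D) (hx : x ∈ D) (a b : Fin 4) :
    ContDiffAt ℝ ∞ (fun y => (symInv (s y).metric : Fin 4 → Fin 4 → ℝ) a b) x :=
  contDiffAt_coe_symForm (ContDiffAt.comp (g := symInv) (f := fun y => (s y).metric) x
    (contDiffAt_symInv (h.det_ne_zero x hx)) (h.contDiffAt_metric hx)) a b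

theorem contDiffAt_density (h : IsRegular Λ s D) (hx : x ∈ D) :
    ContDiffAt ℝ ∞ (fun y => sqrtDet (s y).metric) x :=
  ContDiffAt.comp (g := sqrtDet) (f := fun y => (s y).metric) x
    (contDiffAt_sqrtDet (h.det_ne_zero x hx)) (h.contDiffAt_metric hx)

theorem fderiv_density (h : IsRegular Λ s D) (hx : x ∈ D) (v : Base) :
    fderiv ℝ (fun y => sqrtDet (s y).metric) x v =
      1 / 2 * (toMatrix (symInv (s x).metric)
        * toMatrix (fderiv ℝ (fun y => (s y).metric) x v)).trace * sqrtDet (s x).metric := by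
  have h1 := HasFDerivAt.comp (g := sqrtDet) (f := fun y => (s y).metric) x
    ((contDiffAt_sqrtDet (h.det_ne_zero x hx)).differentiableAt (by simp)).hasFDerivAt
    ((h.contDiffAt_metric hx).differentiableAt (by simp)).hasFDerivAt
  rw [← fderiv_sqrtDet (h.det_ne_zero x hx)]
  exact congrArg (fun T => T v) h1.fderiv

theorem fderiv_inverse (h : IsRegular Λ s D) (hx : x ∈ D) (v : Base) (a b : Fin 4) :
    fderiv ℝ (fun y => (symInv (s y).metric : Fin 4 → Fin 4 → ℝ) a b) x v =
      (-(toMatrix (symInv (s x).metric) * toMatrix (fderiv ℝ (fun y => (s y).metric) x v) *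
        toMatrix (symInv (s x).metric))) a b := by
  have h1 := HasFDerivAt.comp (g := symInv) (f := fun y => (s y).metric) x
    ((contDiffAt_symInv (h.det_ne_zero x hx)).differentiableAt (by simp)).hasFDerivAt
    ((h.contDiffAt_metric hx).differentiableAt (by simp)).hasFDerivAt
  have h2 := hasFDerivAt_pi'.1 (hasFDerivAt_pi'.1
    (SymForm.subtypeL.hasFDerivAt.comp x h1) a) b
  rw [← hasFDerivAt_symInv_apply (h.det_ne_zero x hx)]
  exact congrArg (fun T => T v) h2.fderiv

theorem eventually_mem (h : IsRegular Λ s D) (hx : x ∈ D) : ∀ᶠ y in 𝓝 x, y ∈ D :=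
  h.isOpen.mem_nhds hx

theorem fderiv_momentum (h : IsRegular Λ s D) (hx : x ∈ D) {δ : Fibre 𝔊}
    (hδ : IsConnVariation δ) (r : Fin 4) (v : Base) :
    fderiv ℝ (fun y => momentum (totalDensity Λ) (jet s y) r δ) x v =
      ∑ a, ∑ c, fderiv ℝ (fun y => (symInv (s y).metric : Fin 4 → Fin 4 → ℝ) a c *
          sqrtDet (s y).metric) x v * δ.conn a r c
        - ∑ c, fderiv ℝ (fun y => (symInv (s y).metric : Fin 4 → Fin 4 → ℝ) r c *
          sqrtDet (s y).metric) x v * ∑ b, δ.conn b b c := by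
  have h1 : (fun y => momentum (totalDensity Λ) (jet s y) r δ) =ᶠ[𝓝 x] fun y =>
      ∑ a, ∑ c, (symInv (s y).metric : Fin 4 → Fin 4 → ℝ) a c * sqrtDet (s y).metric * δ.conn a r c
        - ∑ c, (symInv (s y).metric : Fin 4 → Fin 4 → ℝ) r c * sqrtDet (s y).metric *
          ∑ b, δ.conn b b c := by
    filter_upwards [h.eventually_mem hx] with y hy
    rw [momentum_totalDensity_of_isConnVariation (j := jet s y) (h.det_ne_zero y hy)
      (h.contDiffAt_matter y hy) r hδ, sub_mul]
    simp only [Finset.sum_mul, jet, mul_right_comm _ _ (sqrtDet (s y).metric)]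
  have h2 : ∀ a c, HasFDerivAt (fun y => (symInv (s y).metric : Fin 4 → Fin 4 → ℝ) a c *
          sqrtDet (s y).metric) _ x := fun a c =>
    (((h.contDiffAt_inverse hx a c).mul (h.contDiffAt_density hx)).differentiableAt
      (by simp)).hasFDerivAt
  have h3 := (HasFDerivAt.fun_sum (u := Finset.univ) fun a _ => HasFDerivAt.fun_sum
    (u := Finset.univ) fun c _ =>
    (h2 a c).mul_const (δ.conn a r c)).fun_sub (HasFDerivAt.fun_sum (u := Finset.univ) fun c _ =>
    (h2 r c).mul_const (∑ b, δ.conn b b c))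
  rw [h1.fderiv_eq, h3.fderiv]
  simp only [sub_apply, sum_apply, smul_apply, smul_eq_mul, mul_comm]

/-- The connection field equation in coordinates: the connection is metric. -/
theorem fderiv_inverse_eq (h : IsRegular Λ s D) (hx : x ∈ D)
    (hEL : ∀ δ : Fibre 𝔊, IsConnVariation δ → eulerLagrange (totalDensity Λ) s x δ = 0)
    (r p q : Fin 4) :
    fderiv ℝ (fun y => (symInv (s y).metric : Fin 4 → Fin 4 → ℝ) p q) x (stdVec r) =
      ∑ c, (s x).conn r p c * (symInv (s x).metric : Fin 4 → Fin 4 → ℝ) c q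
        + ∑ c, (symInv (s x).metric : Fin 4 → Fin 4 → ℝ) p c * (s x).conn r q c := by
  have hdet := h.det_ne_zero x hx
  -- The Euler–Lagrange equation is Palatini's hypothesis for the density `g^{ac} √|g|`.
  have hpal := palatini_algebra
    (k := fun a c => (symInv (s x).metric : Fin 4 → Fin 4 → ℝ) a c * sqrtDet (s x).metric)
    (dk := fun r a c => fderiv ℝ (fun y => (symInv (s y).metric : Fin 4 → Fin 4 → ℝ) a c *
          sqrtDet (s y).metric) x (stdVec r)) (Γ := (s x).conn)
    (fun a b => by rw [(symInv (s x).metric).2 a b])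
    (fun r a b => by simp only [fun y => (symInv (s y).metric).2 a b])
    (h.conn_symm x hx) (fun δ hδ => by
      have hv : IsConnVariation ((0, 0, 0, δ) : Fibre 𝔊) := ⟨rfl, rfl, rfl, hδ⟩
      have h1 := hEL _ hv
      have h2 := fderiv_totalDensity_of_isConnVariation (j := jet s x) hdet
        (h.contDiffAt_matter x hx) hv
      simp only [eulerLagrange, h.fderiv_momentum hx hv] at h1
      rw [← h1]
      refine congrArg₂ (· - ·) ?_ rfl
      refine Eq.trans ?_ h2.symm
      simp only [Finset.sum_mul, jet, mul_right_comm _ (sqrtDet (s x).metric)])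
  -- Split the derivative of `g^{pq} √|g|` by the product rule; `σ` is the logarithmic derivative of
  -- `√|g|`.
  have hinv := inverse_of_density (r := sqrtDet (s x).metric) (N := Matrix.of ((s x).conn r))
    (sqrtDet_ne_zero hdet) (symInv_mul hdet)
    (w := toMatrix (fderiv ℝ (fun y => (s y).metric) x (stdVec r))) rfl rfl (by
      ext p q
      have h3 := hpal r p q
      have h4 := ((((h.contDiffAt_inverse hx p q).differentiableAt (by simp)).hasFDerivAt).mul
        (((h.contDiffAt_density hx).differentiableAt (by simp)).hasFDerivAt)).fderiv
      have h5 := congrArg (fun T => T (stdVec r)) h4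
      simp only [add_apply, smul_apply, smul_eq_mul, h.fderiv_density hx,
        h.fderiv_inverse hx] at h5
      have h6 := h5.symm.trans h3
      rw [Finset.sum_congr rfl fun c _ => (mul_assoc ((s x).conn r p c) _ _).symm,
        Finset.sum_congr rfl fun c _ => mul_right_comm
          ((symInv (s x).metric : Fin 4 → Fin 4 → ℝ) p c) _ ((s x).conn r q c),
        ← Finset.sum_mul, ← Finset.sum_mul] at h6
      generalize toMatrix (fderiv ℝ (fun y => (s y).metric) x (stdVec r)) = w at *
      refine Eq.trans ?_ (h6.trans ?_)
      · simp only [Matrix.add_apply, Matrix.smul_apply, smul_eq_mul]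
        change _ = toMatrix (symInv (s x).metric) p q * _ + _
        ring
      · simp only [Matrix.sub_apply, Matrix.smul_apply, smul_eq_mul, Matrix.add_apply,
          Matrix.mul_apply, Matrix.transpose_apply, Matrix.of_apply, Matrix.trace, Matrix.diag_apply]
        ring)
  rw [h.fderiv_inverse hx, hinv]
  simp only [Matrix.add_apply, Matrix.mul_apply, Matrix.transpose_apply, Matrix.of_apply]

end IsRegular
end Section

/-! ### Curvature of the metric connection and the gravitational energy-tensor. -/

section Curvature

variable {V : Type*} [NormedAddCommGroup V] [NormedSpace ℝ V] [FiniteDimensional ℝ V]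
  {𝔊 : GaugeGroup V} {Λ : Base × SymForm × V × (Fin 4 → V) → ℝ} {s : Base → Fibre 𝔊}
  {D : Set Base} {x : Base}

theorem riemann_swap (j : Jet (Fibre 𝔊)) (a b c d : Fin 4) :
    riemann j a b c d = -riemann j b a c d := by
  simp only [riemann, Finset.sum_sub_distrib]
  ring

/-- First Bianchi identity: by the symmetry of `Γ` and of its derivatives, the terms of the cyclic
sum cancel in pairs. -/
theorem riemann_bianchi {j : Jet (Fibre 𝔊)} (h : ∀ a b c, j.2.1.conn a b c = j.2.1.conn c b a)
    (h' : ∀ r a b c, (dcoord j r).conn a b c = (dcoord j r).conn c b a) (a b c d : Fin 4) :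
    riemann j a b c d + riemann j b d c a + riemann j d a c b = 0 := by
  simp only [riemann, Finset.sum_sub_distrib]
  rw [h' a b c d, h' b d c a, h' d a c b]
  simp only [h b _ d, h d _ a, h a _ b]
  ring

namespace IsRegular

theorem dcoord_conn_symm (h : IsRegular Λ s D) (hx : x ∈ D) (r a b c : Fin 4) :
    (dcoord (jet s x) r).conn a b c = (dcoord (jet s x) r).conn c b a := by
  rw [← h.fderiv_conn hx, ← h.fderiv_conn hx]
  have : (fun y => (s y).conn a b c) =ᶠ[𝓝 x] fun y => (s y).conn c b a := by
    filter_upwards [h.eventually_mem hx] with y hy using h.conn_symm y hy a b c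
  rw [this.fderiv_eq]

/-- The metricity equation holds on the whole open set `D`, so it can be differentiated again, first
derivatives of `g⁻¹` being eliminated by the same equation. -/
theorem fderiv_fderiv_inverse (h : IsRegular Λ s D) (hx : x ∈ D)
    (hH : ∀ y ∈ D, ∀ r p q : Fin 4,
      fderiv ℝ (fun y => (symInv (s y).metric : Fin 4 → Fin 4 → ℝ) p q) y (stdVec r) =
      ∑ c, (s y).conn r p c * (symInv (s y).metric : Fin 4 → Fin 4 → ℝ) c q
        + ∑ c, (symInv (s y).metric : Fin 4 → Fin 4 → ℝ) p c * (s y).conn r q c)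
    (r t p q : Fin 4) :
    fderiv ℝ (fun y => fderiv ℝ (fun y => (symInv (s y).metric : Fin 4 → Fin 4 → ℝ) p q) y
      (stdVec r)) x (stdVec t) =
    (let H := toMatrix (symInv (s x).metric)
    let N := fun r => Matrix.of ((s x).conn r)
    let N' := Matrix.of ((dcoord (jet s x) t).conn r)
    N' * H + N r * (N t * H + H * (N t).transpose)
        + ((N t * H + H * (N t).transpose) * (N r).transpose + H * N'.transpose)) p q := by
  have h1 : (fun y => fderiv ℝ (fun y => (symInv (s y).metric : Fin 4 → Fin 4 → ℝ) p q) y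
      (stdVec r)) =ᶠ[𝓝 x] fun y =>
      ∑ c, (s y).conn r p c * (symInv (s y).metric : Fin 4 → Fin 4 → ℝ) c q
        + ∑ c, (symInv (s y).metric : Fin 4 → Fin 4 → ℝ) p c * (s y).conn r q c := by
    filter_upwards [h.eventually_mem hx] with y hy using hH y hy r p q
  have h2 : ∀ a c, HasFDerivAt (fun y => (symInv (s y).metric : Fin 4 → Fin 4 → ℝ) a c) _ x :=
    fun a c => ((h.contDiffAt_inverse hx a c).differentiableAt (by simp)).hasFDerivAt
  have h3 : ∀ a b c, HasFDerivAt (fun y => (s y).conn a b c) _ x :=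
    fun a b c => ((h.contDiffAt_connComp hx a b c).differentiableAt (by simp)).hasFDerivAt
  have h4 := (HasFDerivAt.fun_sum (u := Finset.univ) fun c _ => (h3 r p c).fun_mul (h2 c q)).fun_add
    (HasFDerivAt.fun_sum (u := Finset.univ) fun c _ => (h2 p c).fun_mul (h3 r q c))
  rw [h1.fderiv_eq, h4.fderiv]
  simp only [add_apply, sum_apply, smul_apply, smul_eq_mul, hH x hx, h.fderiv_conn hx,
    Matrix.add_apply, Matrix.mul_apply, Matrix.transpose_apply, Matrix.of_apply,
    Finset.sum_add_distrib, mul_comm ((symInv (s x).metric : Fin 4 → Fin 4 → ℝ) _ q)]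
  rw [add_comm (∑ c, (s x).conn r p c * _)]
  refine congrArg₂ (· + ·) rfl ?_
  rw [add_comm]
  simp only [mul_comm]

/-- The curvature of the connection is antisymmetric. -/
theorem riemann_antisymm (h : IsRegular Λ s D) (hx : x ∈ D)
    (hH : ∀ y ∈ D, ∀ r p q : Fin 4,
      fderiv ℝ (fun y => (symInv (s y).metric : Fin 4 → Fin 4 → ℝ) p q) y (stdVec r) =
      ∑ c, (s y).conn r p c * (symInv (s y).metric : Fin 4 → Fin 4 → ℝ) c q
        + ∑ c, (symInv (s y).metric : Fin 4 → Fin 4 → ℝ) p c * (s y).conn r q c)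
    (a b : Fin 4) :
    Matrix.of (riemann (jet s x) a b) * toMatrix (symInv (s x).metric)
      + toMatrix (symInv (s x).metric) * (Matrix.of (riemann (jet s x) a b)).transpose = 0 := by
  have h1 := curvature_antisymm (H := toMatrix (symInv (s x).metric))
    (Nr := Matrix.of ((s x).conn a)) (Nq := Matrix.of ((s x).conn b))
    (dqNr := Matrix.of ((dcoord (jet s x) b).conn a))
    (drNq := Matrix.of ((dcoord (jet s x) a).conn b)) (by
      ext p q
      refine (h.fderiv_fderiv_inverse hx hH a b p q).symm.trans
        (Eq.trans ?_ (h.fderiv_fderiv_inverse hx hH b a p q))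
      -- The two sides are the mixed second derivatives of `g^{pq}`, which agree by smoothness.
      have hc := h.contDiffAt_inverse hx p q
      have hs := (hc.isSymmSndFDerivAt (by simpa using WithTop.coe_le_coe.2 (le_top : (2 : ℕ∞) ≤ ⊤))).eq (stdVec b) (stdVec a)
      have hd := (((hc.fderiv_right (m := 1) (by norm_cast)).differentiableAt
        (by simp)).hasFDerivAt)
      have hd' : ∀ v, HasFDerivAt (fun y => fderiv ℝ
        (fun y => (symInv (s y).metric : Fin 4 → Fin 4 → ℝ) p q) y v) _ x := fun v =>
        hd.clm_apply (hasFDerivAt_const v x)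
      rw [(hd' _).fderiv, (hd' _).fderiv]
      simpa using hs)
  have h2 : Matrix.of (riemann (jet s x) a b) = Matrix.of ((dcoord (jet s x) b).conn a)
      - Matrix.of ((dcoord (jet s x) a).conn b) + (Matrix.of ((s x).conn a)
      * Matrix.of ((s x).conn b) - Matrix.of ((s x).conn b) * Matrix.of ((s x).conn a)) := by
    ext c d
    simp only [riemann, Matrix.add_apply, Matrix.sub_apply, Matrix.mul_apply, Matrix.of_apply,
      Finset.sum_sub_distrib, jet]
  rw [h2]
  exact h1

/-- At `y = Γ` the last term of the overconnection vanishes, and the remaining terms combine with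
`∂_b Γ` into the curvature; so `∇_b Γ` is the curvature of `Γ`. -/
theorem conn_covDeriv (s : Base → Fibre 𝔊) (x : Base) (p b q r : Fin 4) :
    (fderiv ℝ s x (stdVec b) - prolongConn s x (s x) b).conn p q r =
      riemann (jet s x) p b q r := by
  change (fderiv ℝ s x (stdVec b)).conn p q r - ((fderiv ℝ s x (stdVec p)).conn b q r
    + ∑ e, (-(s x).conn b e r * (s x).conn p q e + (s x).conn p e r * (s x).conn b q e
        + (s x).conn b e p * ((s x).conn e q r - (s x).conn e q r))) = _
  simp only [riemann, dcoord, jet, sub_self, mul_zero, add_zero, Finset.sum_add_distrib,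
    Finset.sum_sub_distrib, neg_mul, Finset.sum_neg_distrib, mul_comm ((s x).conn b _ r),
    mul_comm ((s x).conn p _ r)]
  ring

/-- The canonical energy-tensor of the gravitational Lagrangian. -/
theorem energyTensor_lagGrav (h : IsRegular Λ s D) (hx : x ∈ D)
    (hH : ∀ y ∈ D, ∀ r p q : Fin 4,
      fderiv ℝ (fun y => (symInv (s y).metric : Fin 4 → Fin 4 → ℝ) p q) y (stdVec r) =
      ∑ c, (s y).conn r p c * (symInv (s y).metric : Fin 4 → Fin 4 → ℝ) c q
        + ∑ c, (symInv (s y).metric : Fin 4 → Fin 4 → ℝ) p c * (s y).conn r q c)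
    (e b : Fin 4) :
    energyTensor lagGrav (prolongConn s) s x e b =
      -2 * (einsteinMixed (jet s x) e b * sqrtDet (s x).metric) := by
  have hanti := h.riemann_antisymm hx hH
  have hdet := h.det_ne_zero x hx
  have hric : ∀ a c, ricci (jet s x) a c = ricci (jet s x) c a :=
    ricci_symm_of_antisymm (symInv_mul hdet) (riemann_swap _)
      (riemann_bianchi (h.conn_symm x hx) (h.dcoord_conn_symm hx)) hanti
  have hcon := contraction_of_antisymm (symInv (s x).metric).2 (riemann_swap (jet s x)) hanti e b
  have h1 : ∀ c, ∑ d, riemann (jet s x) d b d c = -ricci (jet s x) c b := fun c => by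
    rw [hric c b, ricci, ← Finset.sum_neg_distrib]
    exact Finset.sum_congr rfl fun d _ => riemann_swap _ _ _ _ _
  have h2 : ∀ c, ∑ d, riemann (jet s x) b d d c = ricci (jet s x) c b := fun c => (hric c b).symm
  have h3 : ∑ c, (symInv (s x).metric : Fin 4 → Fin 4 → ℝ) e c *
      ((s x).metric : Fin 4 → Fin 4 → ℝ) c b = if e = b then 1 else 0 := by
    have := congrFun (congrFun (symInv_mul hdet) e) b
    rw [Matrix.mul_apply, Matrix.one_apply] at this
    exact this
  -- Both contractions of the curvature in this momentum reduce to `R^e_b`, the second one entering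
  -- with two minus signs. Hence `U = R δ √|g| - 2 R^e_b √|g|`.
  have h4 := momentum_lagGrav (j := jet s x) hdet e
    (fderiv ℝ s x (stdVec b) - prolongConn s x (s x) b)
  simp only [conn_covDeriv, h1, mul_neg, Finset.sum_neg_distrib] at h4
  rw [energyTensor, h4]
  simp only [jet] at hcon h2 ⊢
  simp only [hcon, h2, einsteinMixed, einstein, mul_sub, Finset.sum_sub_distrib,
    mul_left_comm _ (1 / 2 * scalarCurv _), ← Finset.mul_sum, h3, lagGrav]
  split_ifs <;> ring

end IsRegular
end Curvature

/-! ### The stress-energy tensor through variations of the metric by shears. -/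

section Stress

/-- The Lie derivative `A^d_p g_{dq} + A^d_q g_{pd}` of the metric, for the elementary endomorphism
`A` with `A^a_c = 1`. -/
def shear (g : SymForm) (a c : Fin 4) : SymForm :=
  ⟨fun p q => (if p = c then (g : Fin 4 → Fin 4 → ℝ) a q else 0)
      + (if q = c then (g : Fin 4 → Fin 4 → ℝ) a p else 0), fun _ _ => add_comm _ _⟩

theorem toMatrix_shear (g : SymForm) (a c : Fin 4) :
    toMatrix (shear g a c) = Matrix.single c a 1 * toMatrix g + toMatrix g * Matrix.single a c 1 := by
  ext p q
  have h := g.2 p a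
  simp only [Matrix.add_apply, Matrix.mul_apply, Matrix.single_apply, Matrix.of_apply, shear,
    ite_mul, one_mul, zero_mul, mul_ite, mul_one, mul_zero, ite_and, Finset.sum_ite_irrel,
    Finset.sum_ite_eq, Finset.mem_univ, if_true, Finset.sum_const_zero, h, eq_comm (a := c)]

theorem symInv_shear {g : SymForm} (hg : (toMatrix g).det ≠ 0) (a c p r : Fin 4) :
    (toMatrix (symInv g) * toMatrix (shear g a c) * toMatrix (symInv g)) p r =
      (if r = a then (symInv g : Fin 4 → Fin 4 → ℝ) p c else 0)
        + (if p = a then (symInv g : Fin 4 → Fin 4 → ℝ) c r else 0) := by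
  have h : toMatrix (symInv g) * toMatrix (shear g a c) * toMatrix (symInv g) =
      toMatrix (symInv g) * Matrix.single c a 1 + Matrix.single a c 1 * toMatrix (symInv g) := by
    rw [toMatrix_shear, mul_add, add_mul, Matrix.mul_assoc, Matrix.mul_assoc, mul_symInv hg,
      Matrix.mul_one, ← Matrix.mul_assoc (toMatrix (symInv g)) (toMatrix g), symInv_mul hg,
      Matrix.one_mul]
  rw [h]
  simp only [Matrix.add_apply, Matrix.mul_apply, Matrix.single_apply, Matrix.of_apply,
    ite_mul, one_mul, zero_mul, mul_ite, mul_one, mul_zero, ite_and, Finset.sum_ite_irrel,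
    Finset.sum_ite_eq, Finset.mem_univ, if_true, Finset.sum_const_zero, eq_comm (a := a)]

theorem trace_symInv_shear {g : SymForm} (hg : (toMatrix g).det ≠ 0) (a c : Fin 4) :
    (toMatrix (symInv g) * toMatrix (shear g a c)).trace = if a = c then 2 else 0 := by
  rw [toMatrix_shear, mul_add, Matrix.trace_add, ← Matrix.mul_assoc, Matrix.trace_mul_comm,
    ← Matrix.mul_assoc, mul_symInv hg, ← Matrix.mul_assoc, symInv_mul hg, Matrix.one_mul,
    Matrix.one_mul]
  split_ifs with h
  · subst h
    rw [Matrix.trace_single_eq_same]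
    norm_num
  · rw [Matrix.trace_single_eq_of_ne _ _ _ h, Matrix.trace_single_eq_of_ne _ _ _ (Ne.symm h),
      add_zero]

theorem eq_sum_symUnit (u : SymForm) :
    u = ∑ p, ∑ q, (u : Fin 4 → Fin 4 → ℝ) p q • symUnit p q := by
  apply Subtype.ext
  funext c d
  have h : ((∑ p, ∑ q, (u : Fin 4 → Fin 4 → ℝ) p q • symUnit p q : SymForm) :
      Fin 4 → Fin 4 → ℝ) c d = ∑ p, ∑ q, (u : Fin 4 → Fin 4 → ℝ) p q *
        (((if c = p ∧ d = q then 1 else 0) + (if c = q ∧ d = p then 1 else 0)) / 2) := by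
    simp only [AddSubmonoidClass.coe_finsetSum, Finset.sum_apply]
    rfl
  rw [h]
  have h1 : ∑ p, ∑ q, (u : Fin 4 → Fin 4 → ℝ) p q * (if c = p ∧ d = q then (1 : ℝ) else 0) =
      (u : Fin 4 → Fin 4 → ℝ) c d := by
    simp [ite_and]
  have h2 : ∑ p, ∑ q, (u : Fin 4 → Fin 4 → ℝ) p q * (if c = q ∧ d = p then (1 : ℝ) else 0) =
      (u : Fin 4 → Fin 4 → ℝ) d c := by
    simp [ite_and]
  simp only [mul_div_assoc', mul_add, ← Finset.sum_div, Finset.sum_add_distrib, h1, h2, u.2 d c]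
  ring

theorem symUnit_comm (a b : Fin 4) : symUnit a b = symUnit b a := by
  apply Subtype.ext
  funext c d
  simp only [symUnit, add_comm]

variable {V : Type*} [NormedAddCommGroup V] [NormedSpace ℝ V] [FiniteDimensional ℝ V]
  {𝔊 : GaugeGroup V} {j : Jet (Fibre 𝔊)}

theorem stressTensor_comm (ℓ : Jet (Fibre 𝔊) → ℝ) (j : Jet (Fibre 𝔊)) (a b : Fin 4) :
    stressTensor ℓ j a b = stressTensor ℓ j b a := by
  rw [stressTensor, symUnit_comm]
  rfl

/-- The jet with the metric replaced. -/
abbrev withMetric (j : Jet (Fibre 𝔊)) (g : SymForm) : Jet (Fibre 𝔊) :=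
  (j.1, (j.2.1.matter, j.2.1.gauge, g, j.2.1.conn), j.2.2)

theorem differentiableAt_withMetric {ℓ : Jet (Fibre 𝔊) → ℝ} (h : ContDiffAt ℝ ∞ ℓ j) :
    DifferentiableAt ℝ (fun g => ℓ (withMetric j g)) j.2.1.metric := by
  have h1 : DifferentiableAt ℝ ℓ (withMetric j j.2.1.metric) := h.differentiableAt (by simp)
  exact DifferentiableAt.comp (g := ℓ) j.2.1.metric h1 (by fun_prop)

/-- Chain rule through `g ↦ g⁻¹`: the induced variation of the inverse metric is minus a symmetrized
array with `g^{pc}` in column `a`, and its two halves pair equally with the symmetric `T`. -/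
theorem stressTensor_contraction {ℓ : Jet (Fibre 𝔊) → ℝ} (h : ContDiffAt ℝ ∞ ℓ j)
    (hj : (toMatrix j.2.1.metric).det ≠ 0) (a c : Fin 4) :
    fderiv ℝ (fun g => ℓ (withMetric j g)) j.2.1.metric (shear j.2.1.metric a c) =
      -2 * ∑ p, (symInv j.2.1.metric : Fin 4 → Fin 4 → ℝ) c p * stressTensor ℓ j p a := by
  set g := j.2.1.metric with hg
  have hd : DifferentiableAt ℝ symInv g := (contDiffAt_symInv hj).differentiableAt (by simp)
  have hd' : DifferentiableAt ℝ symInv (symInv g) :=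
    (contDiffAt_symInv (det_symInv_ne_zero hj)).differentiableAt (by simp)
  have h1 : DifferentiableAt ℝ (fun g => ℓ (withMetric j g)) (symInv (symInv g)) := by
    rw [symInv_symInv hj]
    exact differentiableAt_withMetric h
  have h2 : DifferentiableAt ℝ (fun k => ℓ (withMetric j (symInv k))) (symInv g) :=
    DifferentiableAt.comp (g := fun g => ℓ (withMetric j g)) (symInv g) h1 hd'
  have h3 := HasFDerivAt.comp (g := fun k => ℓ (withMetric j (symInv k))) g h2.hasFDerivAt
    hd.hasFDerivAt
  -- Inversion is an involution only on nondegenerate arrays, hence only near `g`.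
  have h4 : (fun g => ℓ (withMetric j g)) =ᶠ[𝓝 g]
      ((fun k => ℓ (withMetric j (symInv k))) ∘ symInv) := by
    filter_upwards [eventually_det_ne_zero hj] with g' hg'
    simp only [Function.comp_apply, symInv_symInv hg']
  rw [h4.fderiv_eq, h3.fderiv, ContinuousLinearMap.comp_apply,
    eq_sum_symUnit (fderiv ℝ symInv g (shear g a c))]
  have h5 : ∀ p q, (fderiv ℝ symInv g (shear g a c) : Fin 4 → Fin 4 → ℝ) p q =
      -((if q = a then (symInv g : Fin 4 → Fin 4 → ℝ) p c else 0)
        + (if p = a then (symInv g : Fin 4 → Fin 4 → ℝ) c q else 0)) := fun p q => by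
    rw [← symInv_shear hj]
    exact congrFun (congrFun (hasFDerivAt_symInv_apply hj (shear g a c)) p) q
  have h6 : ∀ p q, fderiv ℝ (fun k => ℓ (withMetric j (symInv k))) (symInv g) (symUnit p q) =
      stressTensor ℓ j p q := fun _ _ => rfl
  simp only [map_sum, map_smul, smul_eq_mul, h5, h6, neg_mul, add_mul, ite_mul, zero_mul,
    Finset.sum_neg_distrib, Finset.sum_add_distrib, Finset.sum_ite_eq', Finset.mem_univ, if_true,
    Finset.sum_ite_irrel, Finset.sum_const_zero, stressTensor_comm ℓ j a, (symInv g).2 _ c]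
  ring

/-- Lowering an index in the Einstein equations. -/
theorem einstein_of_mixed {ℓ : Jet (Fibre 𝔊) → ℝ} {ℓ' : Jet (Fibre 𝔊) → ℝ}
    (hj : (toMatrix j.2.1.metric).det ≠ 0) {r : ℝ} {a : Fin 4}
    (h : ∀ c, einsteinMixed j c a * r =
      -∑ p, (symInv j.2.1.metric : Fin 4 → Fin 4 → ℝ) c p *
        (stressTensor ℓ j p a + stressTensor ℓ' j p a)) (b : Fin 4) :
    einstein j b a * r = -(stressTensor ℓ j b a + stressTensor ℓ' j b a) := by
  let v : Fin 4 → ℝ := fun b => einstein j b a * r + (stressTensor ℓ j b a + stressTensor ℓ' j b a)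
  have h1 : (toMatrix (symInv j.2.1.metric)).mulVec v = 0 := by
    funext c
    have h2 := h c
    rw [einsteinMixed, Finset.sum_mul, eq_neg_iff_add_eq_zero, ← Finset.sum_add_distrib] at h2
    change ∑ p, (symInv j.2.1.metric : Fin 4 → Fin 4 → ℝ) c p * v p = 0
    refine Eq.trans (Finset.sum_congr rfl fun p _ => ?_) h2
    simp only [v]
    ring
  have h3 : v = 0 := by
    rw [← Matrix.one_mulVec v, ← mul_symInv hj, ← Matrix.mulVec_mulVec, h1, Matrix.mulVec_zero]
  exact eq_neg_of_add_eq_zero_left (congrFun h3 b)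

end Stress

/-! ### Canonical and metric energy-tensors of natural matter. -/

section Canonical

variable {V : Type*} [NormedAddCommGroup V] [NormedSpace ℝ V] [FiniteDimensional ℝ V]
  {𝔊 : GaugeGroup V} {Λ : Base × SymForm × V × (Fin 4 → V) → ℝ}

/-- Invariance of a matter Lagrangian under the linear automorphisms of the tangent space, in
coordinates. -/
def IsInvariant (Λ : Base × SymForm × V × (Fin 4 → V) → ℝ) (x : Base) : Prop :=
  ∀ B : Matrix (Fin 4) (Fin 4) ℝ, B.det ≠ 0 → ∀ g g' : SymForm, (toMatrix g).det ≠ 0 →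
    toMatrix g' = B.transpose * toMatrix g * B → ∀ (φ : V) (w : Fin 4 → V),
      Λ (x, g', φ, fun b => ∑ d, B d b • w d) = Λ (x, g, φ, w)

/-- Differentiate the invariance along `B = 1 + t E_{ac}`. The metric becomes `g + t · shear + t² Q`
and the covector `w` acquires `t w_a` in slot `c`; `Λ` is constant along this curve for small `t`,
and `Q` does not affect its velocity at `0`. -/
theorem IsInvariant.fderiv_eq_zero {x : Base} (hΛ : IsInvariant Λ x) {g : SymForm} {φ : V}
    {w : Fin 4 → V} (hd : DifferentiableAt ℝ Λ (x, g, φ, w)) (hg : (toMatrix g).det ≠ 0)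
    (a c : Fin 4) :
    fderiv ℝ Λ (x, g, φ, w) (0, shear g a c, 0, Pi.single c (w a)) = 0 := by
  let Q : SymForm := ⟨fun p q => if p = c ∧ q = c then (g : Fin 4 → Fin 4 → ℝ) a a else 0,
    fun p q => by simp only [and_comm]⟩
  let B : ℝ → Matrix (Fin 4) (Fin 4) ℝ := fun t => 1 + t • Matrix.single a c 1
  let v : Base × SymForm × V × (Fin 4 → V) := (0, shear g a c, 0, Pi.single c (w a))
  let q : Base × SymForm × V × (Fin 4 → V) := (0, Q, 0, 0)
  have hB : ∀ᶠ t in 𝓝 (0 : ℝ), (B t).det ≠ 0 := by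
    have hc : Continuous fun t => (B t).det := by
      refine Continuous.matrix_det ?_
      exact continuous_const.add (continuous_id.smul continuous_const)
    refine hc.continuousAt.eventually_ne ?_
    simp [B]
  have h1 : ∀ᶠ t in 𝓝 (0 : ℝ), Λ ((x, g, φ, w) + t • v + t ^ 2 • q) = Λ (x, g, φ, w) := by
    filter_upwards [hB] with t ht
    have hg' : toMatrix (g + t • shear g a c + t ^ 2 • Q) =
        (B t).transpose * toMatrix g * B t := by
      have e1 : (B t).transpose * toMatrix g * B t = toMatrix g
          + t • (Matrix.single c a 1 * toMatrix g + toMatrix g * Matrix.single a c 1)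
          + t ^ 2 • (Matrix.single c a 1 * toMatrix g * Matrix.single a c 1) := by
        simp only [B, Matrix.transpose_add, Matrix.transpose_one, Matrix.transpose_smul,
          Matrix.transpose_single, add_mul, mul_add, one_mul, mul_one, Matrix.smul_mul,
          Matrix.mul_smul, smul_add, smul_smul, sq]
        abel
      have e2 : Matrix.single c a 1 * toMatrix g * Matrix.single a c 1 = toMatrix Q := by
        ext p r
        simp only [Matrix.mul_apply, Matrix.single_apply, Matrix.of_apply, Q,
          ite_mul, one_mul, zero_mul, mul_ite, mul_one, mul_zero, ite_and, Finset.sum_ite_irrel,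
          Finset.sum_ite_eq, Finset.mem_univ, if_true, Finset.sum_const_zero, eq_comm (a := c)]
        split_ifs <;> rfl
      rw [e1, e2, ← toMatrix_shear]
      rfl
    have hw : (fun b => ∑ d, B t d b • w d) = w + t • Pi.single (M := fun _ => V) c (w a) := by
      funext b
      simp only [B, Matrix.add_apply, Matrix.one_apply, Matrix.smul_apply, Matrix.single_apply,
        smul_eq_mul, mul_ite, mul_one, mul_zero, add_smul, ite_smul, one_smul, zero_smul, ite_and,
        Finset.sum_add_distrib, Finset.sum_ite_eq', Finset.sum_ite_eq, Finset.mem_univ, if_true,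
        Pi.add_apply, Pi.smul_apply, Pi.single_apply, eq_comm (a := c)]
      split_ifs <;> simp
    rw [← hΛ (B t) ht g _ hg hg' φ w, hw]
    congr 1
    simp [v, q]
  have h2 : HasDerivAt (fun t : ℝ => (x, g, φ, w) + t • v + t ^ 2 • q) v 0 := by
    have := (((hasDerivAt_id (0 : ℝ)).smul_const v).const_add (x, g, φ, w)).fun_add
      (((hasDerivAt_id (0 : ℝ)).pow 2).smul_const q)
    simpa using! this
  have h3 : (x, g, φ, w) + (0 : ℝ) • v + (0 : ℝ) ^ 2 • q = (x, g, φ, w) := by simp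
  have h4 : HasDerivAt (fun t : ℝ => Λ ((x, g, φ, w) + t • v + t ^ 2 • q))
      (fderiv ℝ Λ (x, g, φ, w) v) 0 := by
    refine HasFDerivAt.comp_hasDerivAt (l := Λ) (0 : ℝ) ?_ h2
    rw [h3]
    exact hd.hasFDerivAt
  have h5 : HasDerivAt (fun t : ℝ => Λ ((x, g, φ, w) + t • v + t ^ 2 • q)) 0 0 :=
    (hasDerivAt_const 0 (Λ (x, g, φ, w))).congr_of_eventuallyEq h1
  exact h4.unique h5

variable {s : Base → Fibre 𝔊} {x : Base} {j : Jet (Fibre 𝔊)}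

theorem fderiv_matterDensity_metric (hj : (toMatrix j.2.1.metric).det ≠ 0)
    (hΛ : ContDiffAt ℝ ∞ Λ (j.1, j.2.1.metric, j.2.1.matter, covMatter j)) (w : SymForm) :
    fderiv ℝ (fun g => matterDensity Λ (withMetric j g)) j.2.1.metric w =
      fderiv ℝ Λ (j.1, j.2.1.metric, j.2.1.matter, covMatter j) (0, w, 0, 0) * sqrtDet j.2.1.metric
        + Λ (j.1, j.2.1.metric, j.2.1.matter, covMatter j) *
          (1 / 2 * (toMatrix (symInv j.2.1.metric) * toMatrix w).trace * sqrtDet j.2.1.metric) := by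
  have h0 : HasFDerivAt (fun g : SymForm =>
      ((j.1, g, j.2.1.matter, covMatter j) : Base × SymForm × V × (Fin 4 → V)))
      ((0 : SymForm →L[ℝ] Base).prod ((ContinuousLinearMap.id ℝ SymForm).prod
        ((0 : SymForm →L[ℝ] V).prod 0))) j.2.1.metric :=
    (hasFDerivAt_const _ _).prodMk ((hasFDerivAt_id _).prodMk
      ((hasFDerivAt_const _ _).prodMk (hasFDerivAt_const _ _)))
  have h1 := HasFDerivAt.comp (g := Λ) j.2.1.metric (hΛ.differentiableAt (by simp)).hasFDerivAt h0
  have h2 := h1.mul ((contDiffAt_sqrtDet hj).differentiableAt (by simp)).hasFDerivAt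
  have h3 : (fun g => matterDensity Λ (withMetric j g)) = fun g =>
      (Λ ∘ fun g : SymForm => (j.1, g, j.2.1.matter, covMatter j)) g * sqrtDet g := rfl
  rw [h3]
  refine (congrArg (fun T => T w) h2.fderiv).trans ?_
  simp only [add_apply, smul_apply, smul_eq_mul, fderiv_sqrtDet hj, Function.comp_apply]
  rw [add_comm, mul_comm (sqrtDet _)]
  rfl

/-- The canonical energy-tensor of a natural matter Lagrangian is minus twice its stress-energy
tensor. -/
theorem energyTensor_matterDensity (hj : (toMatrix (s x).metric).det ≠ 0)
    (hΛ : ContDiffAt ℝ ∞ Λ (x, (s x).metric, (s x).matter, covMatter (jet s x)))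
    (hinv : IsInvariant Λ x) (c a : Fin 4) :
    energyTensor (matterDensity Λ) (prolongConn s) s x c a =
      -2 * ∑ p, (symInv (s x).metric : Fin 4 → Fin 4 → ℝ) c p *
        stressTensor (matterDensity Λ) (jet s x) p a := by
  have h1 := stressTensor_contraction (j := jet s x) (contDiffAt_matterDensity (j := jet s x) hj hΛ)
    hj a c
  have h2 := fderiv_matterDensity_metric (j := jet s x) hj hΛ (shear (s x).metric a c)
  have h3 := momentum_matterDensity (j := jet s x) hj hΛ c
    (fderiv ℝ s x (stdVec a) - prolongConn s x (s x) a)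
  have h4 := hinv.fderiv_eq_zero (hΛ.differentiableAt (by simp)) hj a c
  have h5 : ((0, shear (s x).metric a c, 0, Pi.single c (covMatter (jet s x) a)) :
      Base × SymForm × V × (Fin 4 → V)) = (0, shear (s x).metric a c, 0, 0)
        + (0, 0, 0, Pi.single c (covMatter (jet s x) a)) := by simp
  have h6 : (fderiv ℝ s x (stdVec a) - prolongConn s x (s x) a).matter = covMatter (jet s x) a := rfl
  rw [h5, map_add] at h4
  rw [h6] at h3
  have h7 : matterDensity Λ (jet s x) = Λ (x, (s x).metric, (s x).matter, covMatter (jet s x)) *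
    sqrtDet (s x).metric := rfl
  refine Eq.trans ?_ h1
  refine Eq.trans ?_ h2.symm
  rw [energyTensor, h3, h7]
  simp only [jet] at h4 ⊢
  -- Invariance replaces the metric derivative of `Λ` by minus the derivative along `∇φ`, which is
  -- the momentum term of `U`; the trace gives `ℓ δ^c_a`.
  rw [trace_symInv_shear hj, eq_neg_of_add_eq_zero_left h4]
  simp only [eq_comm (a := c)]
  split_ifs <;> ring

end Canonical

/-! ### Canonical and metric energy-tensors of the gauge field. -/

section Gauge

theorem sum_comm_inner (F : Fin 4 → Fin 4 → Fin 4 → ℝ) :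
    ∑ p, ∑ q, ∑ r, F p r q = ∑ p, ∑ q, ∑ r, F p q r :=
  Finset.sum_congr rfl fun _ _ => Finset.sum_comm

theorem sum_rotate (F : Fin 4 → Fin 4 → Fin 4 → ℝ) :
    ∑ p, ∑ q, ∑ r, F r p q = ∑ p, ∑ q, ∑ r, F p q r := by
  rw [sum_comm_inner fun p q r => F q p r, Finset.sum_comm]

theorem sum_reverse (F : Fin 4 → Fin 4 → Fin 4 → ℝ) :
    ∑ p, ∑ q, ∑ r, F r q p = ∑ p, ∑ q, ∑ r, F p q r := by
  rw [sum_rotate fun p q r => F p r q, sum_comm_inner]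

/-- Here `S` is `⟨ρ_{ab}, ρ_{cd}⟩`. The left side comes from the momentum contracted with the
curvature, the right side from varying the metric. The symmetries of `S` reduce all eight sums to `±
X`, and both sides equal `4 X`. -/
theorem curvature_square_contraction {h : Fin 4 → Fin 4 → ℝ}
    {S : Fin 4 → Fin 4 → Fin 4 → Fin 4 → ℝ} (hh : ∀ a b, h a b = h b a)
    (hS : ∀ a b c d, S a b c d = S c d a b) (hS' : ∀ a b c d, S a b c d = -S b a c d)
    (a c : Fin 4) :
    ∑ p, ∑ q, ∑ r, ∑ s, h p r * h q s *
      (((if c = q then S p a r s else 0) - (if c = p then S q a r s else 0))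
        + ((if c = s then S r a p q else 0) - (if c = r then S s a p q else 0))) =
    ∑ p, ∑ q, ∑ r, ∑ s, (h p r * ((if s = a then h q c else 0) + (if q = a then h c s else 0))
      + h q s * ((if r = a then h p c else 0) + (if p = a then h c r else 0))) * S p q r s := by
  have hS'' : ∀ a b c d, S a b c d = -S a b d c := fun a b c d => by rw [hS, hS', hS]
  let X := ∑ p, ∑ r, ∑ s, h p r * h c s * S p a r s
  have m1 : ∑ p, ∑ q, ∑ r, ∑ s, (if c = q then h p r * h q s * S p a r s else 0) = X := by
    simp only [Finset.sum_ite_irrel, Finset.sum_const_zero, Finset.sum_ite_eq, Finset.mem_univ,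
      if_true, X]
  have m2 : ∑ p, ∑ q, ∑ r, ∑ s, (if c = p then h p r * h q s * S q a r s else 0) = -X := by
    simp only [Finset.sum_ite_irrel, Finset.sum_const_zero, Finset.sum_ite_eq, Finset.mem_univ,
      if_true, X, ← Finset.sum_neg_distrib]
    rw [← sum_comm_inner]
    refine Finset.sum_congr rfl fun q _ => Finset.sum_congr rfl fun r _ =>
      Finset.sum_congr rfl fun s _ => ?_
    rw [hS'' q a r s]
    ring
  have m3 : ∑ p, ∑ q, ∑ r, ∑ s, (if c = s then h p r * h q s * S r a p q else 0) = X := by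
    simp only [Finset.sum_ite_eq, Finset.mem_univ, if_true, X]
    rw [← sum_rotate fun p r s => h p r * h c s * S p a r s]
    refine Finset.sum_congr rfl fun q _ => Finset.sum_congr rfl fun r _ =>
      Finset.sum_congr rfl fun s _ => ?_
    rw [hh q s, hh c r]
  have m4 : ∑ p, ∑ q, ∑ r, ∑ s, (if c = r then h p r * h q s * S s a p q else 0) = -X := by
    simp only [Finset.sum_ite_irrel, Finset.sum_const_zero, Finset.sum_ite_eq, Finset.mem_univ,
      if_true, X, ← Finset.sum_neg_distrib]
    rw [← sum_reverse]
    refine Finset.sum_congr rfl fun q _ => Finset.sum_congr rfl fun r _ =>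
      Finset.sum_congr rfl fun s _ => ?_
    rw [hS'' q a r s, hh c s, hh q r]
    ring
  have d1 : ∑ p, ∑ q, ∑ r, ∑ s, (if r = a then h q s * h p c * S p q r s else 0) = X := by
    simp only [Finset.sum_ite_irrel, Finset.sum_const_zero, Finset.sum_ite_eq', Finset.mem_univ,
      if_true, X]
    rw [← sum_reverse fun p r s => h p r * h c s * S p a r s]
    refine Finset.sum_congr rfl fun q _ => Finset.sum_congr rfl fun r _ =>
      Finset.sum_congr rfl fun s _ => ?_
    rw [hS q r a s, hS', hS'', hh q c, hh r s]
    ring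
  have d2 : ∑ p, ∑ q, ∑ r, ∑ s, (if p = a then h q s * h c r * S p q r s else 0) = X := by
    simp only [Finset.sum_ite_irrel, Finset.sum_const_zero, Finset.sum_ite_eq', Finset.mem_univ,
      if_true, X]
    rw [← sum_comm_inner fun p r s => h p r * h c s * S p a r s]
    refine Finset.sum_congr rfl fun q _ => Finset.sum_congr rfl fun r _ =>
      Finset.sum_congr rfl fun s _ => ?_
    rw [hS', hS'']
    ring
  have d3 : ∑ p, ∑ q, ∑ r, ∑ s, (if s = a then h p r * h q c * S p q r s else 0) = X := by
    simp only [Finset.sum_ite_eq', Finset.mem_univ, if_true, X]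
    rw [← sum_rotate fun p r s => h p r * h c s * S p a r s]
    refine Finset.sum_congr rfl fun q _ => Finset.sum_congr rfl fun r _ =>
      Finset.sum_congr rfl fun s _ => ?_
    rw [hS q r s a, hh q s, hh c r]
  have d4 : ∑ p, ∑ q, ∑ r, ∑ s, (if q = a then h p r * h c s * S p q r s else 0) = X := by
    simp only [Finset.sum_ite_irrel, Finset.sum_const_zero, Finset.sum_ite_eq', Finset.mem_univ,
      if_true, X]
  simp only [mul_add, add_mul, mul_sub, mul_ite, ite_mul, mul_zero, zero_mul,
    Finset.sum_add_distrib, Finset.sum_sub_distrib, m1, m2, m3, m4, d1, d2, d3, d4]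
  ring

variable {V : Type*} [NormedAddCommGroup V] [NormedSpace ℝ V] [FiniteDimensional ℝ V]
  {𝔊 : GaugeGroup V} {s : Base → Fibre 𝔊} {x : Base} {j : Jet (Fibre 𝔊)}

theorem bracket_swap (A B : 𝔊.lie) : 𝔊.bracket A B = -𝔊.bracket B A :=
  Subtype.ext (neg_sub _ _).symm

theorem gaugeCurv_swap (j : Jet (Fibre 𝔊)) (a b : Fin 4) : gaugeCurv j a b = -gaugeCurv j b a := by
  rw [gaugeCurv, gaugeCurv, bracket_swap]
  abel

/-- At `y = κ` the term of the overconnection with `Γ` vanishes, so the covariant derivative of the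
gauge field is its curvature. -/
theorem gauge_covDeriv (s : Base → Fibre 𝔊) (x : Base) (b p : Fin 4) :
    (fderiv ℝ s x (stdVec b) - prolongConn s x (s x) b).gauge p = gaugeCurv (jet s x) p b := by
  change (fderiv ℝ s x (stdVec b)).gauge p - ((fderiv ℝ s x (stdVec p)).gauge b
    + 𝔊.bracket ((s x).gauge b) ((s x).gauge p)
    + ∑ c, (s x).conn b c p • ((s x).gauge c - (s x).gauge c)) = _
  simp only [sub_self, smul_zero, Finset.sum_const_zero, add_zero, gaugeCurv, dcoord, jet]
  rw [bracket_swap]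
  abel

theorem fderiv_lagGauge_metric (hj : (toMatrix j.2.1.metric).det ≠ 0) (a c : Fin 4) :
    fderiv ℝ (fun g => lagGauge (withMetric j g)) j.2.1.metric (shear j.2.1.metric a c) =
      (if a = c then lagGauge j else 0) + 1 / 4 * (∑ p, ∑ q, ∑ r, ∑ s,
        ((symInv j.2.1.metric : Fin 4 → Fin 4 → ℝ) p r *
          ((if s = a then (symInv j.2.1.metric : Fin 4 → Fin 4 → ℝ) q c else 0)
            + (if q = a then (symInv j.2.1.metric : Fin 4 → Fin 4 → ℝ) c s else 0))
        + (symInv j.2.1.metric : Fin 4 → Fin 4 → ℝ) q s *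
          ((if r = a then (symInv j.2.1.metric : Fin 4 → Fin 4 → ℝ) p c else 0)
            + (if p = a then (symInv j.2.1.metric : Fin 4 → Fin 4 → ℝ) c r else 0))) *
        𝔊.pairing (gaugeCurv j p q) (gaugeCurv j r s)) * sqrtDet j.2.1.metric := by
  set g := j.2.1.metric with hg
  have h1 : ∀ p r, HasFDerivAt (fun g => (symInv g : Fin 4 → Fin 4 → ℝ) p r) _ g := fun p r =>
    hasFDerivAt_pi'.1 (hasFDerivAt_pi'.1 (SymForm.subtypeL.hasFDerivAt.comp g
      ((contDiffAt_symInv hj).differentiableAt (by simp)).hasFDerivAt) p) r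
  have h2 := ((HasFDerivAt.fun_sum (u := Finset.univ) fun p _ =>
    HasFDerivAt.fun_sum (u := Finset.univ) fun q _ =>
    HasFDerivAt.fun_sum (u := Finset.univ) fun r _ =>
    HasFDerivAt.fun_sum (u := Finset.univ) fun s _ =>
      ((h1 p r).fun_mul (h1 q s)).mul_const
        (𝔊.pairing (gaugeCurv j p q) (gaugeCurv j r s))).const_mul (-(1 / 4))).fun_mul
      ((contDiffAt_sqrtDet hj).differentiableAt (by simp)).hasFDerivAt
  have h3 : ∀ p r, ((ContinuousLinearMap.proj (R := ℝ) (φ := fun _ : Fin 4 => ℝ) r).comp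
      ((ContinuousLinearMap.proj (R := ℝ) (φ := fun _ : Fin 4 => Fin 4 → ℝ) p).comp
        (SymForm.subtypeL.comp (fderiv ℝ symInv g)))) (shear g a c) =
      -((if r = a then (symInv g : Fin 4 → Fin 4 → ℝ) p c else 0)
        + (if p = a then (symInv g : Fin 4 → Fin 4 → ℝ) c r else 0)) := fun p r => by
    rw [← symInv_shear hj]
    exact congrFun (congrFun (hasFDerivAt_symInv_apply hj (shear g a c)) p) r
  refine (congrArg (fun T => T (shear g a c)) h2.fderiv).trans ?_
  have h4 : ∀ A B : ℝ, ∀ T : ℝ, T = (if a = c then 2 else 0) →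
      A * (1 / 2 * T * sqrtDet g) + B = (if a = c then A * sqrtDet g else 0) + B := by
    rintro A B T rfl
    split_ifs <;> ring
  simp only [add_apply, smul_apply, sum_apply, smul_eq_mul, h3, fderiv_sqrtDet hj]
  refine (h4 _ _ _ (trace_symInv_shear hj a c)).trans ?_
  refine congrArg₂ (· + ·) rfl ?_
  rw [mul_comm (sqrtDet g)]
  refine congrArg (· * sqrtDet g) ?_
  rw [neg_mul, ← mul_neg]
  refine congrArg (1 / 4 * ·) ?_
  simp only [← Finset.sum_neg_distrib]
  refine Finset.sum_congr rfl fun p _ => Finset.sum_congr rfl fun q _ =>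
    Finset.sum_congr rfl fun r _ => Finset.sum_congr rfl fun s _ => ?_
  ring

/-- The canonical energy-tensor of the gauge Lagrangian is minus twice its stress-energy tensor. -/
theorem energyTensor_lagGauge (hj : (toMatrix (s x).metric).det ≠ 0) (c a : Fin 4) :
    energyTensor lagGauge (prolongConn s) s x c a =
      -2 * ∑ p, (symInv (s x).metric : Fin 4 → Fin 4 → ℝ) c p *
        stressTensor lagGauge (jet s x) p a := by
  refine Eq.trans ?_ (stressTensor_contraction (j := jet s x) (contDiffAt_lagGauge hj) hj a c)
  have h1 := fderiv_lagGauge_metric (j := jet s x) hj a c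
  rw [← curvature_square_contraction
    (S := fun p q r t => 𝔊.pairing (gaugeCurv (jet s x) p q) (gaugeCurv (jet s x) r t))
    (symInv (jet s x).2.1.metric).2 (fun _ _ _ _ => 𝔊.pairing_symm _ _) (fun p q r t => by
      rw [gaugeCurv_swap _ p q, map_neg, LinearMap.neg_apply]) a c] at h1
  refine Eq.trans ?_ h1.symm
  have h3 := momentum_lagGauge (j := jet s x) hj c
    (fderiv ℝ s x (stdVec a) - prolongConn s x (s x) a)
  simp only [gauge_covDeriv] at h3
  rw [energyTensor, h3, if_congr (eq_comm (a := c) (b := a)) rfl rfl]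
  have h2 : ∀ (P Q : Prop) [Decidable P] [Decidable Q] (A B C : 𝔊.lie),
      𝔊.pairing ((if P then A else 0) - (if Q then B else 0)) C =
        (if P then 𝔊.pairing A C else 0) - (if Q then 𝔊.pairing B C else 0) := by
    intro P Q _ _ A B C
    split_ifs <;> simp
  simp only [h2]
  ring

end Gauge

/-! ### Horizontal lifts of vector fields vanishing at a point. -/

section Lift

variable {F : Type*} [NormedAddCommGroup F] [NormedSpace ℝ F]

/-- The lift is `Φ q (X q.1)` with `Φ` linear in the vector and continuous in `q`. As `X` vanishes
at `x`, only `X` is differentiated; no derivative of `K` is needed. -/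
theorem hasFDerivAt_horizontalLift {K : Base × F → Fin 4 → F} {x : Base} {y : F}
    (hK : ∀ a, ContinuousAt (fun q => K q a) (x, y)) {X : Base → Base} {a b : Fin 4}
    (hX : X =ᶠ[𝓝 x] fun y => (y a - x a) • stdVec b) :
    ((X x, ∑ a, X x a • K (x, y) a) : Base × F) = 0 ∧ ∃ Y' : Base × F →L[ℝ] Base × F,
      HasFDerivAt (fun q : Base × F => ((X q.1, ∑ a, X q.1 a • K q a) : Base × F)) Y' (x, y) ∧
        ∀ q, Y' q = q.1 a • (stdVec b, K (x, y) b) := by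
  let Φ : Base × F → Base →L[ℝ] Base × F := fun q => (ContinuousLinearMap.id ℝ Base).prod
    (∑ d, ContinuousLinearMap.smulRightL ℝ Base F (stdCovec d) (K q d))
  have hΦ : ContinuousAt Φ (x, y) := by
    have h1 : ContinuousAt (fun q : Base × F => ∑ d, ContinuousLinearMap.smulRightL ℝ Base F
        (stdCovec d) (K q d)) (x, y) :=
      tendsto_finsetSum _ fun d _ => (ContinuousLinearMap.smulRightL ℝ Base F
        (stdCovec d)).continuous.continuousAt.comp (hK d)
    exact (ContinuousLinearMap.prodₗᵢ ℝ).continuous.continuousAt.comp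
      (ContinuousAt.prodMk continuousAt_const h1)
  have hY : (fun q : Base × F => ((X q.1, ∑ a, X q.1 a • K q a) : Base × F)) =
      fun q => Φ q (X q.1) := by
    funext q
    simp only [Φ, ContinuousLinearMap.prod_apply, sum_apply,
      ContinuousLinearMap.smulRightL_apply_apply]
    rfl
  have hX0 : X x = 0 := by
    rw [hX.eq_of_nhds, sub_self, zero_smul]
  have hX' : HasFDerivAt X ((stdCovec a).smulRight (stdVec b)) x := by
    have h1 : HasFDerivAt (fun y : Base => y a - x a) (stdCovec a) x :=
      (stdCovec a).hasFDerivAt.sub_const _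
    exact (h1.smul_const (stdVec b)).congr_of_eventuallyEq hX
  have hX'' : HasFDerivAt (fun q : Base × F => X q.1)
      (((stdCovec a).smulRight (stdVec b)).comp (ContinuousLinearMap.fst ℝ Base F)) (x, y) :=
    HasFDerivAt.comp (g := X) (x, y) hX' hasFDerivAt_fst
  have h0 : ((X x, ∑ a, X x a • K (x, y) a) : Base × F) = 0 := by
    simp only [hX0, PiLp.zero_apply, zero_smul, Finset.sum_const_zero]
    rfl
  rw [hY]
  refine ⟨h0, _, hasFDerivAt_clm_apply_of_eq_zero hΦ hX'' hX0, fun q => ?_⟩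
  have h2 : Φ (x, y) (stdVec b) = (stdVec b, K (x, y) b) := by
    refine Prod.ext rfl ?_
    simp only [Φ, ContinuousLinearMap.prod_apply, sum_apply,
      ContinuousLinearMap.smulRightL_apply_apply, ContinuousLinearMap.smulRight_apply,
      stdCovec_stdVec, ite_smul, one_smul, zero_smul, Finset.sum_ite_eq', Finset.mem_univ, if_true]
  rw [← h2, ← map_smul]
  rfl

end Lift

/-! ### Continuity of the prolonged connection. -/

section Prolongation

variable {V : Type*} [NormedAddCommGroup V] [NormedSpace ℝ V] [FiniteDimensional ℝ V]
  {𝔊 : GaugeGroup V} {s : Base → Fibre 𝔊} {x : Base}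

theorem continuousAt_bracket {X : Type*} [TopologicalSpace X] {x : X} {A B : X → 𝔊.lie}
    (hA : ContinuousAt A x) (hB : ContinuousAt B x) :
    ContinuousAt (fun x => 𝔊.bracket (A x) (B x)) x := by
  have hA' : ContinuousAt (fun x => (A x : V →L[ℝ] V)) x := continuous_subtype_val.continuousAt.comp hA
  have hB' : ContinuousAt (fun x => (B x : V →L[ℝ] V)) x := continuous_subtype_val.continuousAt.comp hB
  rw [Topology.IsInducing.subtypeVal.continuousAt_iff]
  exact (hA'.clm_comp hB').sub (hB'.clm_comp hA')

theorem continuousAt_prolongConn (hs : ContDiffAt ℝ ∞ s x) (y : Fibre 𝔊) (a : Fin 4) :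
    ContinuousAt (fun q : Base × Fibre 𝔊 => prolongConn s q.1 q.2 a) (x, y) := by
  have h0 : ContinuousAt (fun q : Base × Fibre 𝔊 => s q.1) (x, y) :=
    ContinuousAt.comp (g := s) hs.continuousAt continuousAt_fst
  have h1 : ∀ v, ContinuousAt (fun q : Base × Fibre 𝔊 => fderiv ℝ s q.1 v) (x, y) := fun v =>
    (ContinuousAt.comp (g := fderiv ℝ s) (f := Prod.fst) (x := (x, y))
      (hs.continuousAt_fderiv (by simp)) continuousAt_fst).clm_apply continuousAt_const
  have h2 : ContinuousAt (fun q : Base × Fibre 𝔊 => q.2) (x, y) := continuousAt_snd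
  have hm : ∀ {f : Base × Fibre 𝔊 → Fibre 𝔊}, ContinuousAt f (x, y) → ∀ a b,
      ContinuousAt (fun q => ((f q).metric : Fin 4 → Fin 4 → ℝ) a b) (x, y) := fun hf a b =>
    continuousAt_pi.1 (continuousAt_pi.1
      (continuous_subtype_val.continuousAt.comp hf.snd.snd.fst) a) b
  have hc : ∀ {f : Base × Fibre 𝔊 → Fibre 𝔊}, ContinuousAt f (x, y) → ∀ a b d,
      ContinuousAt (fun q => (f q).conn a b d) (x, y) := fun hf a b d =>
    continuousAt_pi.1 (continuousAt_pi.1 (continuousAt_pi.1 hf.snd.snd.snd a) b) d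
  have hg : ∀ {f : Base × Fibre 𝔊 → Fibre 𝔊}, ContinuousAt f (x, y) → ∀ a,
      ContinuousAt (fun q => (f q).gauge a) (x, y) := fun hf a =>
    continuousAt_pi.1 hf.snd.fst a
  refine ContinuousAt.prodMk ?_ (ContinuousAt.prodMk ?_ (ContinuousAt.prodMk ?_ ?_))
  · exact (continuous_subtype_val.continuousAt.comp (hg h0 a)).clm_apply h2.fst
  · refine continuousAt_pi.2 fun b => ?_
    exact ((hg (h1 _) a).add (continuousAt_bracket (hg h0 a) (hg h2 b))).add
      (tendsto_finsetSum _ fun d _ => (hc h0 a d b).smul ((hg h0 d).sub (hg h2 d)))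
  · rw [Topology.IsInducing.subtypeVal.continuousAt_iff]
    refine continuousAt_pi.2 fun b => continuousAt_pi.2 fun d => ?_
    exact (tendsto_finsetSum _ fun e _ =>
      ((hc h0 a e b).mul (hm h2 e d)).add ((hc h0 a e d).mul (hm h2 e b))).neg
  · refine continuousAt_pi.2 fun b => continuousAt_pi.2 fun d => continuousAt_pi.2 fun r => ?_
    exact (hc (h1 _) a d r).add (tendsto_finsetSum _ fun e _ =>
      (((hc h0 a e r).neg.mul (hc h2 b d e)).add ((hc h2 b e r).mul (hc h0 a d e))).add
        ((hc h0 a e b).mul ((hc h0 e d r).sub (hc h2 e d r))))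

theorem hasFDerivAt_prolong (hs : ContDiffAt ℝ ∞ s x) {X : Base → Base} {a b : Fin 4}
    (hX : X =ᶠ[𝓝 x] fun y => (y a - x a) • stdVec b) (y : Fibre 𝔊) :
    prolong s X (x, y) = 0 ∧ ∃ Y' : Base × Fibre 𝔊 →L[ℝ] Base × Fibre 𝔊,
      HasFDerivAt (prolong s X) Y' (x, y) ∧
        ∀ q, Y' q = q.1 a • (stdVec b, prolongConn s x y b) :=
  hasFDerivAt_horizontalLift (K := fun q => prolongConn s q.1 q.2)
    (continuousAt_prolongConn hs y) hX

end Prolongation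

/-! ### Matter Lagrangians in coordinates and naturality. -/

section Natural

theorem isOpen_nondegenerate {V : Type*} [NormedAddCommGroup V] [NormedSpace ℝ V] :
    IsOpen {q : Base × SymForm × V × (Fin 4 → V) | (toMatrix q.2.1).det ≠ 0} := by
  have h1 : Continuous fun q : Base × SymForm × V × (Fin 4 → V) => (toMatrix q.2.1).det :=
    (contDiff_iff_contDiffAt.2 fun q => contDiffAt_det (n := 0) fun i j =>
      contDiffAt_coe_symForm (contDiff_fst.comp contDiff_snd).contDiffAt i j).continuous
  exact isOpen_ne.preimage h1

variable {V : Type*} [NormedAddCommGroup V] [NormedSpace ℝ V] [FiniteDimensional ℝ V]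
  {M : Type*} [TopologicalSpace M] [ChartedSpace Base M]
  {E : M → Type*} [TopologicalSpace (TotalSpace V E)]
  [∀ p, AddCommGroup (E p)] [∀ p, Module ℝ (E p)] [∀ p, TopologicalSpace (E p)]
  [∀ p, IsTopologicalAddGroup (E p)] [∀ p, ContinuousSMul ℝ (E p)]
  [FiberBundle V E] [VectorBundle ℝ V E]
  [IsManifold 𝓘(ℝ, Base) ∞ M] [ContMDiffVectorBundle ∞ V E 𝓘(ℝ, Base)]
  {c : OpenPartialHomeomorph M Base}
  {τ : Trivialization V (TotalSpace.proj : TotalSpace V E → M)} {x : Base} {p : M}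

/-- The scalar factor of a matter Lagrangian in coordinates. -/
noncomputable def coordMatter (L : MatterLagrangian (V := V) M E) (c : OpenPartialHomeomorph M Base)
    (τ : Trivialization V (TotalSpace.proj : TotalSpace V E → M))
    (q : Base × SymForm × V × (Fin 4 → V)) : ℝ :=
  L.toFun (c.symm q.1) (formOf c (c.symm q.1) q.2.1) (τ.symm (c.symm q.1) q.2.2.1)
    (covecOf c τ (c.symm q.1) q.2.2.2)

theorem contDiffAt_coordMatter (L : MatterLagrangian (V := V) M E)
    (hc : c ∈ IsManifold.maximalAtlas 𝓘(ℝ, Base) ∞ M) (hτ : τ ∈ trivializationAtlas V E)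
    (hx : x ∈ coordDomain c τ) {g : SymForm} (hg : (toMatrix g).det ≠ 0) (φ : V) (w : Fin 4 → V) :
    ContDiffAt ℝ ∞ (coordMatter L c τ) (x, g, φ, w) := by
  refine (L.smooth c hc τ hτ).contDiffAt (IsOpen.mem_nhds ?_ ⟨hx, hg⟩)
  exact (isOpen_coordDomain.preimage continuous_fst).inter isOpen_nondegenerate

theorem exists_tangent_equiv (hc : c ∈ IsManifold.maximalAtlas 𝓘(ℝ, Base) ∞ M)
    (hp : p ∈ c.source) {B : Matrix (Fin 4) (Fin 4) ℝ} (hB : B.det ≠ 0) :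
    ∃ T : TangentSpace 𝓘(ℝ, Base) p ≃L[ℝ] TangentSpace 𝓘(ℝ, Base) p,
      ∀ d u, coordCovec c p d (T u) = ∑ b, B d b * coordCovec c p b u := by
  let e := (mdifferentiable_of_mem_maximalAtlas hc).mfderiv hp
  let b := (EuclideanSpace.basisFun (Fin 4) ℝ).toBasis
  let T₀ : Base ≃L[ℝ] Base :=
    (Matrix.toLinearEquiv b B (isUnit_iff_ne_zero.2 hB)).toContinuousLinearEquiv
  have hT₀ : ∀ i, T₀ (stdVec i) = ∑ d, B d i • stdVec d := fun i => by
    have hb : ∀ i, b i = stdVec i := fun i => by simp [b, stdVec]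
    have h : T₀ (b i) = ∑ d, B d i • b d := Matrix.toLin_self b b B i
    simpa only [hb] using h
  have hT₁ : ∀ d v, stdCovec d (T₀ v) = ∑ i, B d i * stdCovec i v := fun d v => by
    conv_lhs => rw [base_eq_sum v]
    simp only [map_sum, map_smul, hT₀, stdCovec_stdVec, smul_eq_mul, mul_ite, mul_one, mul_zero,
      Finset.sum_ite_eq, Finset.mem_univ, if_true]
    exact Finset.sum_congr rfl fun i _ => mul_comm _ _
  refine ⟨(e.trans T₀).trans e.symm, fun d u => ?_⟩
  refine Eq.trans ?_ (hT₁ d (e u))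
  exact congrArg (stdCovec d) (e.apply_symm_apply (T₀ (e u)))

theorem formOf_apply (g : SymForm) (u v : TangentSpace 𝓘(ℝ, Base) p) :
    formOf c p g u v = ∑ a, ∑ b, (g : Fin 4 → Fin 4 → ℝ) a b *
      (coordCovec c p a u * coordCovec c p b v) := by
  simp only [formOf, sum_apply, smul_apply, ContinuousLinearMap.smulRight_apply, smul_eq_mul]

theorem formOf_symm (g : SymForm) (u v : TangentSpace 𝓘(ℝ, Base) p) :
    formOf c p g u v = formOf c p g v u := by
  rw [formOf_apply, formOf_apply, Finset.sum_comm]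
  refine Finset.sum_congr rfl fun a _ => Finset.sum_congr rfl fun b _ => ?_
  rw [g.2 b a, mul_comm (coordCovec c p b u)]

theorem formOf_nondegenerate (hc : c ∈ IsManifold.maximalAtlas 𝓘(ℝ, Base) ∞ M)
    (hp : p ∈ c.source) {g : SymForm} (hg : (toMatrix g).det ≠ 0)
    {u : TangentSpace 𝓘(ℝ, Base) p} (h : ∀ v, formOf c p g u v = 0) : u = 0 := by
  have h1 : Matrix.vecMul (fun a => coordCovec c p a u) (toMatrix g) = 0 := by
    funext b
    have h2 := h (coordVec c p b)
    simp only [formOf_apply, coordCovec_coordVec hc hp, mul_ite, mul_one, mul_zero,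
      Finset.sum_ite_eq', Finset.mem_univ, if_true] at h2
    refine Eq.trans ?_ h2
    change ∑ a, coordCovec c p a u * (g : Fin 4 → Fin 4 → ℝ) a b = _
    exact Finset.sum_congr rfl fun a _ => mul_comm _ _
  have h3 := Matrix.eq_zero_of_vecMul_eq_zero hg h1
  rw [tangent_eq_sum hc hp u]
  exact Finset.sum_eq_zero fun a _ => by rw [congrFun h3 a]; exact zero_smul _ _

/-- The matrix `B` is realized as an automorphism of the tangent space by conjugation with the
chart; it transforms `g_{ab}` by `Bᵀ g B` and covectors by `Bᵀ`. -/
theorem isInvariant_coordMatter {L : MatterLagrangian (V := V) M E} (hL : L.IsNatural)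
    (hc : c ∈ IsManifold.maximalAtlas 𝓘(ℝ, Base) ∞ M) (hτ : τ ∈ trivializationAtlas V E)
    (hx : x ∈ coordDomain c τ) : IsInvariant (coordMatter L c τ) x := by
  intro B hB g g' hg hg' φ w
  have : MemTrivializationAtlas τ := ⟨hτ⟩
  have hp := c.map_target hx.1
  obtain ⟨T, hT⟩ := exists_tangent_equiv hc hp hB
  have h1 := hL (c.symm x) T (formOf c (c.symm x) g) (τ.symm (c.symm x) φ)
    (covecOf c τ (c.symm x) w) (formOf_symm g) (fun u hu => formOf_nondegenerate hc hp hg hu)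
    (formOf c (c.symm x) g') (fun u v => by
      have h2 : ∀ a b, (g' : Fin 4 → Fin 4 → ℝ) a b =
          ∑ p, ∑ q, B p a * (g : Fin 4 → Fin 4 → ℝ) p q * B q b := fun a b => by
        refine (congrFun (congrFun hg' a) b).trans ?_
        simp only [Matrix.mul_apply, Matrix.transpose_apply, Matrix.of_apply, Finset.sum_mul]
        exact Finset.sum_comm
      simp only [formOf_apply, hT, h2, Finset.sum_mul, Finset.mul_sum]
      rw [Finset.sum_congr rfl fun a _ => (Finset.sum_comm.trans (Finset.sum_congr rfl
        fun p _ => Finset.sum_comm)), Finset.sum_comm]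
      refine Finset.sum_congr rfl fun p _ => ?_
      rw [Finset.sum_comm]
      refine Finset.sum_congr rfl fun q _ => ?_
      rw [Finset.sum_comm]
      refine Finset.sum_congr rfl fun a _ => Finset.sum_congr rfl fun b _ => ?_
      ring)
  have h3 : (covecOf c τ (c.symm x) w).comp (T : TangentSpace 𝓘(ℝ, Base) (c.symm x) →L[ℝ]
      TangentSpace 𝓘(ℝ, Base) (c.symm x)) =
      covecOf c τ (c.symm x) (fun b => ∑ d, B d b • w d) := by
    ext u
    have h4 : ∀ v, τ.symm (c.symm x) v = τ.symmₗ ℝ (c.symm x) v := fun v =>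
      (τ.symmₗ_apply (R := ℝ) hx.2 v).symm
    simp only [covecOf, ContinuousLinearMap.comp_apply, sum_apply,
      ContinuousLinearMap.smulRight_apply, ContinuousLinearEquiv.coe_coe, hT, h4, map_sum, map_smul,
      Finset.sum_smul, Finset.smul_sum, smul_smul]
    rw [Finset.sum_comm]
    simp only [mul_comm]
  rw [h3] at h1
  exact h1

end Natural

/-! ### The Einstein equations. -/

section Main

variable {V : Type*} [NormedAddCommGroup V] [NormedSpace ℝ V] [FiniteDimensional ℝ V]
  {M : Type*} [TopologicalSpace M] [T2Space M] [ChartedSpace Base M]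
  [IsManifold 𝓘(ℝ, Base) ∞ M]
  {E : M → Type*} [TopologicalSpace (TotalSpace V E)]
  [∀ p, AddCommGroup (E p)] [∀ p, Module ℝ (E p)] [∀ p, TopologicalSpace (E p)]
  [∀ p, IsTopologicalAddGroup (E p)] [∀ p, ContinuousSMul ℝ (E p)]
  [FiberBundle V E] [VectorBundle ℝ V E] [ContMDiffVectorBundle ∞ V E 𝓘(ℝ, Base)]
  {𝔊 : GaugeGroup V} {c : OpenPartialHomeomorph M Base}
  {τ : Trivialization V (TotalSpace.proj : TotalSpace V E → M)} {x : Base}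

theorem isRegular_coords (L : MatterLagrangian (V := V) M E) (f : Fields (M := M) 𝔊 E)
    (hc : c ∈ IsManifold.maximalAtlas 𝓘(ℝ, Base) ∞ M) (hτ : τ ∈ trivializationAtlas V E) :
    IsRegular (coordMatter L c τ) (f.coords c τ) (coordDomain c τ) where
  isOpen := isOpen_coordDomain
  contDiffAt _ hx := contDiffAt_coords f hc hτ hx
  det_ne_zero _ hx := det_metricCoord_ne_zero f hc hx.1
  conn_symm _ hx := connCoord_symm f hc hx.1
  contDiffAt_matter _ hx :=
    contDiffAt_coordMatter L hc hτ hx (det_metricCoord_ne_zero f hc hx.1) _ _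

/-- The conservation of all the currents `i_{Y[X]} C` forces the total canonical energy-tensor to
vanish. -/
theorem energyTensor_eq_zero_of_conserved {L : MatterLagrangian (V := V) M E}
    {f : Fields (M := M) 𝔊 E}
    (hJ : ∀ X : Π p : M, TangentSpace 𝓘(ℝ, Base) p,
      ContMDiff 𝓘(ℝ, Base) (𝓘(ℝ, Base).prod 𝓘(ℝ, Base)) ∞
        (fun p => TotalSpace.mk' Base p (X p)) → CurrentConserved L f X)
    (hc : c ∈ IsManifold.maximalAtlas 𝓘(ℝ, Base) ∞ M) (hτ : τ ∈ trivializationAtlas V E)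
    (hx : x ∈ coordDomain c τ) (a b : Fin 4) :
    energyTensor (totalDensity (coordMatter L c τ)) (prolongConn (f.coords c τ))
      (f.coords c τ) x a b = 0 := by
  have hreg := isRegular_coords L f hc hτ
  -- This field vanishes at `x` and its only nonzero first derivative is `∂_a X^b = 1`, which
  -- isolates the component `U^a_b`.
  have hw : ContDiff ℝ ∞ fun y : Base => (y a - x a) • stdVec b :=
    ((stdCovec a).contDiff.sub contDiff_const).smul contDiff_const
  obtain ⟨X, hX, hXw⟩ := coordField_eventuallyEq_of_chart hc hx.1 hw
  obtain ⟨hY0, Y', hY, hY'⟩ := hasFDerivAt_prolong (hreg.contDiffAt x hx) hXw (f.coords c τ x)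
  have hs : ContDiffAt ℝ 2 (f.coords c τ) x :=
    (hreg.contDiffAt x hx).of_le (WithTop.coe_le_coe.2 (le_top : (2 : ℕ∞) ≤ ⊤))
  have h1 := pullbackDeriv_current_apply (contDiffAt_totalDensity (j := jet (f.coords c τ) x)
    (hreg.det_ne_zero x hx) (hreg.contDiffAt_matter x hx)) hs hY0 hY hY'
  exact h1.symm.trans (congrArg (fun β => β stdVec) (hJ X hX c hc τ hτ x hx))

theorem einsteinCanonical_of_conserved {L : MatterLagrangian (V := V) M E}
    {f : Fields (M := M) 𝔊 E} (hΓ : ConnFieldEquation L f)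
    (hJ : ∀ X : Π p : M, TangentSpace 𝓘(ℝ, Base) p,
      ContMDiff 𝓘(ℝ, Base) (𝓘(ℝ, Base).prod 𝓘(ℝ, Base)) ∞
        (fun p => TotalSpace.mk' Base p (X p)) → CurrentConserved L f X) :
    EinsteinCanonical L f := by
  intro c hc τ hτ x hx a b
  have hreg := isRegular_coords L f hc hτ
  -- Metricity is needed on the whole domain, not just at `x`, because its derivative controls the
  -- curvature.
  have hH : ∀ y ∈ coordDomain c τ, ∀ r p q, _ := fun y hy =>
    hreg.fderiv_inverse_eq hy (hΓ c hc τ hτ y hy)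
  have h1 := energyTensor_eq_zero_of_conserved hJ hc hτ hx a b
  have h2 : ContDiffAt ℝ ∞ (lagGrav : Jet (Fibre 𝔊) → ℝ) (jet (f.coords c τ) x) :=
    contDiffAt_lagGrav (hreg.det_ne_zero x hx)
  have h3 : ContDiffAt ℝ ∞ (matterDensity (coordMatter L c τ) : Jet (Fibre 𝔊) → ℝ)
      (jet (f.coords c τ) x) :=
    contDiffAt_matterDensity (hreg.det_ne_zero x hx) (hreg.contDiffAt_matter x hx)
  have h4 : ContDiffAt ℝ ∞ (lagGauge : Jet (Fibre 𝔊) → ℝ) (jet (f.coords c τ) x) :=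
    contDiffAt_lagGauge (hreg.det_ne_zero x hx)
  have h5 := energyTensor_add (h2.add h3) h4 (prolongConn (f.coords c τ)) a b
  rw [energyTensor_add h2 h3, hreg.energyTensor_lagGrav hx hH] at h5
  have h6 := h5.symm.trans h1
  have h7 : energyTensor (lagMatter L c τ) (prolongConn (f.coords c τ)) (f.coords c τ) x a b =
    energyTensor (matterDensity (coordMatter L c τ)) (prolongConn (f.coords c τ))
      (f.coords c τ) x a b := rfl
  have h8 : (f.coords c τ x).metric = f.metricCoord c x := rfl
  rw [h7]
  rw [h8] at h6
  linarith

theorem einsteinMetric_of_canonical {L : MatterLagrangian (V := V) M E}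
    {f : Fields (M := M) 𝔊 E} (h : EinsteinCanonical L f) (hL : L.IsNatural) :
    EinsteinMetric L f := by
  intro c hc τ hτ x hx b a
  have hreg := isRegular_coords L f hc hτ
  refine einstein_of_mixed (j := jet (f.coords c τ) x) (hreg.det_ne_zero x hx) (fun d => ?_) b
  have h1 := h c hc τ hτ x hx d a
  have h2 := energyTensor_matterDensity (s := f.coords c τ) (hreg.det_ne_zero x hx)
    (hreg.contDiffAt_matter x hx) (isInvariant_coordMatter hL hc hτ hx) d a
  have h3 := energyTensor_lagGauge (s := f.coords c τ) (hreg.det_ne_zero x hx) d a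
  have h4 : energyTensor (lagMatter L c τ) (prolongConn (f.coords c τ)) (f.coords c τ) x d a =
    energyTensor (matterDensity (coordMatter L c τ)) (prolongConn (f.coords c τ))
      (f.coords c τ) x d a := rfl
  rw [h4, h2, h3] at h1
  refine h1.trans ?_
  simp only [mul_add, Finset.sum_add_distrib]
  rw [neg_inj]
  have h5 : ∀ A B : ℝ, -(1 / 2) * (-2 * A) + -(1 / 2) * (-2 * B) = A + B := fun A B => by ring
  exact h5 _ _

end Main

end MetricAffine

theorem mainTheorem5
    {V : Type*} [NormedAddCommGroup V] [NormedSpace ℝ V] [FiniteDimensional ℝ V]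
    {M : Type*} [TopologicalSpace M] [T2Space M] [ChartedSpace MetricAffine.Base M]
    [IsManifold 𝓘(ℝ, MetricAffine.Base) ∞ M]
    {E : M → Type*} [TopologicalSpace (TotalSpace V E)]
    [∀ p, AddCommGroup (E p)] [∀ p, Module ℝ (E p)] [∀ p, TopologicalSpace (E p)]
    [∀ p, IsTopologicalAddGroup (E p)] [∀ p, ContinuousSMul ℝ (E p)]
    [FiberBundle V E] [VectorBundle ℝ V E]
    [ContMDiffVectorBundle ∞ V E 𝓘(ℝ, MetricAffine.Base)]
    (𝔊 : MetricAffine.GaugeGroup V) (hE : MetricAffine.HasStructureGroup 𝔊 E)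
    (L : MetricAffine.MatterLagrangian (V := V) M E)
    (f : MetricAffine.Fields (M := M) 𝔊 E)
    (hΓ : MetricAffine.ConnFieldEquation L f)
    (hJ : ∀ X : Π p : M, TangentSpace 𝓘(ℝ, MetricAffine.Base) p,
      ContMDiff 𝓘(ℝ, MetricAffine.Base) (𝓘(ℝ, MetricAffine.Base).prod 𝓘(ℝ, MetricAffine.Base)) ∞
        (fun p => TotalSpace.mk' MetricAffine.Base p (X p)) →
      MetricAffine.CurrentConserved L f X) :
    MetricAffine.EinsteinCanonical L f ∧ (L.IsNatural → MetricAffine.EinsteinMetric L f) :=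
  have h := MetricAffine.einsteinCanonical_of_conserved hΓ hJ
  ⟨h, MetricAffine.einsteinMetric_of_canonical h⟩
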